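/- Work on $\mathbb{R}^n$, $n\ge 1$, with Lebesgue measure $dx$ and complex-valued measurable functions. Write $s'=s/(s-1)$ for $s\in(1,\infty)$. A *weight* is a locally integrable function $w$ with $w>0$ a.e.; $w(E)=\int_E w\,dx$; $A_q$ ($1\le q<\infty$) denotes the Muckenhoupt classes, and $\|b\|_{\mathrm{BMO}}=\sup_Q\frac1{|Q|}\int_Q|b-b_Q|\,dx$, the supremum being over all cubes $Q$ and $b_Q$ being the mean of $b$ over $Q$. For $1<p<\infty$ and $0<\lambda<1$ let $L^{p,\lambda}(w)$ be the space of measurable $f$ with $$\|f\|_{L^{p,\lambda}(w)}=\sup_{y\in\mathbb{R}^n,\,\rho>0}\Big(\frac1{w(B(y,\rho))^{\lambda}}\int_{B(y,\rho)}|f|^p\,w\,dx\Big)^{1/p}<\infty .$$ **Lemma.** Let $u\in(1,\infty)$ and $m\in\{0,1,2,\dots\}$. Consider a function $b\in\mathrm{BMO}(\mathbb{R}^n)$, a measurable function $W$ on $\mathbb{R}^n$ with $$\sup_{R>0}R^{n/u}\Big(\int_{R\le|x|\le2R}|W(x)|^{u'}dx\Big)^{1/u'}\le A<\infty,$$ and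 an operator $S$ that maps functions to measurable functions, is sublinear on $L^{p,\lambda}(w)$ (that is, $|S(f+g)|\le|Sf|+|Sg|$ and $|S(cf)|=|c|\,|Sf|$ a.e. for $f,g\in L^{p,\lambda}(w)$ and $c\in\mathbb{C}$), and satisfies, for all $f\in L^{p,\lambda}(w)$ and a.e. $x$, $$|Sf(x)|\le\int_{\mathbb{R}^n}|b(x)-b(y)|^m\,|W(x-y)f(y)|\,dy .$$ Here $p,\lambda,w$ are as in (a) or in (b): (a) $p\in(u,\infty)$, $\lambda\in(0,1)$ and $w\in A_{p/u}$; (b) $p\in(1,u)$, $w$ is a weight with $w^r\in A_1$ for some $r\in(u,\infty)$, and $\lambda\in(0,\,1-r'/u')$. In either case there is $\varepsilon\in(0,1)$, depending only on $n,u,m,p,\lambda,w$ (and $r$ in (b)), and for every $A$ there is a constant $C>0$, depending only on these data and on $A$, such that the following holds for all $b$, $W$, $S$ as above and all $D\ge0$. If $$\|Sf\|_{L^p(w)}\le D\,\|b\|_{\mathrm{BMO}}^m\,\|f\|_{L^p(w)}\quad\text{for all } f\in L^p(w),$$ then for all $f\in L^{p,\lambda}(w)$ one has $Sf\in L^{p,\lambda}(w)$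 and $$\|Sf\|_{L^{p,\lambda}(w)}\le C\,(D+D^{\varepsilon})\,\|b\|_{\mathrm{BMO}}^m\,\|f\|_{L^{p,\lambda}(w)} .$$ For $m=0$ the factors $|b(x)-b(y)|^m$ and $\|b\|_{\mathrm{BMO}}^m$ are $1$. -/

import Mathlib

open MeasureTheory

noncomputable section

namespace WeightedMorrey

/-- The Euclidean space `ℝⁿ`. -/
abbrev E (n : ℕ) : Type := EuclideanSpace ℝ (Fin n)

/-- The cube with sides parallel to the axes, lower corner `a` and side length `l`. -/
def cube {n : ℕ} (a : E n) (l : ℝ) : Set (E n) :=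
  {x | ∀ i, a i ≤ x i ∧ x i ≤ a i + l}

/-- A weight: a locally integrable function that is positive almost everywhere. -/
structure IsWeight {n : ℕ} (w : E n → ℝ) : Prop where
  locallyIntegrable : LocallyIntegrable w volume
  pos : ∀ᵐ x ∂(volume : Measure (E n)), 0 < w x

/-- The measure `w(x) dx`. -/
def weightMeasure {n : ℕ} (w : E n → ℝ) : Measure (E n) :=
  (volume : Measure (E n)).withDensity fun x => ENNReal.ofReal (w x)

/-- The Muckenhoupt class `A_q` for `1 < q < ∞`: the products
`(⨍_Q w) (⨍_Q w ^ (-1/(q-1))) ^ (q-1)` are bounded uniformly over all cubes `Q`. -/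
def IsAp {n : ℕ} (q : ℝ) (w : E n → ℝ) : Prop :=
  IsWeight w ∧ ∃ K : ℝ, ∀ (a : E n) (l : ℝ), 0 < l →
    (⨍⁻ x in cube a l, ENNReal.ofReal (w x) ∂volume) *
      (⨍⁻ x in cube a l, ENNReal.ofReal (w x ^ (-1 / (q - 1))) ∂volume) ^ (q - 1) ≤ ENNReal.ofReal K

/-- The Muckenhoupt class `A_1`: for every cube `Q`, the mean of `w` over `Q` is at most a
constant multiple of `w(x)` for almost every `x ∈ Q`. -/
def IsA1 {n : ℕ} (w : E n → ℝ) : Prop :=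
  IsWeight w ∧ ∃ K : ℝ, ∀ (a : E n) (l : ℝ), 0 < l →
    ∀ᵐ x ∂((volume : Measure (E n)).restrict (cube a l)), (⨍ y in cube a l, w y ∂volume) ≤ K * w x

/-- The seminorm `‖b‖_BMO = sup_Q ⨍_Q |b - b_Q|`, the supremum being over all cubes. -/
def bmoNorm {n : ℕ} (b : E n → ℂ) : ENNReal :=
  ⨆ (a : E n) (l : ℝ) (_ : 0 < l), ⨍⁻ x in cube a l, ‖b x - ⨍ y in cube a l, b y ∂volume‖ₑ ∂volume

/-- `b ∈ BMO(ℝⁿ)`. -/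
structure IsBMO {n : ℕ} (b : E n → ℂ) : Prop where
  locallyIntegrable : LocallyIntegrable b volume
  bmoNorm_lt_top : bmoNorm b < ⊤

/-- The weighted Morrey norm
`sup_{y, r > 0} (w(B(y,r)) ^ (-lam) ∫_{B(y,r)} |f|ᵖ w) ^ (1/p)`. -/
def morreyNorm {n : ℕ} (p lam : ℝ) (w : E n → ℝ) (f : E n → ℂ) : ENNReal :=
  ⨆ (y : E n) (r : ℝ) (_ : 0 < r),
    ((∫⁻ x in Metric.ball y r, ‖f x‖ₑ ^ p ∂(weightMeasure w)) /
      (weightMeasure w (Metric.ball y r)) ^ lam) ^ (1 / p)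

/-- The weighted Morrey space `L^{p,lam}(ℝⁿ, w)`: measurable functions with finite norm. Finiteness
of the norm makes `|f|ᵖ w` locally integrable. -/
def morreySpace {n : ℕ} (p lam : ℝ) (w : E n → ℝ) : Set (E n → ℂ) :=
  {f | AEStronglyMeasurable f volume ∧ morreyNorm p lam w f < ⊤}

/-- `S` maps the functions in `V` to measurable functions, and it is sublinear on `V`:
`|S(f + g)| ≤ |S f| + |S g|` and `|S(c f)| = |c| |S f|`, almost everywhere. -/
structure IsSublinearOn {n : ℕ} (V : Set (E n → ℂ)) (S : (E n → ℂ) → E n → ℂ) : Prop where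
  aestronglyMeasurable : ∀ f ∈ V, AEStronglyMeasurable (S f) volume
  add_le : ∀ f ∈ V, ∀ g ∈ V,
    ∀ᵐ x ∂(volume : Measure (E n)), ‖S (f + g) x‖ ≤ ‖S f x‖ + ‖S g x‖
  smul_eq : ∀ (c : ℂ), ∀ f ∈ V,
    ∀ᵐ x ∂(volume : Measure (E n)), ‖S (c • f) x‖ = ‖c‖ * ‖S f x‖

/-- For every `f ∈ V` and almost every `x`,
`|S f(x)| ≤ ∫ |b(x) - b(y)|ᵐ |W(x - y) f(y)| dy` (the right-hand side may be infinite). -/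
def IsDominatedOn {n : ℕ} (V : Set (E n → ℂ)) (m : ℕ) (b W : E n → ℂ)
    (S : (E n → ℂ) → E n → ℂ) : Prop :=
  ∀ f ∈ V, ∀ᵐ x ∂(volume : Measure (E n)),
    ‖S f x‖ₑ ≤ ∫⁻ y, ‖b x - b y‖ₑ ^ m * ‖W (x - y) * f y‖ₑ

/-- The size condition `sup_{R > 0} R^{n/u} (∫_{R ≤ |x| ≤ 2R} |W|^{u'})^{1/u'} ≤ A`, where
`u' = u / (u - 1)`. -/
structure HasAnnularSize {n : ℕ} (u A : ℝ) (W : E n → ℂ) : Prop where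
  aestronglyMeasurable : AEStronglyMeasurable W volume
  bound : ∀ R : ℝ, 0 < R →
    ENNReal.ofReal (R ^ ((n : ℝ) / u)) *
      (∫⁻ x in {x : E n | R ≤ ‖x‖ ∧ ‖x‖ ≤ 2 * R}, ‖W x‖ₑ ^ u.conjExponent) ^
        (1 / u.conjExponent) ≤ ENNReal.ofReal A

/-- `S` is bounded on `L^p(ℝⁿ, w)` with bound `K`. -/
def IsBoundedOnLp {n : ℕ} (p : ℝ) (w : E n → ℝ) (K : ENNReal)
    (S : (E n → ℂ) → E n → ℂ) : Prop :=
  ∀ f : E n → ℂ, MemLp f (ENNReal.ofReal p) (weightMeasure w) →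
    eLpNorm (S f) (ENNReal.ofReal p) (weightMeasure w) ≤
      K * eLpNorm f (ENNReal.ofReal p) (weightMeasure w)

/-- `S` is bounded on `L^{p,lam}(ℝⁿ, w)` with bound `K`. -/
def IsBoundedOnMorrey {n : ℕ} (p lam : ℝ) (w : E n → ℝ) (K : ENNReal)
    (S : (E n → ℂ) → E n → ℂ) : Prop :=
  ∀ f ∈ morreySpace p lam w,
    S f ∈ morreySpace p lam w ∧ morreyNorm p lam w (S f) ≤ K * morreyNorm p lam w f

end WeightedMorrey

end

noncomputable section

namespace WeightedMorrey

open Filter Topology Set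
open scoped ENNReal

variable {n : ℕ}

/-! Fix a ball B of radius r and split f into its restriction to 2B and its restrictions to the
dyadic shells around it. The part on 2B is handled by the `L^p` bound, because the weight is
doubling; it contributes the term D. The restriction to shell j admits two estimates on B. The `L^p`
bound gives D times a power of 2 growing in j, since the Morrey norm only controls f through `w(2^j
B)^lam`. The pointwise domination gives a bound free of D that decays geometrically in j. Their
weighted geometric mean still decays once the weight ε on the first is small, so the shells sum to a
multiple of `D ^ ε`. Sublinearity permits only finitely many splittings; the remainder beyond shell
J is estimated by the domination alone and vanishes as J → ∞, so no term free of D survives.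

The decaying estimate is the analytic core. With Q and Q' the cubes around B and around shell j, it
has the form `I * w(Q') ≤ C (1 + j)^(m p) 2^(η j) w(Q) F`, where I and F are the p-th power
integrals of the dominating operator over B and of f over the shell. Passing to Morrey norms leaves
`(w(Q) / w(Q'))^(1 - lam)`, which is at most a multiple of `2^(-κ (1 - lam) j)`, so `η < κ (1 -
lam)` is needed. In case (a), Hölder with exponents u', u and the dual weight of `A_{p/u}` give η =
0, and any κ > 0 suffices. In case (b), p < u forces a Fubini argument that costs `η = n (1 - 1/u)`,
while the power of w in `A_1` yields `κ = n (1 - 1/r)`; the required inequality is then exactly `lam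
< 1 - r'/u'`.

The factors `|b(x) - b(y)|^m` are separated into a function of x times a function of y, whose
moments are bounded by a John–Nirenberg inequality. It is proved for every measure under which a
subset filling at most half of a cube carries at most a fixed fraction θ < 1 of its mass. This
covers Lebesgue measure, w, its dual weight and `w^u` at once. -/

/-! ### Cubes and Lebesgue differentiation -/

theorem cube_eq_preimage (a : E n) (l : ℝ) :
    cube a l = (@WithLp.ofLp 2 (Fin n → ℝ)) ⁻¹' Icc (fun i => a i) (fun i => a i + l) := by
  ext x
  simp [cube, Pi.le_def, forall_and]

theorem isCompact_cube (a : E n) (l : ℝ) : IsCompact (cube a l) := by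
  rw [cube_eq_preimage]
  exact (PiLp.homeomorph 2 (fun _ : Fin n => ℝ)).isCompact_preimage.2 isCompact_Icc

theorem measurableSet_cube (a : E n) (l : ℝ) : MeasurableSet (cube a l) :=
  (isCompact_cube a l).measurableSet

theorem volume_cube (a : E n) (l : ℝ) : volume (cube a l) = ENNReal.ofReal l ^ n := by
  rw [cube_eq_preimage, (PiLp.volume_preserving_ofLp (Fin n)).measure_preimage
    measurableSet_Icc.nullMeasurableSet, Real.volume_Icc_pi]
  simp

theorem volume_cube_pos (a : E n) {l : ℝ} (hl : 0 < l) : volume (cube a l) ≠ 0 := by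
  rw [volume_cube]; simp [hl]

theorem volume_cube_ne_top (a : E n) (l : ℝ) : volume (cube a l) ≠ ∞ := by
  rw [volume_cube]; simp

/-- The half-open cube with lower corner `a` and side length `l`. -/
def halfOpenCube (a : E n) (l : ℝ) : Set (E n) := {x | ∀ i, a i ≤ x i ∧ x i < a i + l}

theorem halfOpenCube_eq_preimage (a : E n) (l : ℝ) :
    halfOpenCube a l = (@WithLp.ofLp 2 (Fin n → ℝ)) ⁻¹'
      (Set.univ.pi fun i => Ico (a i) (a i + l)) := by
  ext x
  simp [halfOpenCube]

theorem measurableSet_halfOpenCube (a : E n) (l : ℝ) : MeasurableSet (halfOpenCube a l) := by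
  rw [halfOpenCube_eq_preimage]
  exact (PiLp.volume_preserving_ofLp (Fin n)).measurable
    (MeasurableSet.univ_pi fun i => measurableSet_Ico)

theorem halfOpenCube_subset_cube (a : E n) (l : ℝ) : halfOpenCube a l ⊆ cube a l :=
  fun _ hx i => ⟨(hx i).1, (hx i).2.le⟩

/-- Dyadic cells have to be half-open to be disjoint, while BMO averages are taken over closed
cubes. The faces are null, so averages and masses pass freely between the two. -/
theorem halfOpenCube_ae_eq_cube (a : E n) (l : ℝ) :
    halfOpenCube a l =ᵐ[volume] cube a l := by
  rw [halfOpenCube_eq_preimage, cube_eq_preimage]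
  exact (PiLp.volume_preserving_ofLp (Fin n)).quasiMeasurePreserving.preimage_ae_eq
    Measure.univ_pi_Ico_ae_eq_Icc

theorem setLAverage_congr_set {s t : Set (E n)} (h : s =ᵐ[volume] t) (f : E n → ℝ≥0∞) :
    ⨍⁻ x in s, f x ∂volume = ⨍⁻ x in t, f x ∂volume := by
  rw [setLAverage_eq, setLAverage_eq, setLIntegral_congr h, measure_congr h]

/-- Lebesgue differentiation along cubes shrinking to a point. -/
theorem ae_tendsto_laverage_cube {b : E n → ℂ} (hb : LocallyIntegrable b volume) :
    ∀ᵐ x ∂(volume : Measure (E n)), ∀ (c : ℕ → E n) (l : ℕ → ℝ), (∀ k, 0 < l k) →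
      Tendsto l atTop (𝓝 0) → (∀ k, x ∈ cube (c k) (l k)) →
      Tendsto (fun k => ⨍⁻ y in cube (c k) (l k), ‖b y - b x‖ₑ ∂volume) atTop (𝓝 0) := by
  -- In the sup norm of `Fin n → ℝ` the closed balls are exactly the closed cubes, so the
  -- differentiation theorem for doubling measures applies after transport. The dilation factor is 1
  -- because the point lies in each cube.
  have hmp := PiLp.volume_preserving_toLp (Fin n)
  have hemb : MeasurableEmbedding (@WithLp.toLp 2 (Fin n → ℝ)) :=
    (MeasurableEquiv.toLp 2 (Fin n → ℝ)).measurableEmbedding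
  have hloc : LocallyIntegrable (fun z : Fin n → ℝ => b (WithLp.toLp 2 z)) volume := by
    rw [locallyIntegrable_iff]
    intro k hk
    have hk' : IsCompact ((@WithLp.ofLp 2 (Fin n → ℝ)) ⁻¹' k) :=
      (PiLp.homeomorph 2 (fun _ : Fin n => ℝ)).isCompact_preimage.2 hk
    have := hb.integrableOn_isCompact hk'
    exact (hmp.integrableOn_comp_preimage hemb (s := (@WithLp.ofLp 2 (Fin n → ℝ)) ⁻¹' k)).2 this
  have key := IsUnifLocDoublingMeasure.ae_tendsto_average_norm_sub volume hloc 1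
  have key' := (PiLp.volume_preserving_ofLp (Fin n)).quasiMeasurePreserving.ae key
  filter_upwards [key'] with x hx c l hl hl0 hxc
  have hcub : ∀ k, (@WithLp.toLp 2 (Fin n → ℝ)) ⁻¹' (cube (c k) (l k)) =
      Metric.closedBall (fun i => c k i + l k / 2) (l k / 2) := by
    intro k
    rw [closedBall_pi _ (by linarith [hl k])]
    ext z
    simp only [cube, mem_preimage, mem_ofPred_eq, Real.closedBall_eq_Icc, Set.mem_pi, mem_univ,
      forall_const, mem_Icc]
    refine forall_congr' fun i => ?_
    constructor <;> rintro ⟨h1, h2⟩ <;> constructor <;> linarith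
  have h := hx (fun k i => c k i + l k / 2) (fun k => l k / 2)
    (tendsto_nhdsWithin_iff.2 ⟨by simpa using hl0.div_const 2,
      Eventually.of_forall fun k => half_pos (hl k)⟩)
    (Eventually.of_forall fun k => by
      rw [one_mul, ← hcub]; exact hxc k)
  have h2 : ∀ k, ENNReal.ofReal (⨍ y in Metric.closedBall (fun i => c k i + l k / 2) (l k / 2),
      ‖b (WithLp.toLp 2 y) - b (WithLp.toLp 2 (WithLp.ofLp x))‖) =
      ⨍⁻ y in cube (c k) (l k), ‖b y - b x‖ₑ ∂volume := by
    intro k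
    have hint : IntegrableOn (fun y => b y - b x) (cube (c k) (l k)) :=
      (hb.integrableOn_isCompact (isCompact_cube _ _)).sub
        (integrableOn_const (volume_cube_ne_top _ _))
    rw [setAverage_eq, ← hcub k, hmp.setIntegral_preimage_emb hemb (fun y => ‖b y - b x‖),
      measureReal_def, hmp.measure_preimage_emb hemb, setLAverage_eq,
      ← ofReal_integral_norm_eq_lintegral_enorm hint, smul_eq_mul, mul_comm, ← div_eq_mul_inv,
      ENNReal.ofReal_div_of_pos (ENNReal.toReal_pos (volume_cube_pos _ (hl k))
        (volume_cube_ne_top _ _)), ENNReal.ofReal_toReal (volume_cube_ne_top _ _)]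
  have h3 := (ENNReal.continuous_ofReal.tendsto 0).comp h
  simp only [Function.comp_def, ENNReal.ofReal_zero, h2] at h3
  exact h3

/-- At a Lebesgue point, `‖b x - z‖` is at most the average of `‖b y - b x‖`, which tends to 0 along
the shrinking cubes, plus the average of `‖b y - z‖`, which stays below t. -/
theorem ae_enorm_sub_le_of_laverage_cube_le {b : E n → ℂ} (hb : LocallyIntegrable b volume)
    {l : ℝ} (hl : 0 < l) (z : ℂ) (t : ℝ≥0∞) :
    ∀ᵐ x ∂(volume : Measure (E n)),
      (∀ k : ℕ, ∃ c, x ∈ cube c (l / 2 ^ k) ∧ ⨍⁻ y in cube c (l / 2 ^ k), ‖b y - z‖ₑ ∂volume ≤ t) →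
      ‖b x - z‖ₑ ≤ t := by
  filter_upwards [ae_tendsto_laverage_cube hb] with x hx hk
  choose c hc hct using hk
  have hl0 : Tendsto (fun k : ℕ => l / 2 ^ k) atTop (𝓝 0) :=
    tendsto_const_nhds.div_atTop (tendsto_pow_atTop_atTop_of_one_lt one_lt_two)
  have h := (hx c (fun k => l / 2 ^ k) (fun k => by positivity) hl0 hc).add_const t
  rw [zero_add] at h
  refine ge_of_tendsto' h fun k => ?_
  have hpos : 0 < l / 2 ^ k := by positivity
  have h1 : ∀ y, ‖b x - z‖ₑ ≤ ‖b y - b x‖ₑ + ‖b y - z‖ₑ := fun y => by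
    rw [enorm_sub_rev (b y) (b x)]
    calc ‖b x - z‖ₑ = ‖(b x - b y) + (b y - z)‖ₑ := by ring_nf
      _ ≤ _ := enorm_add_le _ _
  calc ‖b x - z‖ₑ = ⨍⁻ y in cube (c k) (l / 2 ^ k), ‖b x - z‖ₑ ∂volume :=
        (setLAverage_const (volume_cube_pos _ hpos) (volume_cube_ne_top _ _) _).symm
    _ ≤ ⨍⁻ y in cube (c k) (l / 2 ^ k), (‖b y - b x‖ₑ + ‖b y - z‖ₑ) ∂volume := by
        rw [setLAverage_eq, setLAverage_eq]
        gcongr with y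
        exact h1 y
    _ = (⨍⁻ y in cube (c k) (l / 2 ^ k), ‖b y - b x‖ₑ ∂volume) +
          ⨍⁻ y in cube (c k) (l / 2 ^ k), ‖b y - z‖ₑ ∂volume := by
        rw [setLAverage_eq, setLAverage_eq, setLAverage_eq, lintegral_add_left', ENNReal.add_div]
        have := (hb.aestronglyMeasurable.sub
          (aestronglyMeasurable_const (b := b x))).enorm
        exact this.restrict
    _ ≤ _ := by gcongr; exact hct k

/-! ### Dyadic cells and stopping cubes -/

/-- The index of the dyadic subcell of generation `k` that contains `x`. -/
def cellIndex (a : E n) (l : ℝ) (k : ℕ) (x : E n) : Fin n → ℤ := fun i => ⌊(x i - a i) / l * 2 ^ k⌋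

/-- The lower corner of the dyadic subcell of generation `k` and index `ν`. -/
def cellCorner (a : E n) (l : ℝ) (k : ℕ) (ν : Fin n → ℤ) : E n :=
  WithLp.toLp 2 fun i => a i + ν i * (l / 2 ^ k)

theorem mem_halfOpenCube_cellCorner_iff {a : E n} {l : ℝ} (hl : 0 < l) {k : ℕ} {ν : Fin n → ℤ}
    {x : E n} : x ∈ halfOpenCube (cellCorner a l k ν) (l / 2 ^ k) ↔ cellIndex a l k x = ν := by
  rw [funext_iff]
  refine forall_congr' fun i => ?_
  have h2 : (0 : ℝ) < l / 2 ^ k := by positivity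
  have h3 : (x i - a i) / l * 2 ^ k = (x i - a i) / (l / 2 ^ k) := by field_simp
  simp only [cellCorner, cellIndex]
  rw [Int.floor_eq_iff, h3, le_div_iff₀ h2, div_lt_iff₀ h2]
  constructor <;> rintro ⟨h4, h5⟩ <;> constructor <;> linarith

theorem cellIndex_eq_of_le {a : E n} {l : ℝ} {k k' : ℕ} (h : k' ≤ k) {x z : E n}
    (hxz : cellIndex a l k x = cellIndex a l k z) : cellIndex a l k' x = cellIndex a l k' z := by
  obtain ⟨d, rfl⟩ := Nat.exists_eq_add_of_le h
  ext i
  -- Nestedness of the dyadic grid: the coarser index is the integer quotient of the finer one by `2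
  -- ^ d`.
  have key : ∀ y : E n, cellIndex a l k' y i = cellIndex a l (k' + d) y i / ((2 ^ d : ℕ) : ℤ) := by
    intro y
    simp only [cellIndex]
    rw [← Int.floor_div_natCast]
    congr 1
    push_cast
    rw [pow_add]
    field_simp
  rw [key, key, hxz]

theorem cellIndex_zero_eq_zero_iff {a : E n} {l : ℝ} (hl : 0 < l) {x : E n} :
    cellIndex a l 0 x = 0 ↔ x ∈ halfOpenCube a l := by
  rw [← mem_halfOpenCube_cellCorner_iff hl]
  have : cellCorner a l 0 0 = a := by ext i; simp [cellCorner]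
  simp [this]

/-- Calderón–Zygmund stopping cubes of `|b - z|` at height `t`. -/
theorem exists_stopping_cells {b : E n → ℂ} (hb : LocallyIntegrable b volume) {a : E n} {l : ℝ}
    (hl : 0 < l) (z : ℂ) (t : ℝ≥0∞)
    (h : ⨍⁻ y in cube a l, ‖b y - z‖ₑ ∂volume ≤ t) :
    ∃ I : Set (ℕ × (Fin n → ℤ)),
      (∀ i ∈ I, halfOpenCube (cellCorner a l i.1 i.2) (l / 2 ^ i.1) ⊆ cube a l) ∧
      (I.PairwiseDisjoint fun i => halfOpenCube (cellCorner a l i.1 i.2) (l / 2 ^ i.1)) ∧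
      (∀ i ∈ I, t < ⨍⁻ y in cube (cellCorner a l i.1 i.2) (l / 2 ^ i.1), ‖b y - z‖ₑ ∂volume) ∧
      (∀ i ∈ I,
        ⨍⁻ y in cube (cellCorner a l i.1 i.2) (l / 2 ^ i.1), ‖b y - z‖ₑ ∂volume ≤ 2 ^ n * t) ∧
      ∀ᵐ x ∂(volume : Measure (E n)), x ∈ cube a l →
        (∀ i ∈ I, x ∉ halfOpenCube (cellCorner a l i.1 i.2) (l / 2 ^ i.1)) → ‖b x - z‖ₑ ≤ t := by
  set avg : ℕ → (Fin n → ℤ) → ℝ≥0∞ := fun k ν =>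
    ⨍⁻ y in cube (cellCorner a l k ν) (l / 2 ^ k), ‖b y - z‖ₑ ∂volume with havg
  have hcorner : cellCorner a l 0 0 = a := by ext i; simp [cellCorner]
  have hzero : avg 0 0 ≤ t := by simpa [havg, hcorner] using h
  have hsub : ∀ x ∈ halfOpenCube a l, ∀ k,
      halfOpenCube (cellCorner a l k (cellIndex a l k x)) (l / 2 ^ k) ⊆ halfOpenCube a l := by
    intro x hx k y hy
    rw [mem_halfOpenCube_cellCorner_iff hl] at hy
    rw [← cellIndex_zero_eq_zero_iff hl] at hx ⊢
    rw [cellIndex_eq_of_le (Nat.zero_le k) hy, hx]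
  -- The selected cells are the maximal ones with average above t: every strict ancestor still has
  -- average at most t.
  refine ⟨{i | ∃ x ∈ halfOpenCube a l, i.2 = cellIndex a l i.1 x ∧ t < avg i.1 i.2 ∧
    ∀ k < i.1, avg k (cellIndex a l k x) ≤ t}, ?_, ?_, ?_, ?_, ?_⟩
  · rintro ⟨k, ν⟩ ⟨x, hx, hν, -, -⟩
    simp only at hν ⊢
    rw [hν]
    exact (hsub x hx k).trans (halfOpenCube_subset_cube _ _)
  · rintro ⟨k, ν⟩ ⟨x, -, hν, hk, hkx⟩ ⟨k', ν'⟩ ⟨x', -, hν', hk', hkx'⟩ hne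
    simp only [Function.onFun] at *
    rw [Set.disjoint_left]
    intro y hy hy'
    rw [mem_halfOpenCube_cellCorner_iff hl] at hy hy'
    apply hne
    -- If two selected cells of different generations met, the coarser would be an ancestor of the
    -- finer, and its average would be both above and at most t.
    have : k = k' := by
      rcases lt_trichotomy k k' with hlt | heq | hlt
      · exfalso
        refine (hkx' k hlt).not_gt ?_
        rw [← cellIndex_eq_of_le hlt.le (hy'.trans hν'), hy]
        exact hk
      · exact heq
      · exfalso
        refine (hkx k' hlt).not_gt ?_
        rw [← cellIndex_eq_of_le hlt.le (hy.trans hν), hy']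
        exact hk'
    subst this
    rw [← hy, ← hy']
  · rintro ⟨k, ν⟩ ⟨x, -, -, hk, -⟩
    exact hk
  · rintro ⟨k, ν⟩ ⟨x, hx, hν, hk, hkx⟩
    simp only at hν hk hkx
    -- The root is never selected, so a selected cell has a parent. The parent has average at most t
    -- and `2 ^ n` times the volume, whence the bound `2 ^ n * t`.
    rcases k with _ | k
    · rw [hν, (cellIndex_zero_eq_zero_iff hl).2 hx] at hk
      exact absurd hzero hk.not_ge
    have hp := hkx k (Nat.lt_succ_self k)
    have hcont : halfOpenCube (cellCorner a l (k + 1) ν) (l / 2 ^ (k + 1)) ⊆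
        halfOpenCube (cellCorner a l k (cellIndex a l k x)) (l / 2 ^ k) := by
      intro y hy
      rw [mem_halfOpenCube_cellCorner_iff hl] at hy ⊢
      exact cellIndex_eq_of_le k.le_succ (hy.trans hν)
    have hvol : volume (cube (cellCorner a l k (cellIndex a l k x)) (l / 2 ^ k)) =
        2 ^ n * volume (cube (cellCorner a l (k + 1) ν) (l / 2 ^ (k + 1))) := by
      rw [volume_cube, volume_cube, ← mul_pow]
      congr 1
      rw [show (2 : ℝ≥0∞) = ENNReal.ofReal 2 by simp, ← ENNReal.ofReal_mul (by norm_num)]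
      congr 1
      rw [pow_succ]; field_simp
    simp only [havg] at hp ⊢
    rw [← setLAverage_congr_set (halfOpenCube_ae_eq_cube _ _), setLAverage_eq,
      measure_congr (halfOpenCube_ae_eq_cube _ _)] at hp ⊢
    rw [hvol] at hp
    have hv0 := volume_cube_pos (cellCorner a l (k + 1) ν) (l := l / 2 ^ (k + 1)) (by positivity)
    have hvt := volume_cube_ne_top (cellCorner a l (k + 1) ν) (l / 2 ^ (k + 1))
    rw [ENNReal.div_le_iff (mul_ne_zero (by simp) hv0) (ENNReal.mul_ne_top (by simp) hvt)] at hp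
    rw [ENNReal.div_le_iff hv0 hvt]
    calc _ ≤ _ := lintegral_mono_set hcont
      _ ≤ _ := hp
      _ = _ := by ring
  · have hae : ∀ᵐ x ∂(volume : Measure (E n)), x ∈ cube a l → x ∈ halfOpenCube a l :=
      (halfOpenCube_ae_eq_cube a l).symm.le
    filter_upwards [hae, ae_enorm_sub_le_of_laverage_cube_le hb hl z t] with x hx hleb hxQ hxI
    have hx0 := hx hxQ
    -- Otherwise the first generation at which the average around x exceeds t would give a selected
    -- cell containing x.
    have hall : ∀ k, avg k (cellIndex a l k x) ≤ t := by
      by_contra! hcon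
      classical
      have hmin := fun k hk => Nat.find_min hcon (m := k) hk
      refine hxI ⟨Nat.find hcon, cellIndex a l (Nat.find hcon) x⟩
        ⟨x, hx0, rfl, Nat.find_spec hcon, fun k hk => not_lt.1 (hmin k hk)⟩ ?_
      exact (mem_halfOpenCube_cellCorner_iff hl).2 rfl
    refine hleb fun k => ⟨cellCorner a l k (cellIndex a l k x), ?_, hall k⟩
    exact halfOpenCube_subset_cube _ _ ((mem_halfOpenCube_cellCorner_iff hl).2 rfl)

/-! ### The John–Nirenberg inequality and moments of BMO functions -/

theorem enorm_average_sub_le {b : E n → ℂ} (hb : LocallyIntegrable b volume) (a : E n) {l : ℝ}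
    (hl : 0 < l) (z : ℂ) :
    ‖(⨍ y in cube a l, b y ∂volume) - z‖ₑ ≤ ⨍⁻ y in cube a l, ‖b y - z‖ₑ ∂volume := by
  have h0 := volume_cube_pos a hl
  have ht := volume_cube_ne_top a l
  have hint := hb.integrableOn_isCompact (isCompact_cube a l)
  have hz : ⨍ _ in cube a l, z ∂volume = z := setAverage_const h0 ht z
  have : (⨍ y in cube a l, b y ∂volume) - z = ⨍ y in cube a l, (b y - z) ∂volume := by
    conv_lhs => rw [← hz]
    rw [setAverage_eq, setAverage_eq, setAverage_eq, integral_sub hint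
      (integrableOn_const ht), smul_sub]
  rw [this, setAverage_eq, enorm_smul, setLAverage_eq, mul_comm, div_eq_mul_inv]
  gcongr
  · exact enorm_integral_le_lintegral_enorm _
  · rw [measureReal_def, ← ENNReal.toReal_inv, Real.enorm_eq_ofReal ENNReal.toReal_nonneg,
      ENNReal.ofReal_toReal (ENNReal.inv_ne_top.2 h0)]

theorem laverage_le_bmoNorm (b : E n → ℂ) (a : E n) {l : ℝ} (hl : 0 < l) :
    ⨍⁻ x in cube a l, ‖b x - ⨍ y in cube a l, b y ∂volume‖ₑ ∂volume ≤ bmoNorm b :=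
  le_iSup_of_le a (le_iSup_of_le l (le_iSup_of_le hl le_rfl))

/-- A measure for which subsets of at most half of a cube miss a fixed proportion of its mass. -/
structure IsHalfThin (θ : ℝ≥0∞) (μ : Measure (E n)) : Prop where
  ac : μ ≪ volume
  le : ∀ (a : E n) (l : ℝ), 0 < l → ∀ s ⊆ cube a l, MeasurableSet s →
    2 * volume s ≤ volume (cube a l) → μ s ≤ θ * μ (cube a l)

/-- The John–Nirenberg inequality with respect to a half-thin measure. -/
theorem IsHalfThin.measure_tail_le {θ : ℝ≥0∞} {μ : Measure (E n)} (hμ : IsHalfThin θ μ)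
    (hn : 1 ≤ n) {b : E n → ℂ} (hb : LocallyIntegrable b volume) {β : ℝ≥0∞} (hβ0 : β ≠ 0)
    (hβt : β ≠ ∞) (hbβ : bmoNorm b ≤ β) (k : ℕ) (a : E n) (l : ℝ) (hl : 0 < l) :
    μ {x ∈ cube a l | k * (2 ^ (n + 1) * β) ≤ ‖b x - ⨍ y in cube a l, b y ∂volume‖ₑ} ≤
      θ ^ k * μ (cube a l) := by
  induction k generalizing a l with
  | zero => simp
  | succ k ih =>
    set z := ⨍ y in cube a l, b y ∂volume with hz
    have hQ : ⨍⁻ y in cube a l, ‖b y - z‖ₑ ∂volume ≤ β := (laverage_le_bmoNorm b a hl).trans hbβ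
    -- At height `2 * β`, Chebyshev confines the selected cells to at most half of the cube, and
    -- their averages differ from z by at most `2 ^ n * (2 * β)`, which is the increment `2 ^ (n +
    -- 1) * β` of the tail levels.
    obtain ⟨I, hsub, hdisj, hlow, hup, hae⟩ := exists_stopping_cells hb hl z (2 * β)
      (hQ.trans (by rw [two_mul]; exact le_self_add))
    set c : I → E n := fun i => cellCorner a l i.1.1 i.1.2
    set r : I → ℝ := fun i => l / 2 ^ i.1.1
    have hr : ∀ i, 0 < r i := fun i => by simp only [r]; positivity
    set D : I → Set (E n) := fun i => halfOpenCube (c i) (r i)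
    have hDm : ∀ i, MeasurableSet (D i) := fun i => measurableSet_halfOpenCube _ _
    have hDd : Pairwise (Function.onFun Disjoint D) := fun i j hij =>
      hdisj i.2 j.2 (fun h => hij (Subtype.ext h))
    have hDQ : ⋃ i, D i ⊆ cube a l := iUnion_subset fun i => hsub i i.2
    have hhalf : 2 * volume (⋃ i, D i) ≤ volume (cube a l) := by
      rw [← ENNReal.mul_le_mul_iff_right hβ0 hβt]
      calc β * (2 * volume (⋃ i, D i)) = ∑' i, 2 * β * volume (D i) := by
            rw [measure_iUnion hDd hDm, ENNReal.tsum_mul_left]; ring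
        _ ≤ ∑' i, ∫⁻ y in D i, ‖b y - z‖ₑ := by
            refine ENNReal.tsum_le_tsum fun i => ?_
            have := (hlow i i.2).le
            rw [← setLAverage_congr_set (halfOpenCube_ae_eq_cube _ _), setLAverage_eq] at this
            exact ENNReal.mul_le_of_le_div this
        _ = ∫⁻ y in ⋃ i, D i, ‖b y - z‖ₑ := (lintegral_iUnion hDm hDd _).symm
        _ ≤ ∫⁻ y in cube a l, ‖b y - z‖ₑ := lintegral_mono_set hDQ
        _ ≤ β * volume (cube a l) := by
            rw [setLAverage_eq] at hQ
            rwa [ENNReal.div_le_iff (volume_cube_pos a hl) (volume_cube_ne_top a l)] at hQ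
    have hcov : ∀ᵐ x ∂μ,
        x ∈ {x ∈ cube a l | ((k + 1 : ℕ) : ℝ≥0∞) * (2 ^ (n + 1) * β) ≤ ‖b x - z‖ₑ} →
        x ∈ ⋃ i, {x ∈ cube (c i) (r i) |
          k * (2 ^ (n + 1) * β) ≤ ‖b x - ⨍ y in cube (c i) (r i), b y ∂volume‖ₑ} := by
      filter_upwards [hμ.ac.ae_le hae] with x hx ⟨hxQ, hxk⟩
      have hex : ∃ i : I, x ∈ D i := by
        by_contra! hcon
        have h1 := hx hxQ fun i hi => hcon ⟨i, hi⟩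
        -- Outside the cells `‖b x - z‖ ≤ 2 * β`, whereas the level set requires at least `2 ^ (n +
        -- 1) * β`; these are incompatible because n ≥ 1.
        have h2 : (2 : ℝ≥0∞) ^ (n + 1) * β ≤ 2 * β :=
          calc (2 : ℝ≥0∞) ^ (n + 1) * β ≤ ((k + 1 : ℕ) : ℝ≥0∞) * (2 ^ (n + 1) * β) :=
                le_mul_of_one_le_left' (by exact_mod_cast Nat.succ_pos k)
            _ ≤ 2 * β := hxk.trans h1
        rw [ENNReal.mul_le_mul_iff_left hβ0 hβt] at h2
        have h3 : (2 : ℕ) ^ (n + 1) ≤ 2 := by exact_mod_cast h2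
        have h4 : (2 : ℕ) ^ 2 ≤ 2 ^ (n + 1) := Nat.pow_le_pow_right (by norm_num) (by omega)
        omega
      obtain ⟨i, hi⟩ := hex
      refine mem_iUnion.2 ⟨i, halfOpenCube_subset_cube _ _ hi, ?_⟩
      set zi := ⨍ y in cube (c i) (r i), b y ∂volume
      have h1 : ‖zi - z‖ₑ ≤ 2 ^ (n + 1) * β :=
        (enorm_average_sub_le hb (c i) (hr i) z).trans ((hup i i.2).trans_eq (by ring))
      have h2 : ((k + 1 : ℕ) : ℝ≥0∞) * (2 ^ (n + 1) * β) ≤ ‖b x - zi‖ₑ + 2 ^ (n + 1) * β := by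
        calc _ ≤ ‖b x - z‖ₑ := hxk
          _ = ‖(b x - zi) + (zi - z)‖ₑ := by ring_nf
          _ ≤ _ := (enorm_add_le _ _).trans (by gcongr)
      rw [Nat.cast_succ, add_mul, one_mul] at h2
      exact ENNReal.le_of_add_le_add_right (ENNReal.mul_ne_top (by simp) hβt) h2
    -- The induction hypothesis on each cell gives `θ ^ k`; summing over the disjoint cells and
    -- using that they fill at most half of the cube gains one more θ.
    calc _ ≤ μ (⋃ i, {x ∈ cube (c i) (r i) |
          k * (2 ^ (n + 1) * β) ≤ ‖b x - ⨍ y in cube (c i) (r i), b y ∂volume‖ₑ}) :=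
          measure_mono_ae hcov
      _ ≤ ∑' i, θ ^ k * μ (cube (c i) (r i)) :=
          (measure_iUnion_le _).trans (ENNReal.tsum_le_tsum fun i => ih (c i) (r i) (hr i))
      _ = θ ^ k * μ (⋃ i, D i) := by
          rw [ENNReal.tsum_mul_left, measure_iUnion hDd hDm]
          congr 2
          ext i
          exact (measure_congr (hμ.ac.ae_le (halfOpenCube_ae_eq_cube _ _))).symm
      _ ≤ θ ^ k * (θ * μ (cube a l)) := by
          gcongr
          exact hμ.le a l hl _ hDQ (MeasurableSet.iUnion hDm) hhalf
      _ = _ := by ring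

/-- Geometric decay beats powers of k. The base is at least 1, so s may be raised to a natural
exponent N. -/
theorem tsum_linear_rpow_mul_pow_ne_top (c : ℕ) (s : ℝ) {θ : ℝ≥0∞} (hθ : θ < 1) :
    ∑' k : ℕ, (1 + (k + 1) * (c : ℝ≥0∞)) ^ s * θ ^ k ≠ ∞ := by
  obtain ⟨N, hN⟩ := exists_nat_ge s
  have h1 : ∀ k : ℕ, (1 + (k + 1) * (c : ℝ≥0∞)) ^ s * θ ^ k ≤
      ENNReal.ofReal (((1 + c) ^ N * (((k + 1 : ℕ) : ℝ) ^ N * θ.toReal ^ k))) := by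
    intro k
    have hb : (1 + (k + 1) * (c : ℝ≥0∞)) ≤ (1 + c) * ((k + 1 : ℕ) : ℝ≥0∞) := by
      have : (1 + (k + 1) * c) ≤ (1 + c) * (k + 1) := by nlinarith
      exact_mod_cast this
    calc (1 + (k + 1) * (c : ℝ≥0∞)) ^ s * θ ^ k
        ≤ (1 + (k + 1) * (c : ℝ≥0∞)) ^ (N : ℝ) * θ ^ k := by
          gcongr
          exact le_self_add
      _ ≤ ((1 + c) * ((k + 1 : ℕ) : ℝ≥0∞)) ^ N * θ ^ k := by
          rw [ENNReal.rpow_natCast]; gcongr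
      _ = _ := by
          have e1 : (1 + (c : ℝ≥0∞)) = ENNReal.ofReal (1 + c) := by
            rw [ENNReal.ofReal_add (by simp) (by simp)]; simp
          rw [ENNReal.ofReal_mul (by positivity), ENNReal.ofReal_mul (by positivity),
            ENNReal.ofReal_pow (by positivity), ENNReal.ofReal_pow (by positivity),
            ENNReal.ofReal_pow (by positivity), ENNReal.ofReal_toReal hθ.ne_top, ← e1,
            ENNReal.ofReal_natCast, mul_pow, mul_assoc]
  have hθ1 : ‖θ.toReal‖ < 1 := by
    rw [Real.norm_of_nonneg ENNReal.toReal_nonneg]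
    simpa using (ENNReal.toReal_lt_toReal hθ.ne_top ENNReal.one_ne_top).2 hθ
  have hs : Summable fun k : ℕ => (1 + (c : ℝ)) ^ N * (((k + 1 : ℕ) : ℝ) ^ N * θ.toReal ^ k) := by
    refine Summable.mul_left _ ?_
    -- The shift to `(k + 1) ^ N * θ ^ (k + 1)` divides by θ; for θ = 0 only the term k = 0 remains.
    rcases eq_or_ne θ.toReal 0 with h0 | h0
    · refine (hasSum_single 0 fun k hk => ?_).summable
      rw [h0, zero_pow hk, mul_zero]
    · have h2 : Summable fun k : ℕ => ((k + 1 : ℕ) : ℝ) ^ N * θ.toReal ^ (k + 1) :=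
        (summable_nat_add_iff (f := fun k : ℕ => (k : ℝ) ^ N * θ.toReal ^ k) 1).2
          (summable_pow_mul_geometric_of_norm_lt_one N hθ1)
      have e : (fun k : ℕ => ((k + 1 : ℕ) : ℝ) ^ N * θ.toReal ^ k) =
          fun k : ℕ => θ.toReal⁻¹ * (((k + 1 : ℕ) : ℝ) ^ N * θ.toReal ^ (k + 1)) := by
        funext k
        rw [pow_succ, mul_comm (θ.toReal⁻¹), mul_assoc, mul_assoc, mul_inv_cancel₀ h0, mul_one]
      rw [e]
      exact h2.mul_left θ.toReal⁻¹
  refine ne_top_of_le_ne_top ?_ (ENNReal.tsum_le_tsum h1)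
  rw [← ENNReal.ofReal_tsum_of_nonneg (fun k => by positivity) hs]
  exact ENNReal.ofReal_ne_top

/-- Moments of a BMO function with respect to a half-thin measure. -/
theorem exists_lintegral_bmo_le (hn : 1 ≤ n) {θ : ℝ≥0∞} (hθ : θ < 1) {s : ℝ} (hs : 0 ≤ s) :
    ∃ C : ℝ≥0∞, C ≠ ∞ ∧ ∀ (μ : Measure (E n)), IsHalfThin θ μ → ∀ b : E n → ℂ,
      LocallyIntegrable b volume → ∀ β : ℝ≥0∞, β ≠ 0 → β ≠ ∞ → bmoNorm b ≤ β →
      ∀ (a : E n) (l : ℝ), 0 < l →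
        ∫⁻ x in cube a l, (1 + ‖b x - ⨍ y in cube a l, b y ∂volume‖ₑ / β) ^ s ∂μ ≤
          C * μ (cube a l) := by
  refine ⟨_, tsum_linear_rpow_mul_pow_ne_top (2 ^ (n + 1)) s hθ, ?_⟩
  intro μ hμ b hb β hβ0 hβt hbβ a l hl
  set z := ⨍ y in cube a l, b y ∂volume with hz
  set c : ℝ≥0∞ := 2 ^ (n + 1) with hc
  have hc0 : c ≠ 0 := by simp [hc]
  have hct : c ≠ ∞ := by simp [hc]
  set F : ℕ → Set (E n) := fun k => {x | k * (c * β) ≤ ‖b x - z‖ₑ} with hF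
  have hg : AEMeasurable (fun x => ‖b x - z‖ₑ) μ :=
    ((hb.aestronglyMeasurable.mono_ac hμ.ac).sub aestronglyMeasurable_const).enorm
  have hFm : ∀ k, NullMeasurableSet (F k) (μ.restrict (cube a l)) := fun k =>
    nullMeasurableSet_le aemeasurable_const hg.restrict
  -- A single term of the series suffices: the one with k the integer part of `‖b x - z‖ / (c β)`.
  -- Integration then leaves the tail measures.
  have hpt : ∀ x, (1 + ‖b x - z‖ₑ / β) ^ s ≤
      ∑' k : ℕ, (F k).indicator (fun _ => (1 + (k + 1) * c) ^ s) x := by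
    intro x
    have hcβ0 : c * β ≠ 0 := mul_ne_zero hc0 hβ0
    have hcβt : c * β ≠ ∞ := ENNReal.mul_ne_top hct hβt
    set v := ‖b x - z‖ₑ / (c * β) with hv
    have hvt : v ≠ ∞ := ENNReal.div_ne_top enorm_ne_top hcβ0
    set k := ⌊v.toReal⌋₊
    have hkv : (k : ℝ≥0∞) ≤ v := by
      rw [← ENNReal.ofReal_toReal hvt, ← ENNReal.ofReal_natCast]
      exact ENNReal.ofReal_le_ofReal (Nat.floor_le ENNReal.toReal_nonneg)
    have hvk : v ≤ k + 1 := by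
      rw [← ENNReal.ofReal_toReal hvt]
      have : ((k : ℝ≥0∞) + 1) = ENNReal.ofReal (k + 1) := by
        rw [ENNReal.ofReal_add (by simp) (by simp)]; simp
      rw [this]
      exact ENNReal.ofReal_le_ofReal (Nat.lt_floor_add_one _).le
    have hx : x ∈ F k := ENNReal.mul_le_of_le_div hkv
    refine le_trans ?_ (ENNReal.le_tsum k)
    rw [indicator_of_mem hx]
    gcongr
    calc ‖b x - z‖ₑ / β = v * c := by
          rw [hv, ENNReal.div_eq_inv_mul, ENNReal.div_eq_inv_mul,
            ENNReal.mul_inv (Or.inl hc0) (Or.inl hct)]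
          rw [show c⁻¹ * β⁻¹ * ‖b x - z‖ₑ * c = c⁻¹ * c * (β⁻¹ * ‖b x - z‖ₑ) by ring,
            ENNReal.inv_mul_cancel hc0 hct, one_mul]
      _ ≤ _ := by gcongr
  calc ∫⁻ x in cube a l, (1 + ‖b x - z‖ₑ / β) ^ s ∂μ
      ≤ ∫⁻ x in cube a l, ∑' k : ℕ, (F k).indicator (fun _ => (1 + (k + 1) * c) ^ s) x ∂μ :=
        lintegral_mono fun x => hpt x
    _ = ∑' k : ℕ, (1 + (k + 1) * c) ^ s * μ.restrict (cube a l) (F k) := by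
        rw [lintegral_tsum fun k => aemeasurable_const.indicator₀ (hFm k)]
        congr 1; ext k
        rw [lintegral_indicator₀ (hFm k), setLIntegral_const]
    _ ≤ ∑' k : ℕ, (1 + (k + 1) * c) ^ s * (θ ^ k * μ (cube a l)) := by
        refine ENNReal.tsum_le_tsum fun k => ?_
        gcongr
        rw [Measure.restrict_apply₀ (hFm k), inter_comm]
        exact hμ.measure_tail_le hn hb hβ0 hβt hbβ k a l hl
    _ = _ := by
        rw [← ENNReal.tsum_mul_right]
        congr 1; ext k
        rw [← mul_assoc]
        simp [hc]

/-! ### Fair measures: growth and decay on concentric cubes -/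

/-- The closed cube with centre `y` and side length `2 * r`. -/
def centeredCube (y : E n) (r : ℝ) : Set (E n) := cube (WithLp.toLp 2 fun i => y i - r) (2 * r)

theorem ball_subset_centeredCube (y : E n) (r : ℝ) : Metric.ball y r ⊆ centeredCube y r := by
  intro x hx i
  have h1 : |x i - y i| ≤ ‖x - y‖ := by
    simpa using PiLp.norm_apply_le (x - y) i
  rw [Metric.mem_ball, dist_eq_norm] at hx
  have h2 := abs_le.1 (h1.trans hx.le)
  constructor
  · simp only; linarith [h2.1]
  · simp only; linarith [h2.2]

theorem centeredCube_mono (y : E n) {r s : ℝ} (h : r ≤ s) : centeredCube y r ⊆ centeredCube y s := by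
  intro x hx i
  have := hx i
  simp only at this ⊢
  constructor <;> linarith [this.1, this.2]

theorem measurableSet_centeredCube (y : E n) (r : ℝ) : MeasurableSet (centeredCube y r) :=
  measurableSet_cube _ _

theorem volume_centeredCube (y : E n) (r : ℝ) :
    volume (centeredCube y r) = ENNReal.ofReal (2 * r) ^ n := volume_cube _ _

theorem volume_centeredCube_two_pow_mul (y : E n) (r : ℝ) (k : ℕ) :
    volume (centeredCube y (2 ^ k * r)) = (2 ^ k) ^ n * volume (centeredCube y r) := by
  rw [volume_centeredCube, volume_centeredCube, ← mul_pow]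
  congr 1
  rw [show (2 : ℝ≥0∞) ^ k = ENNReal.ofReal (2 ^ k) by
    rw [ENNReal.ofReal_pow (by norm_num)]; simp, ← ENNReal.ofReal_mul (by positivity)]
  congr 1; ring

/-- `μ` is absolutely continuous, finite on cubes, and subsets of a cube that have a large
proportion of its volume have a large proportion of its `μ`-mass. -/
structure IsFair (τ : ℝ) (K : ℝ≥0∞) (μ : Measure (E n)) : Prop where
  ac : μ ≪ volume
  measure_cube_ne_top : ∀ (a : E n) (l : ℝ), 0 < l → μ (cube a l) ≠ ∞
  le : ∀ (a : E n) (l : ℝ), 0 < l → ∀ s ⊆ cube a l, MeasurableSet s →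
    volume s * μ (cube a l) ^ τ ≤ K * volume (cube a l) * μ s ^ τ

/-- If s fills at most half of Q, then `Q \ s` fills at least half, and fairness gives `μ Q ≤ M * μ
(Q \ s)`. Hence s carries at most the fraction `1 - M⁻¹`. -/
theorem IsFair.exists_isHalfThin {τ : ℝ} {K : ℝ≥0∞} (hτ : 0 < τ) (hK : K ≠ ∞) :
    ∃ θ : ℝ≥0∞, θ < 1 ∧ ∀ μ : Measure (E n), IsFair τ K μ → IsHalfThin θ μ := by
  -- The summand 1 keeps M nonzero, so that `M⁻¹` is finite.
  set M : ℝ≥0∞ := (2 * K) ^ (1 / τ) + 1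
  have hMt : M ≠ ∞ := by
    simp only [M]
    refine ENNReal.add_ne_top.2 ⟨ENNReal.rpow_ne_top_of_nonneg (by positivity)
      (ENNReal.mul_ne_top (by simp) hK), by simp⟩
  refine ⟨1 - M⁻¹, ENNReal.sub_lt_self (by simp) (by simp) (by simpa using hMt),
    fun μ hμ => ⟨hμ.ac, ?_⟩⟩
  intro a l hl s hs hsm hhalf
  have hQt := hμ.measure_cube_ne_top a l hl
  have hv0 := volume_cube_pos a hl
  have hvt := volume_cube_ne_top a l
  have hsum : ∀ ν : Measure (E n), ν (cube a l) = ν s + ν (cube a l \ s) := fun ν => by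
    rw [← measure_inter_add_sdiff (cube a l) hsm, inter_eq_self_of_subset_right hs]
  have hvs : volume (cube a l) ≤ 2 * volume (cube a l \ s) := by
    have h1 : 2 * volume (cube a l) = 2 * volume s + 2 * volume (cube a l \ s) := by
      rw [← mul_add, ← hsum]
    rw [two_mul] at h1
    refine ENNReal.le_of_add_le_add_left hvt ?_
    rw [h1]
    gcongr
  have h2 : μ (cube a l) ^ τ ≤ 2 * K * μ (cube a l \ s) ^ τ := by
    rw [← ENNReal.mul_le_mul_iff_right hv0 hvt]
    calc volume (cube a l) * μ (cube a l) ^ τ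
        ≤ 2 * (volume (cube a l \ s) * μ (cube a l) ^ τ) := by
          rw [← mul_assoc]; gcongr
      _ ≤ 2 * (K * volume (cube a l) * μ (cube a l \ s) ^ τ) := by
          exact mul_le_mul_right
            (hμ.le a l hl _ sdiff_subset ((measurableSet_cube a l).diff hsm)) _
      _ = _ := by ring
  have h3 : μ (cube a l) ≤ M * μ (cube a l \ s) := by
    have := ENNReal.rpow_le_rpow h2 (z := 1 / τ) (by positivity)
    rw [ENNReal.mul_rpow_of_nonneg _ _ (by positivity), ← ENNReal.rpow_mul, ← ENNReal.rpow_mul,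
      mul_one_div_cancel hτ.ne', ENNReal.rpow_one, ENNReal.rpow_one] at this
    refine this.trans ?_
    gcongr
    exact le_self_add
  have hM0 : M ≠ 0 := by simp [M]
  have h4 : M⁻¹ * μ (cube a l) ≤ μ (cube a l \ s) := by
    rw [ENNReal.inv_mul_le_iff hM0 hMt]; exact h3
  have h5 := hsum μ
  rw [ENNReal.sub_mul (fun _ _ => hQt), one_mul]
  refine ENNReal.le_sub_of_add_le_right (ENNReal.mul_ne_top (by simpa using hM0) hQt) ?_
  rw [h5]
  gcongr
  rw [← h5]; exact h4

/-- Fair measures grow polynomially on concentric balls and cubes. -/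
theorem IsFair.exists_measure_centeredCube_le {τ : ℝ} {K : ℝ≥0∞} (hτ : 0 < τ) (hK : K ≠ ∞) :
    ∃ C : ℝ≥0∞, C ≠ ∞ ∧ ∀ μ : Measure (E n), IsFair τ K μ → ∀ (y : E n) (r : ℝ), 0 < r →
      ∀ j : ℕ, μ (centeredCube y (2 ^ j * r)) ≤
        C * (2 : ℝ≥0∞) ^ (n / τ * j) * μ (Metric.ball y r) := by
  set ω : ℝ≥0∞ := volume (Metric.ball (0 : E n) 1)
  have hω0 : ω ≠ 0 := (Metric.measure_ball_pos volume _ one_pos).ne'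
  have hωt : ω ≠ ∞ := measure_ball_lt_top.ne
  refine ⟨(K * 2 ^ n * ω⁻¹) ^ (1 / τ), ENNReal.rpow_ne_top_of_nonneg (by positivity)
    (ENNReal.mul_ne_top (ENNReal.mul_ne_top hK (by simp)) (by simpa using hω0)), ?_⟩
  intro μ hμ y r hr j
  set R : ℝ≥0∞ := ENNReal.ofReal r ^ n
  have hR0 : R ≠ 0 := by simp [R, hr]
  have hRt : R ≠ ∞ := by simp [R]
  have hball : volume (Metric.ball y r) = R * ω := by
    rw [Measure.addHaar_ball_of_pos volume y hr, ENNReal.ofReal_pow hr.le]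
    simp [R, ω]
  have hcube : volume (centeredCube y (2 ^ j * r)) = (2 ^ j) ^ n * (2 ^ n * R) := by
    rw [volume_centeredCube_two_pow_mul, volume_centeredCube, ENNReal.ofReal_mul (by norm_num),
      mul_pow]
    simp [R]
  have hsub : Metric.ball y r ⊆ centeredCube y (2 ^ j * r) :=
    (ball_subset_centeredCube y r).trans (centeredCube_mono y
      (le_mul_of_one_le_left hr.le (one_le_pow₀ one_le_two)))
  -- Fairness for the ball inside the dilated cube: the volume ratio is a constant times `2 ^ (n
  -- j)`, and the root of order τ turns this into the exponent `n / τ * j`.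
  have h := hμ.le _ (2 * (2 ^ j * r)) (by positivity) _ hsub measurableSet_ball
  change _ * μ (centeredCube y (2 ^ j * r)) ^ τ ≤
    _ * volume (centeredCube y (2 ^ j * r)) * _ at h
  rw [hball, hcube] at h
  have h2 : μ (centeredCube y (2 ^ j * r)) ^ τ ≤
      K * 2 ^ n * ω⁻¹ * (2 ^ j) ^ n * μ (Metric.ball y r) ^ τ := by
    rw [← ENNReal.mul_le_mul_iff_right (mul_ne_zero hR0 hω0) (ENNReal.mul_ne_top hRt hωt)]
    refine h.trans_eq ?_
    calc _ = (ω⁻¹ * ω) * (K * ((2 ^ j) ^ n * (2 ^ n * R)) * μ (Metric.ball y r) ^ τ) := by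
          rw [ENNReal.inv_mul_cancel hω0 hωt, one_mul]
      _ = _ := by ring
  have h3 := ENNReal.rpow_le_rpow h2 (z := 1 / τ) (by positivity)
  rw [ENNReal.mul_rpow_of_nonneg _ _ (by positivity),
    ENNReal.mul_rpow_of_nonneg _ _ (by positivity), ← ENNReal.rpow_mul, ← ENNReal.rpow_mul,
    mul_one_div_cancel hτ.ne', ENNReal.rpow_one, ENNReal.rpow_one] at h3
  refine h3.trans_eq ?_
  congr 2
  rw [← ENNReal.rpow_natCast, ← ENNReal.rpow_natCast, ← ENNReal.rpow_mul, ← ENNReal.rpow_mul]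
  congr 1
  field_simp

/-- A fair measure in positive dimension decays geometrically on concentric cubes. -/
theorem IsHalfThin.exists_measure_centeredCube_le (hn : 1 ≤ n) {θ : ℝ≥0∞} (hθ : θ < 1) :
    ∃ κ : ℝ, 0 < κ ∧ ∀ μ : Measure (E n), IsHalfThin θ μ → ∀ (y : E n) (r : ℝ), 0 < r →
      ∀ j : ℕ, μ (centeredCube y r) ≤
        (2 : ℝ≥0∞) ^ (-(κ * j)) * μ (centeredCube y (2 ^ j * r)) := by
  -- The maximum keeps t positive, so that `κ = -log₂ t` makes sense even if θ = 0.
  set t : ℝ := max θ.toReal (1 / 2)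
  have ht0 : 0 < t := lt_max_of_lt_right (by norm_num)
  have ht1 : t < 1 := max_lt (by
    simpa using (ENNReal.toReal_lt_toReal hθ.ne_top ENNReal.one_ne_top).2 hθ) (by norm_num)
  have hθt : θ ≤ ENNReal.ofReal t := by
    rw [← ENNReal.ofReal_toReal hθ.ne_top]
    exact ENNReal.ofReal_le_ofReal (le_max_left _ _)
  refine ⟨-Real.logb 2 t, neg_pos.2 (Real.logb_neg one_lt_two ht0 ht1), ?_⟩
  intro μ hμ y r hr j
  have hrate : (2 : ℝ≥0∞) ^ (-(-Real.logb 2 t * j)) = ENNReal.ofReal t ^ j := by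
    rw [neg_mul, neg_neg, ENNReal.rpow_mul, ENNReal.rpow_natCast]
    congr 1
    rw [show (2 : ℝ≥0∞) = ENNReal.ofReal 2 by simp, ENNReal.ofReal_rpow_of_pos two_pos,
      Real.rpow_logb two_pos (by norm_num) ht0]
  rw [hrate]
  clear hrate
  induction j with
  | zero => simp
  | succ j ih =>
    refine ih.trans ?_
    rw [pow_succ, mul_assoc]
    gcongr
    -- Halving the side divides the volume by `2 ^ n ≥ 2`, so the smaller cube fills at most half of
    -- the larger and each doubling gains a factor θ.
    have h := hμ.le _ (2 * (2 ^ (j + 1) * r)) (by positivity) (centeredCube y (2 ^ j * r))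
      (centeredCube_mono y (s := 2 ^ (j + 1) * r) (by
        gcongr
        · norm_num
        · omega))
      (measurableSet_centeredCube _ _) (by
        change _ ≤ volume (centeredCube y (2 ^ (j + 1) * r))
        rw [volume_centeredCube_two_pow_mul, volume_centeredCube_two_pow_mul, ← mul_assoc,
          pow_succ, mul_pow, mul_comm 2]
        gcongr
        calc (2 : ℝ≥0∞) = 2 ^ 1 := (pow_one _).symm
          _ ≤ 2 ^ n := pow_le_pow_right₀ (by norm_num) hn)
    refine h.trans ?_
    change θ * μ (centeredCube y (2 ^ (j + 1) * r)) ≤ _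
    gcongr

/-! ### Muckenhoupt pairs and `A_q` weights -/

/-- A pair of densities satisfying the two-weight form of the Muckenhoupt condition, symmetric
under exchanging the densities and replacing `τ` by `1 - τ`. -/
structure IsMuckenhouptPair (τ : ℝ) (K : ℝ≥0∞) (v σ : E n → ℝ≥0∞) : Prop where
  aemeasurable_left : AEMeasurable v volume
  aemeasurable_right : AEMeasurable σ volume
  one_le : ∀ᵐ x ∂(volume : Measure (E n)), 1 ≤ v x ^ τ * σ x ^ (1 - τ)
  left_ne_top : ∀ (a : E n) (l : ℝ), 0 < l → ∫⁻ x in cube a l, v x ≠ ∞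
  right_ne_top : ∀ (a : E n) (l : ℝ), 0 < l → ∫⁻ x in cube a l, σ x ≠ ∞
  le : ∀ (a : E n) (l : ℝ), 0 < l →
    (∫⁻ x in cube a l, v x) ^ τ * (∫⁻ x in cube a l, σ x) ^ (1 - τ) ≤ K * volume (cube a l)

theorem IsMuckenhouptPair.symm {τ : ℝ} {K : ℝ≥0∞} {v σ : E n → ℝ≥0∞}
    (h : IsMuckenhouptPair τ K v σ) : IsMuckenhouptPair (1 - τ) K σ v where
  aemeasurable_left := h.aemeasurable_right
  aemeasurable_right := h.aemeasurable_left
  one_le := by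
    filter_upwards [h.one_le] with x hx
    rwa [sub_sub_cancel, mul_comm]
  left_ne_top := h.right_ne_top
  right_ne_top := h.left_ne_top
  le a l hl := by
    rw [sub_sub_cancel, mul_comm]
    exact h.le a l hl

/-- Integrating `1 ≤ v ^ τ * σ ^ (1 - τ)` over s, Hölder gives `|s| ≤ v(s) ^ τ * σ(Q) ^ (1 - τ)`.
Multiplying by `v(Q) ^ τ`, the pair condition bounds the product on Q. -/
theorem IsMuckenhouptPair.isFair {τ : ℝ} {K : ℝ≥0∞} {v σ : E n → ℝ≥0∞}
    (h : IsMuckenhouptPair τ K v σ) (hτ0 : 0 < τ) (hτ1 : τ < 1) :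
    IsFair τ K (volume.withDensity v) where
  ac := withDensity_absolutelyContinuous _ _
  measure_cube_ne_top a l hl := by
    rw [withDensity_apply _ (measurableSet_cube a l)]
    exact h.left_ne_top a l hl
  le a l hl s hs hsm := by
    rw [withDensity_apply _ (measurableSet_cube a l), withDensity_apply _ hsm]
    have h1 : volume s ≤ (∫⁻ x in s, v x) ^ τ * (∫⁻ x in cube a l, σ x) ^ (1 - τ) :=
      calc volume s = ∫⁻ _ in s, 1 := (setLIntegral_one s).symm
        _ ≤ ∫⁻ x in s, v x ^ τ * σ x ^ (1 - τ) :=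
            lintegral_mono_ae (ae_restrict_of_ae h.one_le)
        _ ≤ (∫⁻ x in s, v x) ^ τ * (∫⁻ x in s, σ x) ^ (1 - τ) :=
            ENNReal.lintegral_mul_norm_pow_le h.aemeasurable_left.restrict
              h.aemeasurable_right.restrict hτ0.le (by linarith) (by ring)
        _ ≤ _ := by
            gcongr
    calc volume s * (∫⁻ x in cube a l, v x) ^ τ
        ≤ (∫⁻ x in s, v x) ^ τ * (∫⁻ x in cube a l, σ x) ^ (1 - τ) *
            (∫⁻ x in cube a l, v x) ^ τ := by gcongr
      _ = (∫⁻ x in s, v x) ^ τ *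
          ((∫⁻ x in cube a l, v x) ^ τ * (∫⁻ x in cube a l, σ x) ^ (1 - τ)) := by ring
      _ ≤ (∫⁻ x in s, v x) ^ τ * (K * volume (cube a l)) := by
          exact mul_le_mul_right (h.le a l hl) _
      _ = _ := by ring

theorem IsWeight.lintegral_cube_ne_top {w : E n → ℝ} (hw : IsWeight w) (a : E n) (l : ℝ) :
    ∫⁻ x in cube a l, ENNReal.ofReal (w x) ≠ ∞ :=
  (hw.locallyIntegrable.integrableOn_isCompact (isCompact_cube a l)).lintegral_lt_top.ne

theorem IsWeight.lintegral_cube_ne_zero {w : E n → ℝ} (hw : IsWeight w) (a : E n) {l : ℝ}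
    (hl : 0 < l) : ∫⁻ x in cube a l, ENNReal.ofReal (w x) ≠ 0 := by
  intro h
  rw [lintegral_eq_zero_iff' hw.locallyIntegrable.aestronglyMeasurable.aemeasurable.ennreal_ofReal.restrict]
    at h
  have h2 : ∀ᵐ x ∂(volume.restrict (cube a l)), False := by
    filter_upwards [h, ae_restrict_of_ae hw.pos] with x h1 h2
    simp only [Pi.zero_apply, ENNReal.ofReal_eq_zero] at h1
    linarith
  rw [eventually_false_iff_eq_bot, ae_eq_bot, Measure.restrict_eq_zero] at h2
  exact volume_cube_pos a hl h2

/-- This is the `A_q` condition raised to the power 1/q. The dual weight is chosen so that `w ^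
(1/q) * σ ^ (1 - 1/q) = 1` almost everywhere. -/
theorem IsAp.isMuckenhouptPair {q : ℝ} (hq : 1 < q) {w : E n → ℝ} (hw : IsAp q w) :
    ∃ K : ℝ≥0∞, K ≠ ∞ ∧ IsMuckenhouptPair (1 / q) K (fun x => ENNReal.ofReal (w x))
      (fun x => ENNReal.ofReal (w x ^ (-1 / (q - 1)))) := by
  obtain ⟨hw, K, hK⟩ := hw
  have hq0 : 0 < q := by linarith
  have hwm : AEMeasurable w volume := hw.locallyIntegrable.aestronglyMeasurable.aemeasurable
  have hle : ∀ (a : E n) (l : ℝ), 0 < l →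
      (∫⁻ x in cube a l, ENNReal.ofReal (w x)) ^ (1 / q) *
        (∫⁻ x in cube a l, ENNReal.ofReal (w x ^ (-1 / (q - 1)))) ^ (1 - 1 / q) ≤
        ENNReal.ofReal K ^ (1 / q) * volume (cube a l) := by
    intro a l hl
    have h := ENNReal.rpow_le_rpow (hK a l hl) (z := 1 / q) (by positivity)
    rw [ENNReal.mul_rpow_of_nonneg _ _ (by positivity), ← ENNReal.rpow_mul,
      show (q - 1) * (1 / q) = 1 - 1 / q by field_simp, setLAverage_eq, setLAverage_eq,
      ENNReal.div_rpow_of_nonneg _ _ (by positivity), ENNReal.div_rpow_of_nonneg _ _ (by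
        rw [sub_nonneg, div_le_one hq0]; exact hq.le)] at h
    have hv0 := volume_cube_pos a hl
    have hvt := volume_cube_ne_top a l
    set V := volume (cube a l)
    have hV : V ^ (1 / q) * V ^ (1 - 1 / q) = V := by
      rw [← ENNReal.rpow_add _ _ hv0 hvt]; simp
    set X := (∫⁻ x in cube a l, ENNReal.ofReal (w x)) ^ (1 / q)
    set Y := (∫⁻ x in cube a l, ENNReal.ofReal (w x ^ (-1 / (q - 1)))) ^ (1 - 1 / q)
    have h2 : X * Y / V ≤ ENNReal.ofReal K ^ (1 / q) := by
      refine le_of_eq_of_le ?_ h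
      simp only [div_eq_mul_inv (_ : ℝ≥0∞)]
      conv_lhs => rw [← hV]
      rw [ENNReal.mul_inv (Or.inr (by simp [hvt, hv0])) (Or.inr (by simp [hvt, hv0]))]
      exact mul_mul_mul_comm _ _ _ _
    rwa [ENNReal.div_le_iff hv0 hvt] at h2
  refine ⟨_, ENNReal.rpow_ne_top_of_nonneg (by positivity) ENNReal.ofReal_ne_top,
    hwm.ennreal_ofReal, (hwm.pow_const _).ennreal_ofReal, ?_,
    fun a l _ => hw.lintegral_cube_ne_top a l, ?_, hle⟩
  · filter_upwards [hw.pos] with x hx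
    rw [← ENNReal.ofReal_rpow_of_pos hx, ← ENNReal.rpow_mul,
      ← ENNReal.rpow_add _ _ (by simpa using hx) ENNReal.ofReal_ne_top]
    have : 1 / q + -1 / (q - 1) * (1 - 1 / q) = 0 := by
      have : q - 1 ≠ 0 := by linarith
      field_simp; ring
    rw [this, ENNReal.rpow_zero]
  -- Local integrability of the dual weight is not assumed: since w has positive mass on the cube,
  -- an infinite dual mass would make the left side of `hle` infinite.
  · intro a l hl htop
    have h := hle a l hl
    have hpos : 0 < 1 - 1 / q := by rw [sub_pos, div_lt_one hq0]; exact hq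
    have h0 : (∫⁻ x in cube a l, ENNReal.ofReal (w x)) ^ (1 / q) ≠ 0 := by
      have := hw.lintegral_cube_ne_zero a hl
      rw [Ne, ENNReal.rpow_eq_zero_iff_of_pos (by positivity)]
      exact this
    rw [htop, ENNReal.top_rpow_of_pos hpos, ENNReal.mul_top h0, top_le_iff] at h
    exact ENNReal.mul_ne_top (ENNReal.rpow_ne_top_of_nonneg (by positivity)
      ENNReal.ofReal_ne_top) (volume_cube_ne_top a l) h

/-! ### Weights with a power in `A_1` -/

/-- On every cube, `v` is bounded below by a number that controls the mean of `v ^ r` over it. -/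
structure HasLowerMean (r : ℝ) (L : ℝ≥0∞) (v : E n → ℝ≥0∞) : Prop where
  aemeasurable : AEMeasurable v volume
  exists_le : ∀ (a : E n) (l : ℝ), 0 < l → ∃ c : ℝ≥0∞, c ≠ 0 ∧ c ≠ ∞ ∧
    (∀ᵐ x ∂((volume : Measure (E n)).restrict (cube a l)), c ≤ v x) ∧
    ∫⁻ x in cube a l, v x ^ r ≤ volume (cube a l) * (L * c) ^ r

theorem lintegral_rpow_le_of_le {s r : ℝ} (hs : 0 < s) (hsr : s ≤ r) {v : E n → ℝ≥0∞}
    (hv : AEMeasurable v volume) {Q : Set (E n)} {M : ℝ≥0∞} (hQ : volume Q ≠ ∞) (hQ0 : volume Q ≠ 0)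
    (h : ∫⁻ x in Q, v x ^ r ≤ volume Q * M ^ r) :
    ∫⁻ x in Q, v x ^ s ≤ volume Q * M ^ s := by
  have hr : 0 < r := hs.trans_le hsr
  have hsr' : s / r ≤ 1 := (div_le_one hr).2 hsr
  calc ∫⁻ x in Q, v x ^ s = ∫⁻ x in Q, (v x ^ r) ^ (s / r) * (1 : ℝ≥0∞) ^ (1 - s / r) := by
        congr 1; ext x
        rw [← ENNReal.rpow_mul, ENNReal.one_rpow, mul_one, mul_div_cancel₀ _ hr.ne']
    _ ≤ (∫⁻ x in Q, v x ^ r) ^ (s / r) * (∫⁻ _ in Q, 1) ^ (1 - s / r) :=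
        ENNReal.lintegral_mul_norm_pow_le (hv.pow_const _).restrict aemeasurable_const
          (by positivity) (by linarith) (by ring)
    _ ≤ (volume Q * M ^ r) ^ (s / r) * (volume Q) ^ (1 - s / r) := by
        rw [setLIntegral_one]
        gcongr
    _ = _ := by
        rw [ENNReal.mul_rpow_of_nonneg _ _ (by positivity), ← ENNReal.rpow_mul,
          mul_div_cancel₀ _ hr.ne', mul_right_comm, ← ENNReal.rpow_add _ _ hQ0 hQ]
        simp

theorem HasLowerMean.mono {s r : ℝ} (hs : 0 < s) (hsr : s ≤ r) {L : ℝ≥0∞} {v : E n → ℝ≥0∞}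
    (h : HasLowerMean r L v) : HasLowerMean s L v := by
  refine ⟨h.aemeasurable, fun a l hl => ?_⟩
  obtain ⟨c, hc0, hct, hcv, hint⟩ := h.exists_le a l hl
  exact ⟨c, hc0, hct, hcv, lintegral_rpow_le_of_le hs hsr h.aemeasurable (volume_cube_ne_top a l)
    (volume_cube_pos a hl) hint⟩

/-- The lower bound gives `c ^ r * |s| ≤ ∫_s v ^ r`, while the mean of `v ^ r` over the cube is at
most `(L c) ^ r`; the number c cancels. -/
theorem HasLowerMean.isFair {r : ℝ} (hr : 0 < r) {L : ℝ≥0∞} (hL : L ≠ ∞) {v : E n → ℝ≥0∞}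
    (h : HasLowerMean r L v) : IsFair 1 (L ^ r) (volume.withDensity fun x => v x ^ r) where
  ac := withDensity_absolutelyContinuous _ _
  measure_cube_ne_top a l hl := by
    obtain ⟨c, hc0, hct, hcv, hint⟩ := h.exists_le a l hl
    rw [withDensity_apply _ (measurableSet_cube a l)]
    exact ne_top_of_le_ne_top (ENNReal.mul_ne_top (volume_cube_ne_top a l)
      (ENNReal.rpow_ne_top_of_nonneg hr.le (ENNReal.mul_ne_top hL hct))) hint
  le a l hl s hs hsm := by
    obtain ⟨c, hc0, hct, hcv, hint⟩ := h.exists_le a l hl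
    rw [withDensity_apply _ (measurableSet_cube a l), withDensity_apply _ hsm, ENNReal.rpow_one,
      ENNReal.rpow_one]
    have h1 : c ^ r * volume s ≤ ∫⁻ x in s, v x ^ r := by
      rw [← setLIntegral_const]
      refine lintegral_mono_ae ?_
      filter_upwards [ae_restrict_of_ae_restrict_of_subset hs hcv] with x hx
      gcongr
    calc _ ≤ volume s * (volume (cube a l) * (L * c) ^ r) := by gcongr
      _ = L ^ r * volume (cube a l) * (c ^ r * volume s) := by
          rw [ENNReal.mul_rpow_of_nonneg _ _ hr.le]; ring
      _ ≤ _ := by gcongr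

/-- The number c is `(m / K') ^ (1 / r)` with m the mean of `w ^ r`: the `A_1` condition says that
it bounds w from below, and `L = K' ^ (1 / r)` restores the mean. -/
theorem IsA1.hasLowerMean {r : ℝ} (hr : 0 < r) {w : E n → ℝ} (hw : IsWeight w)
    (h : IsA1 fun x => w x ^ r) :
    ∃ L : ℝ≥0∞, L ≠ ∞ ∧ HasLowerMean r L fun x => ENNReal.ofReal (w x) := by
  obtain ⟨hwr, K, hK⟩ := h
  set K' : ℝ := max K 1
  have hK' : 0 < K' := lt_max_of_lt_right one_pos
  refine ⟨ENNReal.ofReal (K' ^ (1 / r)), ENNReal.ofReal_ne_top,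
    hw.locallyIntegrable.aestronglyMeasurable.aemeasurable.ennreal_ofReal, fun a l hl => ?_⟩
  have hv0 := volume_cube_pos a hl
  have hvt := volume_cube_ne_top a l
  have hint := hwr.locallyIntegrable.integrableOn_isCompact (isCompact_cube a l)
  have hl1 : ∫⁻ x in cube a l, ENNReal.ofReal (w x) ^ r =
      ENNReal.ofReal (∫ x in cube a l, w x ^ r) := by
    rw [ofReal_integral_eq_lintegral_ofReal hint
      (ae_restrict_of_ae (hwr.pos.mono fun x hx => hx.le))]
    refine lintegral_congr_ae (ae_restrict_of_ae ?_)
    filter_upwards [hw.pos] with x hx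
    rw [ENNReal.ofReal_rpow_of_pos hx]
  have hI0 : 0 < ∫ x in cube a l, w x ^ r := by
    have h1 := hwr.lintegral_cube_ne_zero a hl
    rw [← ofReal_integral_eq_lintegral_ofReal hint
      (ae_restrict_of_ae (hwr.pos.mono fun x hx => hx.le))] at h1
    simpa using h1
  set V : ℝ := volume.real (cube a l)
  have hV : 0 < V := ENNReal.toReal_pos hv0 hvt
  have hVe : ENNReal.ofReal V = volume (cube a l) := ENNReal.ofReal_toReal hvt
  set m : ℝ := ⨍ x in cube a l, w x ^ r ∂volume with hm
  have hmI : ∫ x in cube a l, w x ^ r = V * m := by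
    rw [hm, setAverage_eq, smul_eq_mul, mul_inv_cancel_left₀ hV.ne']
  have hm0 : 0 < m := by
    rw [hmI] at hI0
    exact (mul_pos_iff_of_pos_left hV).1 hI0
  refine ⟨ENNReal.ofReal ((m / K') ^ (1 / r)), ?_, ENNReal.ofReal_ne_top, ?_, ?_⟩
  · simp only [ne_eq, ENNReal.ofReal_eq_zero, not_le]; positivity
  · filter_upwards [hK a l hl, ae_restrict_of_ae hw.pos] with x hx hx0
    refine ENNReal.ofReal_le_ofReal ?_
    have h1 : m / K' ≤ w x ^ r := by
      rw [div_le_iff₀' hK']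
      exact hx.trans (by gcongr; exact le_max_left _ _)
    calc (m / K') ^ (1 / r) ≤ (w x ^ r) ^ (1 / r) := by gcongr
      _ = w x := by rw [← Real.rpow_mul hx0.le, mul_one_div_cancel hr.ne', Real.rpow_one]
  · rw [hl1, hmI, ← ENNReal.ofReal_mul (by positivity),
      ENNReal.ofReal_rpow_of_pos (by positivity), ENNReal.ofReal_mul hV.le,
      ← Real.mul_rpow hK'.le (by positivity), mul_div_cancel₀ _ hK'.ne',
      ← Real.rpow_mul hm0.le, one_div_mul_cancel hr.ne', Real.rpow_one, hVe]

/-- Reverse-Hölder decay of a weight on concentric cubes. -/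
theorem HasLowerMean.lintegral_centeredCube_le {r : ℝ} (hr : 1 < r) {L : ℝ≥0∞}
    {v : E n → ℝ≥0∞} (h : HasLowerMean r L v) (y : E n) {ρ : ℝ} (hρ : 0 < ρ) (j : ℕ) :
    ∫⁻ x in centeredCube y ρ, v x ≤
      L * (2 : ℝ≥0∞) ^ (-(n * (1 - 1 / r) * j)) * ∫⁻ x in centeredCube y (2 ^ j * ρ), v x := by
  have hr0 : 0 < r := by linarith
  have hr1 : 0 ≤ 1 - 1 / r := by rw [sub_nonneg, div_le_one hr0]; exact hr.le
  have hpos : 0 < 2 * (2 ^ j * ρ) := by positivity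
  obtain ⟨c, hc0, hct, hcv, hint⟩ := h.exists_le (WithLp.toLp 2 fun i => y i - 2 ^ j * ρ)
    (2 * (2 ^ j * ρ)) hpos
  change ∀ᵐ x ∂(volume.restrict (centeredCube y (2 ^ j * ρ))), _ at hcv
  change ∫⁻ x in centeredCube y (2 ^ j * ρ), _ ≤ volume (centeredCube y (2 ^ j * ρ)) * _ at hint
  have hv0 : volume (centeredCube y (2 ^ j * ρ)) ≠ 0 := volume_cube_pos _ hpos
  have hvt : volume (centeredCube y (2 ^ j * ρ)) ≠ ∞ := volume_cube_ne_top _ _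
  have hu0 : volume (centeredCube y ρ) ≠ 0 := volume_cube_pos _ (by positivity)
  have hut : volume (centeredCube y ρ) ≠ ∞ := volume_cube_ne_top _ _
  have hvol := volume_centeredCube_two_pow_mul y ρ j
  set V := volume (centeredCube y (2 ^ j * ρ))
  set U := volume (centeredCube y ρ)
  have hsub : centeredCube y ρ ⊆ centeredCube y (2 ^ j * ρ) :=
    centeredCube_mono y (le_mul_of_one_le_left hρ.le (one_le_pow₀ one_le_two))
  -- Hölder on the small cube, with `v ^ r` integrated over the large one. The lower bound c there
  -- turns `c * V` back into the mass of the large cube, and the volume ratio to the power `1 - 1 /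
  -- r` is the decay.
  have h1 : ∫⁻ x in centeredCube y ρ, v x ≤ V ^ (1 / r) * (L * c) * U ^ (1 - 1 / r) :=
    calc ∫⁻ x in centeredCube y ρ, v x
        = ∫⁻ x in centeredCube y ρ, (v x ^ r) ^ (1 / r) * (1 : ℝ≥0∞) ^ (1 - 1 / r) := by
          congr 1; ext x
          rw [← ENNReal.rpow_mul, ENNReal.one_rpow, mul_one, mul_one_div_cancel hr0.ne',
            ENNReal.rpow_one]
      _ ≤ (∫⁻ x in centeredCube y ρ, v x ^ r) ^ (1 / r) *
          (∫⁻ _ in centeredCube y ρ, 1) ^ (1 - 1 / r) :=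
          ENNReal.lintegral_mul_norm_pow_le (h.aemeasurable.pow_const _).restrict
            aemeasurable_const (by positivity) hr1 (by ring)
      _ ≤ (V * (L * c) ^ r) ^ (1 / r) * U ^ (1 - 1 / r) := by
          rw [setLIntegral_one]
          gcongr
          exact (lintegral_mono_set hsub).trans hint
      _ = _ := by
          rw [ENNReal.mul_rpow_of_nonneg _ _ (by positivity), ← ENNReal.rpow_mul,
            mul_one_div_cancel hr0.ne', ENNReal.rpow_one]
  have h2 : c * V ≤ ∫⁻ x in centeredCube y (2 ^ j * ρ), v x := by
    rw [← setLIntegral_const]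
    exact lintegral_mono_ae hcv
  have h3 : V ^ (1 / r) * U ^ (1 - 1 / r) = (2 : ℝ≥0∞) ^ (-(n * (1 - 1 / r) * j)) * V := by
    have hU : U = (2 : ℝ≥0∞) ^ (-((n : ℝ) * j)) * V := by
      rw [hvol, ← mul_assoc, ← ENNReal.rpow_natCast, ← ENNReal.rpow_natCast, ← ENNReal.rpow_mul,
        ← ENNReal.rpow_add _ _ (by norm_num) (by norm_num)]
      rw [show -((n : ℝ) * j) + j * n = 0 by ring, ENNReal.rpow_zero, one_mul]
    conv_lhs => rw [hU]
    rw [ENNReal.mul_rpow_of_nonneg _ _ hr1, mul_left_comm, ← ENNReal.rpow_add _ _ hv0 hvt,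
      ← ENNReal.rpow_mul, show 1 / r + (1 - 1 / r) = 1 by ring, ENNReal.rpow_one]
    congr 2; ring
  calc _ ≤ V ^ (1 / r) * (L * c) * U ^ (1 - 1 / r) := h1
    _ = L * c * (V ^ (1 / r) * U ^ (1 - 1 / r)) := by ring
    _ = L * (2 : ℝ≥0∞) ^ (-(n * (1 - 1 / r) * j)) * (c * V) := by rw [h3]; ring
    _ ≤ _ := by gcongr

/-! ### Size of the kernel on annuli -/

/-- The `L^{u'}` norm of `W` over the annulus `R ≤ |x| ≤ 8 R`. -/
def annularNorm (u : ℝ) (W : E n → ℂ) (R : ℝ) : ℝ≥0∞ :=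
  (∫⁻ x in {x : E n | R ≤ ‖x‖ ∧ ‖x‖ ≤ 8 * R}, ‖W x‖ₑ ^ u.conjExponent) ^ (1 / u.conjExponent)

theorem measurableSet_annulus (R S : ℝ) : MeasurableSet {x : E n | R ≤ ‖x‖ ∧ ‖x‖ ≤ S} :=
  (measurableSet_le measurable_const measurable_norm).inter
    (measurableSet_le measurable_norm measurable_const)

/-- Three dyadic annuli, of inner radii R, 2R and 4R, cover the wide one; on each the normalisation
`S ^ (n/u)` is at least `R ^ (n/u)`. -/
theorem HasAnnularSize.annularNorm_mul_le {u A : ℝ} (hu : 1 < u) {W : E n → ℂ}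
    (h : HasAnnularSize u A W) {R : ℝ} (hR : 0 < R) :
    annularNorm u W R * (ENNReal.ofReal (8 * R) ^ n) ^ (1 / u) ≤
      3 ^ (1 / u.conjExponent) * (8 ^ n) ^ (1 / u) * ENNReal.ofReal A := by
  have hu0 : 0 < u := by linarith
  have hq : 0 < u.conjExponent := (Real.HolderConjugate.conjExponent hu).symm.pos
  set q := u.conjExponent with hqdef
  set X := ENNReal.ofReal (R ^ ((n : ℝ) / u)) with hX
  have hX0 : X ≠ 0 := by simp only [hX, ne_eq, ENNReal.ofReal_eq_zero, not_le]; positivity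
  have hXt : X ≠ ∞ := ENNReal.ofReal_ne_top
  have hpiece : ∀ S, R ≤ S →
      ∫⁻ x in {x : E n | S ≤ ‖x‖ ∧ ‖x‖ ≤ 2 * S}, ‖W x‖ₑ ^ q ≤ (ENNReal.ofReal A / X) ^ q := by
    intro S hS
    have h1 := h.bound S (hR.trans_le hS)
    rw [← hqdef] at h1
    have h2 : (∫⁻ x in {x : E n | S ≤ ‖x‖ ∧ ‖x‖ ≤ 2 * S}, ‖W x‖ₑ ^ q) ^ (1 / q) ≤
        ENNReal.ofReal A / X := by
      rw [ENNReal.le_div_iff_mul_le (Or.inl hX0) (Or.inl hXt), mul_comm]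
      refine le_trans ?_ h1
      gcongr
      exact ENNReal.ofReal_le_ofReal (Real.rpow_le_rpow hR.le hS (by positivity))
    have h3 := ENNReal.rpow_le_rpow h2 hq.le
    rwa [← ENNReal.rpow_mul, one_div_mul_cancel hq.ne', ENNReal.rpow_one] at h3
  have hcov : {x : E n | R ≤ ‖x‖ ∧ ‖x‖ ≤ 8 * R} ⊆
      ({x : E n | R ≤ ‖x‖ ∧ ‖x‖ ≤ 2 * R} ∪ {x : E n | 2 * R ≤ ‖x‖ ∧ ‖x‖ ≤ 2 * (2 * R)}) ∪
        {x : E n | 4 * R ≤ ‖x‖ ∧ ‖x‖ ≤ 2 * (4 * R)} := by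
    rintro x ⟨h1, h2⟩
    rcases le_total ‖x‖ (2 * R) with h3 | h3
    · exact Or.inl (Or.inl ⟨h1, h3⟩)
    · rcases le_total ‖x‖ (4 * R) with h4 | h4
      · exact Or.inl (Or.inr ⟨h3, by linarith⟩)
      · exact Or.inr ⟨h4, by linarith⟩
  have hint : ∫⁻ x in {x : E n | R ≤ ‖x‖ ∧ ‖x‖ ≤ 8 * R}, ‖W x‖ₑ ^ q ≤
      3 * (ENNReal.ofReal A / X) ^ q := by
    calc _ ≤ _ := lintegral_mono_set hcov
      _ ≤ _ := lintegral_union_le _ _ _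
      _ ≤ _ := add_le_add (lintegral_union_le _ _ _) le_rfl
      _ ≤ ((ENNReal.ofReal A / X) ^ q + (ENNReal.ofReal A / X) ^ q) +
          (ENNReal.ofReal A / X) ^ q :=
          add_le_add (add_le_add (hpiece _ le_rfl) (hpiece _ (by linarith)))
            (hpiece _ (by linarith))
      _ = _ := by ring
  have h8 : (ENNReal.ofReal (8 * R) ^ n) ^ (1 / u) = (8 ^ n) ^ (1 / u) * X := by
    rw [ENNReal.ofReal_mul (by norm_num), mul_pow, ENNReal.mul_rpow_of_nonneg _ _ (by positivity),
      hX, ← ENNReal.ofReal_rpow_of_pos hR, ← ENNReal.rpow_natCast (ENNReal.ofReal R),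
      ← ENNReal.rpow_mul, mul_one_div]
    simp
  rw [h8]
  calc annularNorm u W R * ((8 ^ n) ^ (1 / u) * X)
      ≤ (3 * (ENNReal.ofReal A / X) ^ q) ^ (1 / q) * ((8 ^ n) ^ (1 / u) * X) := by
        gcongr
        exact ENNReal.rpow_le_rpow hint (by positivity)
    _ = 3 ^ (1 / q) * (8 ^ n) ^ (1 / u) * (ENNReal.ofReal A / X * X) := by
        rw [ENNReal.mul_rpow_of_nonneg _ _ (by positivity), ← ENNReal.rpow_mul,
          mul_one_div_cancel hq.ne', ENNReal.rpow_one]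
        ring
    _ = _ := by rw [ENNReal.div_mul_cancel hX0 hXt]

/-- Hölder with exponents u' and u. The map φ is left general because the kernel is integrated both
in z, with `φ z = x - z`, and, after Fubini, in x, with `φ x = x - z`. -/
theorem lintegral_mul_le_annularNorm {u : ℝ} (hu : 1 < u) {W : E n → ℂ} {R : ℝ}
    {s : Set (E n)} (hs : MeasurableSet s) {φ : E n → E n}
    (hφ : Measure.QuasiMeasurePreserving φ volume volume)
    (hφi : ∀ h : E n → ℝ≥0∞, ∫⁻ z, h (φ z) = ∫⁻ z, h z) (hW : AEStronglyMeasurable W volume)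
    (hφs : ∀ z ∈ s, R ≤ ‖φ z‖ ∧ ‖φ z‖ ≤ 8 * R) {g : E n → ℝ≥0∞}
    (hg : AEMeasurable g (volume.restrict s)) :
    ∫⁻ z in s, ‖W (φ z)‖ₑ * g z ≤ annularNorm u W R * (∫⁻ z in s, g z ^ u) ^ (1 / u) := by
  have hc := Real.HolderConjugate.conjExponent hu
  have hWφ : AEMeasurable (fun z => ‖W (φ z)‖ₑ) (volume.restrict s) :=
    (hW.comp_quasiMeasurePreserving hφ).enorm.restrict
  refine (ENNReal.lintegral_mul_le_Lp_mul_Lq _ hc.symm hWφ hg).trans ?_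
  gcongr
  unfold annularNorm
  refine ENNReal.rpow_le_rpow ?_ (one_div_nonneg.2 hc.symm.nonneg)
  rw [← lintegral_indicator (measurableSet_annulus R (8 * R)), ← hφi, ← lintegral_indicator hs]
  refine lintegral_mono fun z => ?_
  by_cases hz : z ∈ s
  · rw [indicator_of_mem hz, indicator_of_mem (show φ z ∈ {x : E n | R ≤ ‖x‖ ∧ ‖x‖ ≤ 8 * R} from hφs z hz)]
  · rw [indicator_of_notMem hz]; exact zero_le

/-! ### The gauge of a BMO function -/

/-- `1 + |b - b_Q| / β`, where `Q` is the centred cube with centre `y` and side length `2 * r`. -/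
def gauge (b : E n → ℂ) (β : ℝ≥0∞) (y : E n) (r : ℝ) (x : E n) : ℝ≥0∞ :=
  1 + ‖b x - ⨍ z in centeredCube y r, b z ∂volume‖ₑ / β

theorem aemeasurable_gauge {b : E n → ℂ} {μ : Measure (E n)} (hb : AEStronglyMeasurable b μ)
    (β : ℝ≥0∞) (y : E n) (r : ℝ) : AEMeasurable (gauge b β y r) μ :=
  ((hb.sub aestronglyMeasurable_const).enorm.div_const β).const_add 1

/-- Since `s + t ≤ (1 + s) * (1 + t)`, the summand 1 in the gauge turns the triangle inequality
through the mean into a product, which separates the variables x and z. -/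
theorem enorm_sub_le_gauge (b : E n → ℂ) {β : ℝ≥0∞} (hβ0 : β ≠ 0) (hβt : β ≠ ∞) (y : E n) (r : ℝ)
    (x z : E n) : ‖b x - b z‖ₑ ≤ β * (gauge b β y r x * gauge b β y r z) := by
  unfold gauge
  set c := ⨍ z in centeredCube y r, b z ∂volume
  calc ‖b x - b z‖ₑ = ‖(b x - c) - (b z - c)‖ₑ := by ring_nf
    _ ≤ ‖b x - c‖ₑ + ‖b z - c‖ₑ := enorm_sub_le
    _ = β * (‖b x - c‖ₑ / β + ‖b z - c‖ₑ / β) := by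
        rw [mul_add, ENNReal.mul_div_cancel hβ0 hβt, ENNReal.mul_div_cancel hβ0 hβt]
    _ ≤ _ := by
        gcongr
        ring_nf
        rw [add_assoc, add_assoc]
        refine le_trans ?_ le_add_self
        gcongr
        exact le_add_self

/-- Telescoping over doublings: the average over the smaller cube of the oscillation on the larger
is at most `2 ^ n * β`. -/
theorem enorm_average_sub_average_le {b : E n → ℂ} (hb : LocallyIntegrable b volume) {β : ℝ≥0∞}
    (hbβ : bmoNorm b ≤ β) (y : E n) {r : ℝ} (hr : 0 < r) (k : ℕ) :
    ‖(⨍ z in centeredCube y (2 ^ k * r), b z ∂volume) - ⨍ z in centeredCube y r, b z ∂volume‖ₑ ≤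
      k * (2 ^ n * β) := by
  induction k with
  | zero => simp
  | succ k ih =>
    set c0 := ⨍ z in centeredCube y r, b z ∂volume
    set c1 := ⨍ z in centeredCube y (2 ^ k * r), b z ∂volume with hc1
    set c2 := ⨍ z in centeredCube y (2 ^ (k + 1) * r), b z ∂volume with hc2
    have hpos : 0 < 2 * (2 ^ k * r) := by positivity
    have hpos' : 0 < 2 * (2 ^ (k + 1) * r) := by positivity
    have h1 : ‖c1 - c2‖ₑ ≤ 2 ^ n * β := by
      refine (enorm_average_sub_le hb _ hpos c2).trans ?_
      have h2 := (laverage_le_bmoNorm b (WithLp.toLp 2 fun i => y i - 2 ^ (k + 1) * r) hpos').trans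
        hbβ
      change ⨍⁻ x in centeredCube y (2 ^ (k + 1) * r), ‖b x - c2‖ₑ ∂volume ≤ β at h2
      change ⨍⁻ x in centeredCube y (2 ^ k * r), ‖b x - c2‖ₑ ∂volume ≤ _
      have hv0 : volume (centeredCube y (2 ^ k * r)) ≠ 0 := volume_cube_pos _ hpos
      have hvt : volume (centeredCube y (2 ^ k * r)) ≠ ∞ := volume_cube_ne_top _ _
      have hvol : volume (centeredCube y (2 ^ (k + 1) * r)) =
          2 ^ n * volume (centeredCube y (2 ^ k * r)) := by
        rw [volume_centeredCube_two_pow_mul, volume_centeredCube_two_pow_mul, ← mul_assoc,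
          ← mul_pow, pow_succ, mul_comm 2]
      rw [setLAverage_eq, hvol, ENNReal.div_le_iff (mul_ne_zero (by simp) hv0)
        (ENNReal.mul_ne_top (by simp) hvt)] at h2
      rw [setLAverage_eq, ENNReal.div_le_iff hv0 hvt]
      calc _ ≤ _ := lintegral_mono_set (centeredCube_mono y (s := 2 ^ (k + 1) * r) (by
            gcongr
            · norm_num
            · omega))
        _ ≤ _ := h2
        _ = _ := by ring
    calc ‖c2 - c0‖ₑ = ‖(c1 - c0) - (c1 - c2)‖ₑ := by ring_nf
      _ ≤ ‖c1 - c0‖ₑ + ‖c1 - c2‖ₑ := enorm_sub_le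
      _ ≤ k * (2 ^ n * β) + 2 ^ n * β := add_le_add ih h1
      _ = _ := by push_cast; ring

/-- Recentring the gauge from Q to its dilate by `2 ^ (j + 2)` moves the mean by at most `(j + 2) *
2 ^ n * β`. The loss is only linear in j, which geometric decay can absorb. -/
theorem gauge_le_mul_gauge {b : E n → ℂ} (hb : LocallyIntegrable b volume) {β : ℝ≥0∞}
    (hβ0 : β ≠ 0) (hβt : β ≠ ∞) (hbβ : bmoNorm b ≤ β) (y : E n) {r : ℝ} (hr : 0 < r) (j : ℕ)
    (x : E n) :
    gauge b β y r x ≤ 2 ^ (n + 2) * (1 + j) * gauge b β y (2 ^ (j + 2) * r) x := by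
  have h := enorm_average_sub_average_le hb hbβ y hr (j + 2)
  unfold gauge
  set c0 := ⨍ z in centeredCube y r, b z ∂volume
  set c1 := ⨍ z in centeredCube y (2 ^ (j + 2) * r), b z ∂volume
  set X := ‖b x - c1‖ₑ / β
  have h1 : ‖b x - c0‖ₑ / β ≤ X + (j + 2) * 2 ^ n := by
    rw [ENNReal.div_le_iff hβ0 hβt, add_mul, ENNReal.div_mul_cancel hβ0 hβt]
    calc ‖b x - c0‖ₑ = ‖(b x - c1) + (c1 - c0)‖ₑ := by ring_nf
      _ ≤ ‖b x - c1‖ₑ + ‖c1 - c0‖ₑ := enorm_add_le _ _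
      _ ≤ ‖b x - c1‖ₑ + (j + 2) * 2 ^ n * β := by
          gcongr
          refine h.trans_eq ?_
          push_cast; ring
  have hone : (1 : ℝ≥0∞) ≤ 2 ^ n := one_le_pow₀ (by norm_num)
  have h2 : 1 + (j + 2) * 2 ^ n ≤ (2 : ℝ≥0∞) ^ (n + 2) * (1 + j) := by
    have : 1 + (j + 2) * 2 ^ n ≤ 2 ^ (n + 2) * (1 + j) := by
      have := Nat.one_le_two_pow (n := n)
      rw [pow_add]
      nlinarith [Nat.zero_le (j * 2 ^ n)]
    exact_mod_cast this
  have h3 : (1 : ℝ≥0∞) ≤ 2 ^ (n + 2) * (1 + j) :=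
    le_trans (by exact le_self_add) h2
  calc 1 + ‖b x - c0‖ₑ / β ≤ 1 + (X + (j + 2) * 2 ^ n) := by gcongr
    _ = (1 + (j + 2) * 2 ^ n) + X := by ring
    _ ≤ 2 ^ (n + 2) * (1 + j) + 2 ^ (n + 2) * (1 + j) * X := by
        gcongr
        exact le_mul_of_one_le_left' h3
    _ = _ := by ring

/-! ### Shells and the dominating operator -/

/-- The dyadic annulus `2 ^ (j + 1) * r ≤ |x - y| < 2 ^ (j + 2) * r`. -/
def shell (y : E n) (r : ℝ) (j : ℕ) : Set (E n) :=
  Metric.ball y (2 ^ (j + 2) * r) \ Metric.ball y (2 ^ (j + 1) * r)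

theorem measurableSet_shell (y : E n) (r : ℝ) (j : ℕ) : MeasurableSet (shell y r j) :=
  measurableSet_ball.diff measurableSet_ball

theorem shell_subset_ball (y : E n) (r : ℝ) (j : ℕ) :
    shell y r j ⊆ Metric.ball y (2 ^ (j + 2) * r) := sdiff_subset

theorem shell_subset_centeredCube (y : E n) (r : ℝ) (j : ℕ) :
    shell y r j ⊆ centeredCube y (2 ^ (j + 2) * r) :=
  (shell_subset_ball y r j).trans (ball_subset_centeredCube _ _)

/-- With `R = 2 ^ j * r`, z is at distance between 2R and 4R from y and x is within R of it, so `|x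
- z|` lies between R and 5R. The looser bound 8R fits the three dyadic annuli and the side of the
cube around the shell. -/
theorem norm_sub_of_mem_shell {y : E n} {r : ℝ} {j : ℕ} {x z : E n}
    (hx : x ∈ Metric.ball y r) (hz : z ∈ shell y r j) :
    2 ^ j * r ≤ ‖x - z‖ ∧ ‖x - z‖ ≤ 8 * (2 ^ j * r) := by
  have h1 := hz.1
  have h2 := hz.2
  rw [Metric.mem_ball] at hx h1
  rw [Metric.mem_ball, not_lt] at h2
  have hr : 0 < r := dist_nonneg.trans_lt hx
  rw [← dist_eq_norm]
  have h3 : (1 : ℝ) ≤ 2 ^ j := one_le_pow₀ one_le_two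
  have h4 : r ≤ 2 ^ j * r := le_mul_of_one_le_left hr.le h3
  have h5 := dist_triangle z x y
  have h6 := dist_triangle_right x z y
  rw [dist_comm z x] at h5
  have e1 : (2 : ℝ) ^ (j + 1) * r = 2 * (2 ^ j * r) := by ring
  have e2 : (2 : ℝ) ^ (j + 2) * r = 4 * (2 ^ j * r) := by ring
  rw [e1] at h2
  rw [e2] at h1
  constructor <;> linarith

/-- The dominating operator applied to the restriction of `f` to `s`. -/
def kernelOp (m : ℕ) (b W : E n → ℂ) (s : Set (E n)) (f : E n → ℂ) (x : E n) : ℝ≥0∞ :=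
  ∫⁻ z in s, ‖b x - b z‖ₑ ^ m * ‖W (x - z) * f z‖ₑ

theorem kernelOp_le {m : ℕ} {b W f : E n → ℂ} {β : ℝ≥0∞} (hβ0 : β ≠ 0) (hβt : β ≠ ∞)
    (hb : AEStronglyMeasurable b volume) (hW : AEStronglyMeasurable W volume)
    (hf : AEStronglyMeasurable f volume) (s : Set (E n)) (y : E n) (r : ℝ) (x : E n) :
    kernelOp m b W s f x ≤ (β ^ m * gauge b β y r x ^ m) *
      ∫⁻ z in s, ‖W (x - z)‖ₑ * (gauge b β y r z ^ m * ‖f z‖ₑ) := by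
  have hWx : AEMeasurable (fun z => ‖W (x - z)‖ₑ) (volume.restrict s) :=
    (hW.comp_quasiMeasurePreserving (quasiMeasurePreserving_sub_left volume x)).enorm.restrict
  have hG : AEMeasurable (fun z => gauge b β y r z ^ m * ‖f z‖ₑ) (volume.restrict s) :=
    (((aemeasurable_gauge hb β y r).pow_const m).mul hf.enorm).restrict
  have hWG : AEMeasurable (fun z => ‖W (x - z)‖ₑ * (gauge b β y r z ^ m * ‖f z‖ₑ))
    (volume.restrict s) := hWx.mul hG
  rw [← lintegral_const_mul'' _ hWG]
  refine lintegral_mono fun z => ?_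
  calc ‖b x - b z‖ₑ ^ m * ‖W (x - z) * f z‖ₑ
      ≤ (β * (gauge b β y r x * gauge b β y r z)) ^ m * (‖W (x - z)‖ₑ * ‖f z‖ₑ) := by
        rw [enorm_mul]
        gcongr
        exact enorm_sub_le_gauge b hβ0 hβt y r x z
    _ = _ := by rw [mul_pow, mul_pow]; ring

theorem setLIntegral_withDensity_eq {v : E n → ℝ≥0∞} (hv : AEMeasurable v volume)
    {s : Set (E n)} (hs : MeasurableSet s) {h : E n → ℝ≥0∞}
    (hh : AEMeasurable h (volume.restrict s)) :
    ∫⁻ x in s, h x ∂(volume.withDensity v) = ∫⁻ x in s, v x * h x := by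
  rw [restrict_withDensity hs, lintegral_withDensity_eq_lintegral_mul₀ hv.restrict hh]
  rfl

theorem aemeasurable_kernel {W : E n → ℂ} (hW : AEStronglyMeasurable W volume) (s t : Set (E n)) :
    AEMeasurable (fun q : E n × E n => ‖W (q.1 - q.2)‖ₑ)
      ((volume.restrict s).prod (volume.restrict t)) := by
  rw [Measure.prod_restrict]
  exact (hW.comp_quasiMeasurePreserving (quasiMeasurePreserving_sub volume volume)).enorm.restrict

/-- An `L^p(μ)` bound on `ball y r` for the dominating operator acting on functions supported in
the `j`-th shell around that ball, with the growth rate `2 ^ (η j)`. -/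
def HasShellBound (u p η : ℝ) (m : ℕ) (μ : Measure (E n)) : Prop :=
  ∃ C : ℝ≥0∞, C ≠ ∞ ∧ ∀ (A : ℝ) (b W : E n → ℂ) (β : ℝ≥0∞), IsBMO b → bmoNorm b ≤ β → β ≠ 0 →
    β ≠ ∞ → HasAnnularSize u A W → ∀ (y : E n) (r : ℝ), 0 < r → ∀ (j : ℕ) (f : E n → ℂ),
      AEStronglyMeasurable f volume →
      (∫⁻ x in Metric.ball y r, kernelOp m b W (shell y r j) f x ^ p ∂μ) *
          μ (centeredCube y (2 ^ (j + 2) * r)) ≤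
        C * ENNReal.ofReal A ^ p * (β ^ m) ^ p * (1 + j) ^ (m * p) * 2 ^ (η * j) *
          μ (centeredCube y r) * ∫⁻ x in shell y r j, ‖f x‖ₑ ^ p ∂μ

theorem annularNorm_mul_volume_le {u A : ℝ} (hu : 1 < u) {W : E n → ℂ}
    (h : HasAnnularSize u A W) (y : E n) {r : ℝ} (hr : 0 < r) (j : ℕ) :
    annularNorm u W (2 ^ j * r) * volume (centeredCube y (2 ^ (j + 2) * r)) ^ (1 / u) ≤
      3 ^ (1 / u.conjExponent) * (8 ^ n) ^ (1 / u) * ENNReal.ofReal A := by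
  rw [volume_centeredCube, show 2 * (2 ^ (j + 2) * r) = 8 * (2 ^ j * r) by ring]
  exact h.annularNorm_mul_le hu (by positivity)

/-- Moments are available for the gauge centred at the large cube, whereas the estimates use one
gauge, centred at the small cube, for both variables. Recentring costs a power of `1 + j`. -/
theorem lintegral_gauge_rpow_le {s : ℝ} (hs : 0 ≤ s) {C : ℝ≥0∞} {μ : Measure (E n)}
    {b : E n → ℂ} (hb : LocallyIntegrable b volume) {β : ℝ≥0∞} (hβ0 : β ≠ 0) (hβt : β ≠ ∞)
    (hbβ : bmoNorm b ≤ β) (y : E n) {r : ℝ} (hr : 0 < r) (j : ℕ)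
    (hμ : ∫⁻ x in centeredCube y (2 ^ (j + 2) * r), gauge b β y (2 ^ (j + 2) * r) x ^ s ∂μ ≤
      C * μ (centeredCube y (2 ^ (j + 2) * r))) (hac : μ ≪ volume) :
    ∫⁻ x in centeredCube y (2 ^ (j + 2) * r), gauge b β y r x ^ s ∂μ ≤
      (2 ^ (n + 2) * (1 + j)) ^ s * (C * μ (centeredCube y (2 ^ (j + 2) * r))) := by
  calc _ ≤ ∫⁻ x in centeredCube y (2 ^ (j + 2) * r),
        (2 ^ (n + 2) * (1 + j)) ^ s * gauge b β y (2 ^ (j + 2) * r) x ^ s ∂μ := by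
        refine lintegral_mono fun x => ?_
        rw [← ENNReal.mul_rpow_of_nonneg _ _ hs]
        gcongr
        exact gauge_le_mul_gauge hb hβ0 hβt hbβ y hr j x
    _ = (2 ^ (n + 2) * (1 + j)) ^ s *
          ∫⁻ x in centeredCube y (2 ^ (j + 2) * r), gauge b β y (2 ^ (j + 2) * r) x ^ s ∂μ := by
        refine lintegral_const_mul'' _ (AEMeasurable.pow_const ?_ s)
        exact (aemeasurable_gauge (hb.aestronglyMeasurable.mono_ac hac) _ _ _).restrict
    _ ≤ _ := by gcongr

/-! ### Shell bounds in the two cases -/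

/-- As u < p, the kernel is removed by Hölder with exponents u' and u, and the `L^u` norm of f times
its gauge factor is bounded by the weighted `L^p` norm of f and gauge moments for the dual weight.
The pair condition on Q' and the annular size of W cancel all volumes, so there is no growth in j
beyond the polynomial factor. -/
theorem IsMuckenhouptPair.hasShellBound (hn : 1 ≤ n) {u p : ℝ} (hu : 1 < u) (hup : u < p) (m : ℕ)
    {K : ℝ≥0∞} (hK : K ≠ ∞) {v σ : E n → ℝ≥0∞} (h : IsMuckenhouptPair (u / p) K v σ) :
    HasShellBound u p 0 m (volume.withDensity v) := by
  have hu0 : 0 < u := by linarith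
  have hp0 : 0 < p := by linarith
  set τ := u / p with hτ
  have hτ0 : 0 < τ := by positivity
  have hτ1 : τ < 1 := (div_lt_one hp0).2 hup
  have hτ1' : 0 < 1 - τ := by linarith
  have hpτ : p * τ = u := by rw [hτ]; field_simp
  obtain ⟨θv, hθv, hHv⟩ := IsFair.exists_isHalfThin (n := n) hτ0 hK
  obtain ⟨θσ, hθσ, hHσ⟩ := IsFair.exists_isHalfThin (n := n) hτ1' hK
  have hv := hHv _ (h.isFair hτ0 hτ1)
  have hσ := hHσ _ (h.symm.isFair hτ1' (by linarith))
  -- Chosen so that `(G ^ s) ^ (1 - τ) = G ^ (m u)`: the whole gauge factor goes with the dual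
  -- weight in Hölder.
  set s : ℝ := m * u / (1 - τ) with hs
  have hs0 : 0 ≤ s := by positivity
  obtain ⟨C1, hC1, hm1⟩ := exists_lintegral_bmo_le hn hθσ hs0
  obtain ⟨C2, hC2, hm2⟩ := exists_lintegral_bmo_le hn hθv (s := m * p) (by positivity)
  set c : ℝ≥0∞ := 3 ^ (1 / u.conjExponent) * (8 ^ n) ^ (1 / u) with hc
  have hct : c ≠ ∞ := ENNReal.mul_ne_top
    (ENNReal.rpow_ne_top_of_nonneg
      (one_div_nonneg.2 (Real.HolderConjugate.conjExponent hu).symm.nonneg) (by norm_num))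
    (ENNReal.rpow_ne_top_of_nonneg (by positivity) (by simp))
  set μ := volume.withDensity v
  set μσ := volume.withDensity σ
  have hac : μ ≪ volume := withDensity_absolutelyContinuous _ _
  refine ⟨c ^ p * C1 ^ ((1 - τ) / τ) * K ^ (1 / τ) * C2 * (2 ^ (n + 2)) ^ (m * p), ?_, ?_⟩
  · have e1 : c ^ p ≠ ∞ := ENNReal.rpow_ne_top_of_nonneg hp0.le hct
    have e2 : C1 ^ ((1 - τ) / τ) ≠ ∞ := ENNReal.rpow_ne_top_of_nonneg (by positivity) hC1
    have e3 : K ^ (1 / τ) ≠ ∞ := ENNReal.rpow_ne_top_of_nonneg (by positivity) hK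
    have e4 : ((2 : ℝ≥0∞) ^ (n + 2)) ^ (m * p) ≠ ∞ :=
      ENNReal.rpow_ne_top_of_nonneg (by positivity) (by simp)
    exact ENNReal.mul_ne_top (ENNReal.mul_ne_top (ENNReal.mul_ne_top (ENNReal.mul_ne_top e1 e2) e3)
      hC2) e4
  intro A b W β hb hbβ hβ0 hβt hW y r hr j f hf
  have hbl := hb.locallyIntegrable
  have hbm := hbl.aestronglyMeasurable
  set Q := centeredCube y r
  set Q' := centeredCube y (2 ^ (j + 2) * r)
  set S := shell y r j
  set G := gauge b β y r
  set ω := annularNorm u W (2 ^ j * r)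
  set Λ : ℝ≥0∞ := 2 ^ (n + 2) * (1 + j)
  have hGm : AEMeasurable G volume := aemeasurable_gauge hbm _ _ _
  have hGm' : AEMeasurable G μ := aemeasurable_gauge (hbm.mono_ac hac) _ _ _
  set F := ∫⁻ x in S, ‖f x‖ₑ ^ p ∂μ with hF
  have hFv : F = ∫⁻ x in S, v x * ‖f x‖ₑ ^ p :=
    setLIntegral_withDensity_eq h.aemeasurable_left (measurableSet_shell y r j)
      (hf.enorm.pow_const p).restrict
  set J := ∫⁻ z in S, (G z ^ m * ‖f z‖ₑ) ^ u with hJ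
  have step1 : ∀ x ∈ Metric.ball y r,
      kernelOp m b W S f x ≤ β ^ m * G x ^ m * (ω * J ^ (1 / u)) := by
    intro x hx
    refine (kernelOp_le hβ0 hβt hbm hW.aestronglyMeasurable hf S y r x).trans ?_
    gcongr
    exact lintegral_mul_le_annularNorm hu (measurableSet_shell y r j)
      (quasiMeasurePreserving_sub_left volume x) (fun h => lintegral_sub_left_eq_self h x)
      hW.aestronglyMeasurable (fun z hz => norm_sub_of_mem_shell hx hz)
      ((hGm.pow_const m).mul hf.enorm).restrict
  have step2 : J ≤ F ^ τ * (Λ ^ s * (C1 * μσ Q')) ^ (1 - τ) := by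
    calc J ≤ ∫⁻ z in S, (v z * ‖f z‖ₑ ^ p) ^ τ * (σ z * G z ^ s) ^ (1 - τ) := by
          refine lintegral_mono_ae (ae_restrict_of_ae ?_)
          filter_upwards [h.one_le] with z hz
          calc (G z ^ m * ‖f z‖ₑ) ^ u
              ≤ (v z ^ τ * σ z ^ (1 - τ)) * (G z ^ m * ‖f z‖ₑ) ^ u := le_mul_of_one_le_left' hz
            _ = _ := by
              rw [ENNReal.mul_rpow_of_nonneg _ _ hu0.le, ENNReal.mul_rpow_of_nonneg _ _ hτ0.le,
                ENNReal.mul_rpow_of_nonneg _ _ hτ1'.le, ← ENNReal.rpow_mul, hpτ,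
                ← ENNReal.rpow_natCast, ← ENNReal.rpow_mul, ← ENNReal.rpow_mul, hs,
                div_mul_cancel₀ _ hτ1'.ne']
              ring
      _ ≤ (∫⁻ z in S, v z * ‖f z‖ₑ ^ p) ^ τ * (∫⁻ z in S, σ z * G z ^ s) ^ (1 - τ) :=
          ENNReal.lintegral_mul_norm_pow_le
            (h.aemeasurable_left.mul (hf.enorm.pow_const p)).restrict
            (h.aemeasurable_right.mul (hGm.pow_const s)).restrict hτ0.le hτ1'.le (by ring)
      _ ≤ _ := by
          rw [hFv]
          gcongr
          calc ∫⁻ z in S, σ z * G z ^ s ≤ ∫⁻ z in Q', σ z * G z ^ s :=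
                lintegral_mono_set (shell_subset_centeredCube y r j)
            _ = ∫⁻ z in Q', G z ^ s ∂μσ :=
                (setLIntegral_withDensity_eq h.aemeasurable_right
                  (measurableSet_centeredCube _ _) (hGm.pow_const s).restrict).symm
            _ ≤ _ := lintegral_gauge_rpow_le hs0 hbl hβ0 hβt hbβ y hr j
                (hm1 μσ hσ b hbl β hβ0 hβt hbβ _ _ (by positivity))
                (withDensity_absolutelyContinuous _ _)
  have step3 : ∫⁻ x in Metric.ball y r, kernelOp m b W S f x ^ p ∂μ ≤
      (β ^ m * (ω * J ^ (1 / u))) ^ p * (C2 * μ Q) := by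
    calc _ ≤ ∫⁻ x in Metric.ball y r, (β ^ m * (ω * J ^ (1 / u))) ^ p * G x ^ (m * p) ∂μ := by
          refine setLIntegral_mono' measurableSet_ball fun x hx => ?_
          rw [ENNReal.rpow_mul, ENNReal.rpow_natCast, ← ENNReal.mul_rpow_of_nonneg _ _ hp0.le]
          gcongr
          exact (step1 x hx).trans_eq (by ring)
      _ = (β ^ m * (ω * J ^ (1 / u))) ^ p * ∫⁻ x in Metric.ball y r, G x ^ (m * p) ∂μ :=
          lintegral_const_mul'' _ (hGm'.pow_const _).restrict
      _ ≤ _ := by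
          gcongr
          exact (lintegral_mono_set (ball_subset_centeredCube y r)).trans
            (hm2 μ hv b hbl β hβ0 hβt hbβ _ _ (by positivity))
  have hJp : (J ^ (1 / u)) ^ p ≤
      F * (Λ ^ (m * p) * (C1 ^ ((1 - τ) / τ) * (μσ Q') ^ ((1 - τ) / τ))) := by
    have e1 : (J ^ (1 / u)) ^ p = J ^ (1 / τ) := by
      rw [← ENNReal.rpow_mul]; congr 1; rw [hτ]; field_simp
    rw [e1]
    refine (ENNReal.rpow_le_rpow step2 (by positivity)).trans_eq ?_
    rw [ENNReal.mul_rpow_of_nonneg _ _ (by positivity), ← ENNReal.rpow_mul,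
      mul_one_div_cancel hτ0.ne', ENNReal.rpow_one, ← ENNReal.rpow_mul, mul_one_div,
      ENNReal.mul_rpow_of_nonneg (Λ ^ s) _ (by positivity), ← ENNReal.rpow_mul,
      ENNReal.mul_rpow_of_nonneg C1 _ (by positivity)]
    congr 3
    rw [hs, ← mul_div_assoc, div_mul_cancel₀ _ hτ1'.ne', ← hpτ]; field_simp
  -- The pair condition to the power 1/τ. Since `1 / τ = p / u`, the power of `|Q'|` it leaves is
  -- the one absorbed by `ω ^ p`.
  have hQ' : (μσ Q') ^ ((1 - τ) / τ) * μ Q' ≤ K ^ (1 / τ) * volume Q' ^ (1 / τ) := by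
    have h1 := ENNReal.rpow_le_rpow (h.le (WithLp.toLp 2 fun i => y i - 2 ^ (j + 2) * r)
      (2 * (2 ^ (j + 2) * r)) (by positivity)) (z := 1 / τ) (by positivity)
    rw [ENNReal.mul_rpow_of_nonneg _ _ (by positivity), ← ENNReal.rpow_mul,
      mul_one_div_cancel hτ0.ne', ENNReal.rpow_one, ← ENNReal.rpow_mul, mul_one_div,
      ENNReal.mul_rpow_of_nonneg _ _ (by positivity)] at h1
    rw [mul_comm, withDensity_apply _ (measurableSet_centeredCube _ _),
      withDensity_apply _ (measurableSet_centeredCube _ _)]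
    exact h1
  have hω : ω ^ p * volume Q' ^ (1 / τ) ≤ c ^ p * ENNReal.ofReal A ^ p := by
    have h1 := ENNReal.rpow_le_rpow (annularNorm_mul_volume_le hu hW y hr j) hp0.le
    rw [ENNReal.mul_rpow_of_nonneg _ _ hp0.le, ← ENNReal.rpow_mul,
      ENNReal.mul_rpow_of_nonneg _ _ hp0.le] at h1
    convert h1 using 3
    rw [hτ]; field_simp
  calc _ ≤ (β ^ m * (ω * J ^ (1 / u))) ^ p * (C2 * μ Q) * μ Q' := by gcongr
    _ = (β ^ m) ^ p * ω ^ p * C2 * μ Q * μ Q' * (J ^ (1 / u)) ^ p := by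
        rw [ENNReal.mul_rpow_of_nonneg _ _ hp0.le, ENNReal.mul_rpow_of_nonneg _ _ hp0.le]; ring
    _ ≤ (β ^ m) ^ p * ω ^ p * C2 * μ Q * μ Q' *
        (F * (Λ ^ (m * p) * (C1 ^ ((1 - τ) / τ) * (μσ Q') ^ ((1 - τ) / τ)))) := by gcongr
    _ = (β ^ m) ^ p * C2 * μ Q * F * Λ ^ (m * p) * C1 ^ ((1 - τ) / τ) * ω ^ p *
        ((μσ Q') ^ ((1 - τ) / τ) * μ Q') := by ring
    _ ≤ (β ^ m) ^ p * C2 * μ Q * F * Λ ^ (m * p) * C1 ^ ((1 - τ) / τ) * ω ^ p *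
        (K ^ (1 / τ) * volume Q' ^ (1 / τ)) := by gcongr
    _ = (β ^ m) ^ p * C2 * μ Q * F * Λ ^ (m * p) * C1 ^ ((1 - τ) / τ) * K ^ (1 / τ) *
        (ω ^ p * volume Q' ^ (1 / τ)) := by ring
    _ ≤ (β ^ m) ^ p * C2 * μ Q * F * Λ ^ (m * p) * C1 ^ ((1 - τ) / τ) * K ^ (1 / τ) *
        (c ^ p * ENNReal.ofReal A ^ p) := by gcongr
    _ = _ := by
        rw [zero_mul, ENNReal.rpow_zero, mul_one]
        simp only [Λ]
        rw [ENNReal.mul_rpow_of_nonneg _ _ (by positivity)]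
        ring

theorem isHalfThin_volume : IsHalfThin (2⁻¹ : ℝ≥0∞) (volume : Measure (E n)) where
  ac := Measure.AbsolutelyContinuous.rfl
  le a l _ s _ _ h := by
    rwa [← ENNReal.div_eq_inv_mul, ENNReal.le_div_iff_mul_le (by simp) (by simp), mul_comm]

/-- Hölder lowers the exponent without touching c, so one lower bound serves all exponents up to r.
-/
theorem HasLowerMean.exists_forall_le {r : ℝ} {L : ℝ≥0∞} {v : E n → ℝ≥0∞}
    (h : HasLowerMean r L v) (a : E n) {l : ℝ} (hl : 0 < l) : ∃ c : ℝ≥0∞, c ≠ 0 ∧ c ≠ ∞ ∧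
      (∀ᵐ x ∂((volume : Measure (E n)).restrict (cube a l)), c ≤ v x) ∧
      ∀ s, 0 < s → s ≤ r → ∫⁻ x in cube a l, v x ^ s ≤ volume (cube a l) * (L * c) ^ s := by
  obtain ⟨c, hc0, hct, hcv, hint⟩ := h.exists_le a l hl
  exact ⟨c, hc0, hct, hcv, fun s hs hsr => lintegral_rpow_le_of_le hs hsr h.aemeasurable
    (volume_cube_ne_top a l) (volume_cube_pos a hl) hint⟩

/-- For p < u an `L^p` function need not be locally in `L^u`. The kernel is therefore split as
`|W|^(1/p') |W|^(1/p)`: Hölder leaves `|W| |f|^p`, and Fubini moves the kernel onto x, where v has a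
controlled u-th power mean because u ≤ r. This second integration produces `|Q| ^ (1/u)` where the
size of W calls for `|Q'| ^ (1/u)`; the mismatch is the growth rate `n (1 - 1/u)`. -/
theorem HasLowerMean.hasShellBound (hn : 1 ≤ n) {u p r : ℝ} (hp : 1 < p) (hpu : p < u)
    (hur : u ≤ r) (m : ℕ) {L : ℝ≥0∞} (hL : L ≠ ∞) {v : E n → ℝ≥0∞} (h : HasLowerMean r L v) :
    HasShellBound u p (n * (1 - 1 / u)) m (volume.withDensity v) := by
  have hu : 1 < u := by linarith
  have hu0 : 0 < u := by linarith
  have hp0 : 0 < p := by linarith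
  have hu1 : 0 ≤ 1 - 1 / u := by rw [sub_nonneg, div_le_one hu0]; exact hu.le
  have hpc := Real.HolderConjugate.conjExponent hp
  set p' := p.conjExponent
  have hp'0 : 0 < p' := hpc.symm.pos
  have hLu := (h.mono hu0 hur).isFair hu0 hL
  obtain ⟨θ, hθ, hH⟩ := IsFair.exists_isHalfThin (n := n) one_pos
    (ENNReal.rpow_ne_top_of_nonneg hu0.le hL)
  have hvu := hH _ hLu
  obtain ⟨C1, hC1, hm1⟩ := exists_lintegral_bmo_le (n := n) hn (θ := 2⁻¹) (by norm_num)
    (s := m * p' * u) (by positivity)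
  obtain ⟨C2, hC2, hm2⟩ := exists_lintegral_bmo_le hn hθ (s := m * p * u) (by positivity)
  set c : ℝ≥0∞ := 3 ^ (1 / u.conjExponent) * (8 ^ n) ^ (1 / u) with hc
  have hct : c ≠ ∞ := ENNReal.mul_ne_top
    (ENNReal.rpow_ne_top_of_nonneg
      (one_div_nonneg.2 (Real.HolderConjugate.conjExponent hu).symm.nonneg) (by norm_num))
    (ENNReal.rpow_ne_top_of_nonneg (by positivity) (by simp))
  set μ := volume.withDensity v
  set μu := volume.withDensity fun x => v x ^ u
  have hac : μ ≪ volume := withDensity_absolutelyContinuous _ _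
  refine ⟨c ^ p * (C1 ^ (1 / u)) ^ (p - 1) * C2 ^ (1 / u) * L ^ 2 * (2 ^ (n + 2)) ^ (m * p) *
    2 ^ (n * (1 - 1 / u) * 2), ?_, ?_⟩
  · have e1 : c ^ p ≠ ∞ := ENNReal.rpow_ne_top_of_nonneg hp0.le hct
    have e2 : (C1 ^ (1 / u)) ^ (p - 1) ≠ ∞ := ENNReal.rpow_ne_top_of_nonneg (by linarith)
      (ENNReal.rpow_ne_top_of_nonneg (by positivity) hC1)
    have e3 : C2 ^ (1 / u) ≠ ∞ := ENNReal.rpow_ne_top_of_nonneg (by positivity) hC2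
    have e4 : ((2 : ℝ≥0∞) ^ (n + 2)) ^ (m * p) ≠ ∞ :=
      ENNReal.rpow_ne_top_of_nonneg (by positivity) (by simp)
    have e5 : (2 : ℝ≥0∞) ^ (n * (1 - 1 / u) * 2) ≠ ∞ :=
      ENNReal.rpow_ne_top_of_nonneg (by positivity) (by simp)
    exact ENNReal.mul_ne_top (ENNReal.mul_ne_top (ENNReal.mul_ne_top (ENNReal.mul_ne_top
      (ENNReal.mul_ne_top e1 e2) e3) (ENNReal.pow_ne_top hL)) e4) e5
  intro A b W β hb hbβ hβ0 hβt hW y ρ hρ j f hf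
  have hbl := hb.locallyIntegrable
  have hbm := hbl.aestronglyMeasurable
  obtain ⟨cQ, -, -, hcQ, hiQ⟩ := h.exists_forall_le (WithLp.toLp 2 fun i => y i - ρ)
    (show 0 < 2 * ρ by positivity)
  obtain ⟨cQ', -, -, hcQ', hiQ'⟩ := h.exists_forall_le
    (WithLp.toLp 2 fun i => y i - 2 ^ (j + 2) * ρ) (show 0 < 2 * (2 ^ (j + 2) * ρ) by positivity)
  change ∀ᵐ x ∂(volume.restrict (centeredCube y ρ)), cQ ≤ v x at hcQ
  change ∀ s, 0 < s → s ≤ r → ∫⁻ x in centeredCube y ρ, v x ^ s ≤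
    volume (centeredCube y ρ) * (L * cQ) ^ s at hiQ
  change ∀ᵐ x ∂(volume.restrict (centeredCube y (2 ^ (j + 2) * ρ))), cQ' ≤ v x at hcQ'
  change ∀ s, 0 < s → s ≤ r → ∫⁻ x in centeredCube y (2 ^ (j + 2) * ρ), v x ^ s ≤
    volume (centeredCube y (2 ^ (j + 2) * ρ)) * (L * cQ') ^ s at hiQ'
  have hSQ' := shell_subset_centeredCube y ρ j
  have hBQ := ball_subset_centeredCube y ρ
  have hSm := measurableSet_shell y ρ j
  have hvol := volume_centeredCube_two_pow_mul y ρ (j + 2)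
  have hQm := measurableSet_centeredCube y ρ
  have hQm' := measurableSet_centeredCube y (2 ^ (j + 2) * ρ)
  set Q := centeredCube y ρ
  set Q' := centeredCube y (2 ^ (j + 2) * ρ)
  set S := shell y ρ j
  set B := Metric.ball y ρ
  set G := gauge b β y ρ
  set ω := annularNorm u W (2 ^ j * ρ)
  set Λ : ℝ≥0∞ := 2 ^ (n + 2) * (1 + j)
  have hGm : AEMeasurable G volume := aemeasurable_gauge hbm _ _ _
  have hfm := hf.enorm
  have hvm := h.aemeasurable
  have hωQ' := annularNorm_mul_volume_le hu hW y hρ j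
  set F := ∫⁻ x in S, ‖f x‖ₑ ^ p ∂μ with hF
  -- Fubini yields an unweighted integral of `|f|^p`; the lower bound of v on Q' returns it to the
  -- weighted one.
  have hFle : cQ' * ∫⁻ x in S, ‖f x‖ₑ ^ p ≤ F := by
    rw [hF, setLIntegral_withDensity_eq hvm hSm (hfm.pow_const p).restrict,
      ← lintegral_const_mul'' _ (hfm.pow_const p).restrict]
    refine lintegral_mono_ae ?_
    filter_upwards [ae_restrict_of_ae_restrict_of_subset hSQ' hcQ'] with x hx
    gcongr
  have hμQ : cQ * volume Q ≤ μ Q := by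
    rw [withDensity_apply _ hQm, ← setLIntegral_const]
    exact lintegral_mono_ae hcQ
  have hμQ' : μ Q' ≤ volume Q' * (L * cQ') := by
    rw [withDensity_apply _ hQm']
    simpa using hiQ' 1 one_pos (by linarith)
  -- H bounds the integral of `|W(x - z)| G(z)^(m p')` over the shell, uniformly in x ∈ B. The gauge
  -- moments here are with respect to Lebesgue measure, and `|Q'| ^ (1/u)` is absorbed by the
  -- annular norm.
  set H : ℝ≥0∞ := c * ENNReal.ofReal A * (Λ ^ (m * p') * C1 ^ (1 / u)) with hH
  set Φ : E n → ℝ≥0∞ := fun x => ∫⁻ z in S, ‖W (x - z)‖ₑ * ‖f z‖ₑ ^ p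
  have hker : AEMeasurable (fun q : E n × E n => ‖W (q.1 - q.2)‖ₑ * ‖f q.2‖ₑ ^ p)
      ((volume.restrict B).prod (volume.restrict S)) :=
    (aemeasurable_kernel hW.aestronglyMeasurable B S).mul
      ((hfm.pow_const p).restrict.comp_quasiMeasurePreserving
        Measure.quasiMeasurePreserving_snd)
  have hΦm : AEMeasurable Φ (volume.restrict B) := hker.lintegral_prod_right'
  have step1 : ∀ x ∈ B, kernelOp m b W S f x ^ p ≤
      ((β ^ m) ^ p * H ^ (p - 1)) * (G x ^ (m * p) * Φ x) := by
    intro x hx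
    have hWx : AEMeasurable (fun z => ‖W (x - z)‖ₑ) (volume.restrict S) :=
      (hW.aestronglyMeasurable.comp_quasiMeasurePreserving
        (quasiMeasurePreserving_sub_left volume x)).enorm.restrict
    have h1 : ∫⁻ z in S, ‖W (x - z)‖ₑ * (G z ^ m * ‖f z‖ₑ) ≤
        (∫⁻ z in S, ‖W (x - z)‖ₑ * G z ^ (m * p')) ^ (1 / p') * Φ x ^ (1 / p) := by
      calc _ = ∫⁻ z in S, (‖W (x - z)‖ₑ * G z ^ (m * p')) ^ (1 / p') *
            (‖W (x - z)‖ₑ * ‖f z‖ₑ ^ p) ^ (1 / p) := by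
            congr 1; ext z
            have hsum : 1 / p' + 1 / p = 1 := by
              rw [one_div, one_div]; exact hpc.symm.inv_add_inv_eq_one
            have eG : (G z ^ (m * p')) ^ (1 / p') = G z ^ m := by
              rw [← ENNReal.rpow_mul, mul_assoc, mul_one_div_cancel hp'0.ne', mul_one,
                ENNReal.rpow_natCast]
            have ef : (‖f z‖ₑ ^ p) ^ (1 / p) = ‖f z‖ₑ := by
              rw [← ENNReal.rpow_mul, mul_one_div_cancel hp0.ne', ENNReal.rpow_one]
            rw [ENNReal.mul_rpow_of_nonneg _ _ (by positivity),
              ENNReal.mul_rpow_of_nonneg _ _ (by positivity), eG, ef, mul_mul_mul_comm, ← ENNReal.rpow_add_of_nonneg _ _ (by positivity) (by positivity),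
              hsum, ENNReal.rpow_one]
        _ ≤ _ := ENNReal.lintegral_mul_norm_pow_le (hWx.mul (hGm.pow_const _).restrict)
            (hWx.mul (hfm.pow_const p).restrict) (by positivity) (by positivity)
            (by rw [one_div, one_div]; exact hpc.symm.inv_add_inv_eq_one)
    have h2 : ∫⁻ z in S, ‖W (x - z)‖ₑ * G z ^ (m * p') ≤ H := by
      calc _ ≤ ω * (∫⁻ z in S, (G z ^ (m * p')) ^ u) ^ (1 / u) :=
            lintegral_mul_le_annularNorm hu hSm
              (quasiMeasurePreserving_sub_left volume x) (fun h => lintegral_sub_left_eq_self h x)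
              hW.aestronglyMeasurable (fun z hz => norm_sub_of_mem_shell hx hz)
              (hGm.pow_const _).restrict
        _ ≤ ω * (Λ ^ (m * p' * u) * (C1 * volume Q')) ^ (1 / u) := by
            gcongr
            simp_rw [← ENNReal.rpow_mul]
            exact (lintegral_mono_set hSQ').trans
              (lintegral_gauge_rpow_le (by positivity) hbl hβ0 hβt hbβ y hρ j
                (hm1 volume isHalfThin_volume b hbl β hβ0 hβt hbβ _ _ (by positivity))
                Measure.AbsolutelyContinuous.rfl)
        _ = ω * volume Q' ^ (1 / u) * (Λ ^ (m * p') * C1 ^ (1 / u)) := by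
            rw [ENNReal.mul_rpow_of_nonneg (Λ ^ _) _ (by positivity),
              ENNReal.mul_rpow_of_nonneg C1 _ (by positivity), ← ENNReal.rpow_mul, mul_assoc,
              mul_one_div_cancel hu0.ne', mul_one]
            ring
        _ ≤ H := by rw [hH]; gcongr
    have h3 : kernelOp m b W S f x ≤ β ^ m * G x ^ m * (H ^ (1 / p') * Φ x ^ (1 / p)) := by
      refine (kernelOp_le hβ0 hβt hbm hW.aestronglyMeasurable hf S y ρ x).trans ?_
      gcongr
      refine h1.trans ?_
      gcongr
    refine (ENNReal.rpow_le_rpow h3 hp0.le).trans_eq ?_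
    have e1 : 1 / p' * p = p - 1 := by
      rw [one_div, ← hpc.one_sub_inv]; field_simp
    rw [ENNReal.mul_rpow_of_nonneg _ _ hp0.le, ENNReal.mul_rpow_of_nonneg _ _ hp0.le,
      ENNReal.mul_rpow_of_nonneg _ _ hp0.le, ← ENNReal.rpow_mul H, ← ENNReal.rpow_mul (Φ x),
      one_div_mul_cancel hp0.ne', ENNReal.rpow_one, e1, ← ENNReal.rpow_natCast (G x),
      ← ENNReal.rpow_mul (G x)]
    ring
  have hψm : AEMeasurable (fun x => v x * G x ^ (m * p)) volume := hvm.mul (hGm.pow_const _)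
  have step2 : ∀ z ∈ S, ∫⁻ x in B, ‖W (x - z)‖ₑ * (v x * G x ^ (m * p)) ≤
      ω * (C2 ^ (1 / u) * volume Q ^ (1 / u) * (L * cQ)) := by
    intro z hz
    refine (lintegral_mul_le_annularNorm hu measurableSet_ball
      (measurePreserving_sub_right volume z).quasiMeasurePreserving
      (fun h => lintegral_sub_right_eq_self h z)
      hW.aestronglyMeasurable (fun x hx => norm_sub_of_mem_shell hx hz) hψm.restrict).trans ?_
    gcongr
    have h1 : ∫⁻ x in B, (v x * G x ^ (m * p)) ^ u ≤ C2 * (volume Q * (L * cQ) ^ u) := by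
      calc _ ≤ ∫⁻ x in Q, v x ^ u * G x ^ (m * p * u) := by
            refine (lintegral_mono_set hBQ).trans_eq ?_
            congr 1; ext x
            rw [ENNReal.mul_rpow_of_nonneg _ _ hu0.le, ← ENNReal.rpow_mul]
        _ = ∫⁻ x in Q, G x ^ (m * p * u) ∂μu :=
            (setLIntegral_withDensity_eq (hvm.pow_const u) hQm (hGm.pow_const _).restrict).symm
        _ ≤ C2 * μu Q := hm2 μu hvu b hbl β hβ0 hβt hbβ _ _ (by positivity)
        _ ≤ _ := by
            rw [withDensity_apply _ hQm]
            gcongr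
            exact hiQ u hu0 hur
    refine (ENNReal.rpow_le_rpow h1 (by positivity)).trans_eq ?_
    rw [ENNReal.mul_rpow_of_nonneg _ _ (by positivity), ENNReal.mul_rpow_of_nonneg (volume Q) _
      (by positivity), ← ENNReal.rpow_mul, mul_one_div_cancel hu0.ne', ENNReal.rpow_one]
    ring
  set M : ℝ≥0∞ := (β ^ m) ^ p * H ^ (p - 1) with hM
  have step3 : ∫⁻ x in B, kernelOp m b W S f x ^ p ∂μ ≤
      M * (ω * (C2 ^ (1 / u) * volume Q ^ (1 / u) * (L * cQ)) * ∫⁻ x in S, ‖f x‖ₑ ^ p) := by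
    have hGΦ : AEMeasurable (fun x => G x ^ (m * p) * Φ x) (volume.restrict B) :=
      (hGm.pow_const _).restrict.mul hΦm
    calc _ ≤ ∫⁻ x in B, M * (G x ^ (m * p) * Φ x) ∂μ :=
          setLIntegral_mono' measurableSet_ball step1
      _ = ∫⁻ x in B, v x * (M * (G x ^ (m * p) * Φ x)) :=
          setLIntegral_withDensity_eq hvm measurableSet_ball (hGΦ.const_mul M)
      _ = M * ∫⁻ x in B, (v x * G x ^ (m * p)) * Φ x := by
          have h1 : AEMeasurable (fun x => (v x * G x ^ (m * p)) * Φ x) (volume.restrict B) :=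
            hψm.restrict.mul hΦm
          rw [← lintegral_const_mul'' _ h1]
          congr 1; ext x
          ring
      _ = M * ∫⁻ x in B, ∫⁻ z in S, ‖f z‖ₑ ^ p * (‖W (x - z)‖ₑ * (v x * G x ^ (m * p))) := by
          congr 2; ext x
          have hWx : AEMeasurable (fun z => ‖W (x - z)‖ₑ * ‖f z‖ₑ ^ p) (volume.restrict S) :=
            (hW.aestronglyMeasurable.comp_quasiMeasurePreserving
              (quasiMeasurePreserving_sub_left volume x)).enorm.restrict.mul
              (hfm.pow_const p).restrict
          simp only [Φ]
          rw [← lintegral_const_mul'' _ hWx]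
          congr 1; ext z
          ring
      _ = M * ∫⁻ z in S, ∫⁻ x in B, ‖f z‖ₑ ^ p * (‖W (x - z)‖ₑ * (v x * G x ^ (m * p))) := by
          congr 1
          refine lintegral_lintegral_swap ?_
          have h1 : AEMeasurable (fun q : E n × E n => ‖f q.2‖ₑ ^ p)
              ((volume.restrict B).prod (volume.restrict S)) :=
            (hfm.pow_const p).restrict.comp_quasiMeasurePreserving
              Measure.quasiMeasurePreserving_snd
          have h2 : AEMeasurable (fun q : E n × E n => v q.1 * G q.1 ^ (m * p))
              ((volume.restrict B).prod (volume.restrict S)) :=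
            hψm.restrict.comp_quasiMeasurePreserving
              Measure.quasiMeasurePreserving_fst
          exact h1.mul ((aemeasurable_kernel hW.aestronglyMeasurable B S).mul h2)
      _ ≤ M * ∫⁻ z in S, (ω * (C2 ^ (1 / u) * volume Q ^ (1 / u) * (L * cQ))) * ‖f z‖ₑ ^ p := by
          gcongr M * ?_
          refine setLIntegral_mono' hSm fun z hz => ?_
          have hWz : AEMeasurable (fun x => ‖W (x - z)‖ₑ * (v x * G x ^ (m * p)))
              (volume.restrict B) :=
            (hW.aestronglyMeasurable.comp_quasiMeasurePreserving
              (measurePreserving_sub_right volume z).quasiMeasurePreserving).enorm.restrict.mul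
              hψm.restrict
          rw [lintegral_const_mul'' _ hWz, mul_comm]
          gcongr
          exact step2 z hz
      _ = _ := by rw [lintegral_const_mul'' _ (hfm.pow_const p).restrict]
  -- Trading `|Q| ^ (1/u)` for `|Q'| ^ (1/u)` costs `2 ^ (n (1 - 1/u) (j + 2))`, the only
  -- exponential loss.
  have hQQ' : volume Q ^ (1 / u) * volume Q' =
      2 ^ (n * (1 - 1 / u) * 2) * 2 ^ (n * (1 - 1 / u) * j) * volume Q' ^ (1 / u) * volume Q := by
    have e1 : volume Q' = (2 : ℝ≥0∞) ^ ((n : ℝ) * (j + 2)) * volume Q := by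
      rw [hvol, ← ENNReal.rpow_natCast, ← ENNReal.rpow_natCast, ← ENNReal.rpow_mul]
      congr 2
      push_cast; ring
    have e2 : (2 : ℝ≥0∞) ^ ((n : ℝ) * (j + 2)) = 2 ^ (n * (1 - 1 / u) * 2) *
        2 ^ (n * (1 - 1 / u) * j) * 2 ^ ((n : ℝ) * (j + 2) * (1 / u)) := by
      rw [← ENNReal.rpow_add _ _ (by norm_num) (by norm_num),
        ← ENNReal.rpow_add _ _ (by norm_num) (by norm_num)]
      congr 1
      ring
    rw [e1, ENNReal.mul_rpow_of_nonneg _ (volume Q) (by positivity), ← ENNReal.rpow_mul]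
    calc _ = (2 : ℝ≥0∞) ^ ((n : ℝ) * (j + 2)) * volume Q ^ (1 / u) * volume Q := by ring
      _ = _ := by rw [e2]; ring
  have hMle : M * (ω * volume Q' ^ (1 / u)) ≤ (β ^ m) ^ p *
      (c ^ p * ENNReal.ofReal A ^ p * ((2 ^ (n + 2)) ^ (m * p) * (1 + j) ^ (m * p) *
        (C1 ^ (1 / u)) ^ (p - 1))) := by
    have hp1 : 0 ≤ p - 1 := by linarith
    have e1 : m * p' * (p - 1) = m * p := by
      rw [mul_assoc, mul_comm p', hpc.sub_one_mul_conj]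
    calc M * (ω * volume Q' ^ (1 / u)) ≤ M * (c * ENNReal.ofReal A) := by gcongr
      _ = (β ^ m) ^ p * (((c * ENNReal.ofReal A) ^ (p - 1) * (c * ENNReal.ofReal A) ^ (1 : ℝ)) *
          (Λ ^ (m * p) * (C1 ^ (1 / u)) ^ (p - 1))) := by
          rw [hM, hH, ENNReal.mul_rpow_of_nonneg (c * ENNReal.ofReal A) _ hp1,
            ENNReal.mul_rpow_of_nonneg (Λ ^ _) _ hp1, ← ENNReal.rpow_mul Λ, e1, ENNReal.rpow_one]
          ring
      _ = _ := by
          rw [← ENNReal.rpow_add_of_nonneg _ _ hp1 zero_le_one, sub_add_cancel,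
            ENNReal.mul_rpow_of_nonneg c _ hp0.le,
            ENNReal.mul_rpow_of_nonneg (2 ^ (n + 2)) (1 + (j : ℝ≥0∞)) (by positivity)]
  calc _ ≤ M * (ω * (C2 ^ (1 / u) * volume Q ^ (1 / u) * (L * cQ)) * ∫⁻ x in S, ‖f x‖ₑ ^ p) *
        (volume Q' * (L * cQ')) := by gcongr
    _ = M * ω * C2 ^ (1 / u) * L ^ 2 * cQ * (volume Q ^ (1 / u) * volume Q') *
        (cQ' * ∫⁻ x in S, ‖f x‖ₑ ^ p) := by ring
    _ ≤ M * ω * C2 ^ (1 / u) * L ^ 2 * cQ * (volume Q ^ (1 / u) * volume Q') * F := by gcongr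
    _ = C2 ^ (1 / u) * L ^ 2 * 2 ^ (n * (1 - 1 / u) * 2) * 2 ^ (n * (1 - 1 / u) * j) * F *
        (M * (ω * volume Q' ^ (1 / u))) * (cQ * volume Q) := by rw [hQQ']; ring
    _ ≤ C2 ^ (1 / u) * L ^ 2 * 2 ^ (n * (1 - 1 / u) * 2) * 2 ^ (n * (1 - 1 / u) * j) * F *
        ((β ^ m) ^ p * (c ^ p * ENNReal.ofReal A ^ p * ((2 ^ (n + 2)) ^ (m * p) *
          (1 + j) ^ (m * p) * (C1 ^ (1 / u)) ^ (p - 1)))) * μ Q := by gcongr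
    _ = _ := by ring

/-! ### Minkowski's inequality for sums and series -/

/-- The `L^p(μ)` norm of a function with values in `[0, ∞]`. -/
def lpNorm {α : Type*} [MeasurableSpace α] (p : ℝ) (μ : Measure α) (g : α → ℝ≥0∞) : ℝ≥0∞ :=
  (∫⁻ x, g x ^ p ∂μ) ^ (1 / p)

section LpNorm

variable {α : Type*} [MeasurableSpace α] {p : ℝ} {μ : Measure α}

theorem lpNorm_mono_ae (hp : 0 ≤ p) {f g : α → ℝ≥0∞} (h : ∀ᵐ x ∂μ, f x ≤ g x) :
    lpNorm p μ f ≤ lpNorm p μ g := by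
  unfold lpNorm
  refine ENNReal.rpow_le_rpow (lintegral_mono_ae ?_) (by positivity)
  filter_upwards [h] with x hx using ENNReal.rpow_le_rpow hx hp

theorem lpNorm_add_le (hp : 1 ≤ p) {f g : α → ℝ≥0∞} (hf : AEMeasurable f μ)
    (hg : AEMeasurable g μ) : lpNorm p μ (fun x => f x + g x) ≤ lpNorm p μ f + lpNorm p μ g :=
  ENNReal.lintegral_Lp_add_le hf hg hp

theorem lpNorm_sum_le (hp : 1 ≤ p) {g : ℕ → α → ℝ≥0∞} (hg : ∀ j, AEMeasurable (g j) μ) (J : ℕ) :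
    lpNorm p μ (fun x => ∑ j ∈ Finset.range J, g j x) ≤
      ∑ j ∈ Finset.range J, lpNorm p μ (g j) := by
  induction J with
  | zero =>
    have hp0 : 0 < p := by linarith
    simp [lpNorm, hp0]
  | succ J ih =>
    simp_rw [Finset.sum_range_succ]
    exact (lpNorm_add_le hp (Finset.aemeasurable_fun_sum _ fun j _ => hg j) (hg J)).trans (by gcongr)

/-- Fatou's lemma passes from the partial sums to the series. -/
theorem lpNorm_tsum_le (hp : 1 ≤ p) {g : ℕ → α → ℝ≥0∞} (hg : ∀ j, AEMeasurable (g j) μ) :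
    lpNorm p μ (fun x => ∑' j, g j x) ≤ ∑' j, lpNorm p μ (g j) := by
  have hp0 : 0 < p := by linarith
  have hlim : ∀ x, Tendsto (fun J => (∑ j ∈ Finset.range J, g j x) ^ p) atTop
      (𝓝 ((∑' j, g j x) ^ p)) := fun x =>
    (ENNReal.continuous_rpow_const.tendsto _).comp (ENNReal.tendsto_nat_tsum fun j => g j x)
  have h1 : ∫⁻ x, (∑' j, g j x) ^ p ∂μ ≤ (∑' j, lpNorm p μ (g j)) ^ p := by
    calc ∫⁻ x, (∑' j, g j x) ^ p ∂μ
        = ∫⁻ x, liminf (fun J => (∑ j ∈ Finset.range J, g j x) ^ p) atTop ∂μ := by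
          simp_rw [fun x => (hlim x).liminf_eq]
      _ ≤ liminf (fun J => ∫⁻ x, (∑ j ∈ Finset.range J, g j x) ^ p ∂μ) atTop :=
          lintegral_liminf_le' fun J =>
            (Finset.aemeasurable_fun_sum _ fun j _ => hg j).pow_const p
      _ ≤ _ := by
          refine liminf_le_of_frequently_le' (Frequently.of_forall fun J => ?_)
          have h2 := (lpNorm_sum_le hp hg J).trans (ENNReal.sum_le_tsum (Finset.range J))
          have h3 := ENNReal.rpow_le_rpow h2 hp0.le
          rwa [lpNorm, ← ENNReal.rpow_mul, one_div_mul_cancel hp0.ne', ENNReal.rpow_one] at h3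
  have h2 := ENNReal.rpow_le_rpow h1 (z := 1 / p) (by positivity)
  rwa [← ENNReal.rpow_mul, mul_one_div_cancel hp0.ne', ENNReal.rpow_one] at h2

theorem eLpNorm_ofReal_eq_lpNorm (hp : 0 < p) {F : Type*} [NormedAddCommGroup F] (f : α → F) :
    eLpNorm f (ENNReal.ofReal p) μ = lpNorm p μ (fun x => ‖f x‖ₑ) := by
  rw [eLpNorm_eq_lintegral_rpow_enorm_toReal (by simpa using hp) ENNReal.ofReal_ne_top,
    ENNReal.toReal_ofReal hp.le]
  rfl

end LpNorm

/-! ### From shell bounds to Morrey shell bounds -/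

theorem IsWeight.weightMeasure_ball_ne_zero {w : E n → ℝ} (hw : IsWeight w) (y : E n) {r : ℝ}
    (hr : 0 < r) : weightMeasure w (Metric.ball y r) ≠ 0 := by
  rw [weightMeasure, withDensity_apply _ measurableSet_ball]
  intro h
  rw [lintegral_eq_zero_iff'
    hw.locallyIntegrable.aestronglyMeasurable.aemeasurable.ennreal_ofReal.restrict] at h
  have h2 : ∀ᵐ x ∂(volume.restrict (Metric.ball y r)), False := by
    filter_upwards [h, ae_restrict_of_ae hw.pos] with x h1 h2
    simp only [Pi.zero_apply, ENNReal.ofReal_eq_zero] at h1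
    linarith
  rw [eventually_false_iff_eq_bot, ae_eq_bot, Measure.restrict_eq_zero] at h2
  exact (Metric.measure_ball_pos volume y hr).ne' h2

theorem IsWeight.weightMeasure_centeredCube_ne_top {w : E n → ℝ} (hw : IsWeight w) (y : E n)
    (r : ℝ) : weightMeasure w (centeredCube y r) ≠ ∞ := by
  rw [weightMeasure, withDensity_apply _ (measurableSet_centeredCube y r)]
  exact hw.lintegral_cube_ne_top _ _

theorem IsWeight.weightMeasure_ball_ne_top {w : E n → ℝ} (hw : IsWeight w) (y : E n) (r : ℝ) :
    weightMeasure w (Metric.ball y r) ≠ ∞ :=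
  ne_top_of_le_ne_top (hw.weightMeasure_centeredCube_ne_top y r)
    (measure_mono (ball_subset_centeredCube y r))

theorem weightMeasure_absolutelyContinuous (w : E n → ℝ) : weightMeasure w ≪ volume :=
  withDensity_absolutelyContinuous _ _

theorem lintegral_ball_le_morreyNorm {p lam : ℝ} (hp : 0 < p) {w : E n → ℝ} (hw : IsWeight w)
    (f : E n → ℂ) (y : E n) {r : ℝ} (hr : 0 < r) :
    ∫⁻ x in Metric.ball y r, ‖f x‖ₑ ^ p ∂(weightMeasure w) ≤
      morreyNorm p lam w f ^ p * weightMeasure w (Metric.ball y r) ^ lam := by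
  have h0 := hw.weightMeasure_ball_ne_zero y hr
  have ht := hw.weightMeasure_ball_ne_top y r
  have h : ((∫⁻ x in Metric.ball y r, ‖f x‖ₑ ^ p ∂(weightMeasure w)) /
      (weightMeasure w (Metric.ball y r)) ^ lam) ^ (1 / p) ≤ morreyNorm p lam w f :=
    le_iSup_of_le y (le_iSup_of_le r (le_iSup_of_le hr le_rfl))
  have h2 := ENNReal.rpow_le_rpow h hp.le
  rw [← ENNReal.rpow_mul, one_div_mul_cancel hp.ne', ENNReal.rpow_one] at h2
  rwa [ENNReal.div_le_iff (by simp [ENNReal.rpow_eq_zero_iff, h0, ht])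
    (ENNReal.rpow_ne_top_of_ne_zero h0 ht)] at h2

theorem indicator_mem_morreySpace {p lam : ℝ} (hp : 0 < p) {w : E n → ℝ} {f : E n → ℂ}
    (hf : f ∈ morreySpace p lam w) {s : Set (E n)} (hs : MeasurableSet s) :
    s.indicator f ∈ morreySpace p lam w := by
  refine ⟨hf.1.indicator hs, lt_of_le_of_lt ?_ hf.2⟩
  unfold morreyNorm
  gcongr with y r hr x
  rw [enorm_indicator_eq_indicator_enorm]
  exact indicator_le_self _ _ x

/-- The constant is the sum of a convergent series, which dominates each of its terms. -/
theorem exists_one_add_rpow_le (s : ℝ) {γ : ℝ} (hγ : 0 < γ) :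
    ∃ C : ℝ≥0∞, C ≠ ∞ ∧ ∀ j : ℕ, (1 + (j : ℝ≥0∞)) ^ s ≤ C * 2 ^ (γ * j) := by
  have hθ : (2 : ℝ≥0∞) ^ (-γ) < 1 := ENNReal.rpow_lt_one_of_one_lt_of_neg (by norm_num) (by linarith)
  obtain ⟨N, hN⟩ := exists_nat_ge s
  refine ⟨_, tsum_linear_rpow_mul_pow_ne_top 1 N hθ, fun j => ?_⟩
  have h := ENNReal.le_tsum (f := fun k : ℕ => (1 + (k + 1) * ((1 : ℕ) : ℝ≥0∞)) ^ (N : ℝ) *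
    ((2 : ℝ≥0∞) ^ (-γ)) ^ k) j
  calc (1 + (j : ℝ≥0∞)) ^ s ≤ (1 + (j + 1) * ((1 : ℕ) : ℝ≥0∞)) ^ (N : ℝ) := by
        refine (ENNReal.rpow_le_rpow_of_exponent_le le_self_add hN).trans ?_
        gcongr
        simp
    _ = (1 + (j + 1) * ((1 : ℕ) : ℝ≥0∞)) ^ (N : ℝ) * ((2 : ℝ≥0∞) ^ (-γ)) ^ j * 2 ^ (γ * j) := by
        rw [mul_assoc, ← ENNReal.rpow_natCast, ← ENNReal.rpow_mul,
          ← ENNReal.rpow_add _ _ (by norm_num) (by norm_num)]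
        simp
    _ ≤ _ := by gcongr

/-- The weighted Morrey form of a shell bound, with geometric decay. -/
def HasMorreyShellBound (u p lam γ : ℝ) (m : ℕ) (μ : Measure (E n)) : Prop :=
  ∃ C : ℝ≥0∞, C ≠ ∞ ∧ ∀ (A : ℝ) (b W : E n → ℂ) (β : ℝ≥0∞), IsBMO b → bmoNorm b ≤ β → β ≠ 0 →
    β ≠ ∞ → HasAnnularSize u A W → ∀ (y : E n) (r : ℝ), 0 < r → ∀ (j : ℕ) (f : E n → ℂ),
      AEStronglyMeasurable f volume →
      (∫⁻ x in Metric.ball y r, kernelOp m b W (shell y r j) f x ^ p ∂μ) *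
          μ (Metric.ball y (2 ^ (j + 2) * r)) ^ lam ≤
        C * ENNReal.ofReal A ^ p * (β ^ m) ^ p * 2 ^ (-(γ * j)) *
          μ (Metric.ball y r) ^ lam * ∫⁻ x in shell y r j, ‖f x‖ₑ ^ p ∂μ

/-- Multiplying the shell bound by `μ(Q') ^ (lam - 1)` leaves `(μ(Q) / μ(Q')) ^ (1 - lam)`, which
decays at rate `κ (1 - lam)` and beats η. Half of the net rate absorbs the polynomial factor in j,
and the other half is γ. -/
theorem HasShellBound.hasMorreyShellBound {u p lam η κ d : ℝ} {m : ℕ} (hlam0 : 0 < lam)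
    (hlam1 : lam < 1) (hκ0 : 0 ≤ κ) (hκ : η < κ * (1 - lam)) {w : E n → ℝ} (hw : IsWeight w)
    (h : HasShellBound u p η m (weightMeasure w)) {C1 C2 : ℝ≥0∞} (hC1 : C1 ≠ ∞) (hC2 : C2 ≠ ∞)
    (hdecay : ∀ (y : E n) (r : ℝ), 0 < r → ∀ j : ℕ, weightMeasure w (centeredCube y r) ≤
      C1 * 2 ^ (-(κ * j)) * weightMeasure w (centeredCube y (2 ^ j * r)))
    (hgrowth : ∀ (y : E n) (r : ℝ), 0 < r → ∀ j : ℕ, weightMeasure w (centeredCube y (2 ^ j * r)) ≤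
      C2 * 2 ^ (d * j) * weightMeasure w (Metric.ball y r)) :
    HasMorreyShellBound u p lam ((κ * (1 - lam) - η) / 2) m (weightMeasure w) := by
  obtain ⟨C, hC, hbound⟩ := h
  set γ := (κ * (1 - lam) - η) / 2 with hγ
  have hγ0 : 0 < γ := by rw [hγ]; linarith
  obtain ⟨C3, hC3, hpoly⟩ := exists_one_add_rpow_le (m * p) hγ0
  have h1lam : 0 < 1 - lam := by linarith
  refine ⟨C * C3 * C1 ^ (1 - lam) * C2 ^ lam, ENNReal.mul_ne_top (ENNReal.mul_ne_top
    (ENNReal.mul_ne_top hC hC3) (ENNReal.rpow_ne_top_of_nonneg h1lam.le hC1))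
    (ENNReal.rpow_ne_top_of_nonneg hlam0.le hC2), ?_⟩
  intro A b W β hb hbβ hβ0 hβt hW y r hr j f hf
  have key := hbound A b W β hb hbβ hβ0 hβt hW y r hr j f hf
  set μ := weightMeasure w
  set I := ∫⁻ x in Metric.ball y r, kernelOp m b W (shell y r j) f x ^ p ∂μ
  set F := ∫⁻ x in shell y r j, ‖f x‖ₑ ^ p ∂μ
  have hr' : 0 < 2 ^ (j + 2) * r := by positivity
  have hq'0 : μ (centeredCube y (2 ^ (j + 2) * r)) ≠ 0 := fun h0 =>
    hw.weightMeasure_ball_ne_zero y hr' (measure_mono_null (ball_subset_centeredCube y _) h0)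
  have hq't := hw.weightMeasure_centeredCube_ne_top y (2 ^ (j + 2) * r)
  have hq0 : μ (centeredCube y r) ≠ 0 := fun h0 =>
    hw.weightMeasure_ball_ne_zero y hr (measure_mono_null (ball_subset_centeredCube y _) h0)
  have hqt := hw.weightMeasure_centeredCube_ne_top y r
  have hqq' : μ (centeredCube y r) ≤
      C1 * 2 ^ (-(κ * j)) * μ (centeredCube y (2 ^ (j + 2) * r)) := by
    refine (hdecay y r hr (j + 2)).trans ?_
    gcongr
    · norm_num
    · omega
  have hqB : μ (centeredCube y r) ≤ C2 * μ (Metric.ball y r) := by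
    simpa using hgrowth y r hr 0
  have hB' : μ (Metric.ball y (2 ^ (j + 2) * r)) ≤ μ (centeredCube y (2 ^ (j + 2) * r)) :=
    measure_mono (ball_subset_centeredCube _ _)
  set q := μ (centeredCube y r)
  set q' := μ (centeredCube y (2 ^ (j + 2) * r))
  set Z := C * ENNReal.ofReal A ^ p * (β ^ m) ^ p
  have e1 : q ^ (1 - lam) * q' ^ (lam - 1) ≤ C1 ^ (1 - lam) * 2 ^ (-(κ * (1 - lam) * j)) := by
    calc q ^ (1 - lam) * q' ^ (lam - 1)
        ≤ (C1 * 2 ^ (-(κ * j)) * q') ^ (1 - lam) * q' ^ (lam - 1) := by gcongr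
      _ = C1 ^ (1 - lam) * 2 ^ (-(κ * (1 - lam) * j)) := by
        rw [ENNReal.mul_rpow_of_nonneg _ q' h1lam.le, ENNReal.mul_rpow_of_nonneg _ _ h1lam.le,
          ← ENNReal.rpow_mul, mul_assoc, ← ENNReal.rpow_add _ _ hq'0 hq't]
        simp only [sub_add_sub_cancel, sub_self, ENNReal.rpow_zero, mul_one]
        congr 2; ring
  calc I * μ (Metric.ball y (2 ^ (j + 2) * r)) ^ lam ≤ I * q' ^ lam := by gcongr
    _ = (I * q') * q' ^ (lam - 1) := by
        rw [mul_assoc]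
        congr 1
        conv_rhs => rw [← ENNReal.rpow_one q', ← ENNReal.rpow_mul, one_mul,
          ← ENNReal.rpow_add _ _ hq'0 hq't]
        congr 1; ring
    _ ≤ (Z * (1 + j) ^ (m * p) * 2 ^ (η * j) * q * F) * q' ^ (lam - 1) := by gcongr
    _ = Z * (1 + j) ^ (m * p) * 2 ^ (η * j) * F * q ^ lam * (q ^ (1 - lam) * q' ^ (lam - 1)) := by
        have : q = q ^ lam * q ^ (1 - lam) := by
          rw [← ENNReal.rpow_add _ _ hq0 hqt]; simp
        conv_lhs => rw [this]
        ring
    _ ≤ Z * (C3 * 2 ^ (γ * j)) * 2 ^ (η * j) * F * (C2 * μ (Metric.ball y r)) ^ lam *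
        (C1 ^ (1 - lam) * 2 ^ (-(κ * (1 - lam) * j))) := by
        gcongr
        exact hpoly j
    _ = Z * C3 * F * (C2 ^ lam * μ (Metric.ball y r) ^ lam) * C1 ^ (1 - lam) *
        ((2 : ℝ≥0∞) ^ (γ * j) * 2 ^ (η * j) * 2 ^ (-(κ * (1 - lam) * j))) := by
        rw [ENNReal.mul_rpow_of_nonneg C2 _ hlam0.le]; ring
    _ = Z * C3 * F * (C2 ^ lam * μ (Metric.ball y r) ^ lam) * C1 ^ (1 - lam) *
        (2 : ℝ≥0∞) ^ (-(γ * j)) := by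
        congr 1
        rw [← ENNReal.rpow_add _ _ (by norm_num) (by norm_num),
          ← ENNReal.rpow_add _ _ (by norm_num) (by norm_num)]
        congr 1
        rw [hγ]; ring
    _ = _ := by simp only [Z]; ring

/-! ### Decomposition along shells -/

theorem indicator_ball_succ (f : E n → ℂ) (y : E n) {r : ℝ} (hr : 0 < r) (j : ℕ) :
    (Metric.ball y (2 ^ (j + 2) * r)).indicator f =
      (Metric.ball y (2 ^ (j + 1) * r)).indicator f + (shell y r j).indicator f := by
  have hsub : Metric.ball y (2 ^ (j + 1) * r) ⊆ Metric.ball y (2 ^ (j + 2) * r) := by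
    refine Metric.ball_subset_ball ?_
    gcongr
    · norm_num
    · omega
  ext x
  by_cases h1 : x ∈ Metric.ball y (2 ^ (j + 1) * r)
  · have h2 : x ∉ shell y r j := fun h => h.2 h1
    rw [Pi.add_apply, indicator_of_mem (hsub h1), indicator_of_mem h1, indicator_of_notMem h2,
      add_zero]
  · rw [Pi.add_apply, indicator_of_notMem h1, zero_add]
    by_cases h2 : x ∈ Metric.ball y (2 ^ (j + 2) * r)
    · have h3 : x ∈ shell y r j := ⟨h2, h1⟩
      rw [indicator_of_mem h2, indicator_of_mem h3]
    · have h3 : x ∉ shell y r j := fun h => h2 h.1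
      rw [indicator_of_notMem h2, indicator_of_notMem h3]

theorem compl_ball_subset_iUnion_shell (y : E n) {r : ℝ} (hr : 0 < r) (J : ℕ) :
    (Metric.ball y (2 ^ (J + 1) * r))ᶜ ⊆ ⋃ i : ℕ, shell y r (i + J) := by
  intro x hx
  rw [mem_compl_iff, Metric.mem_ball, not_lt] at hx
  have hex : ∃ k : ℕ, dist x y < 2 ^ (k + 2) * r := by
    obtain ⟨k, hk⟩ := pow_unbounded_of_one_lt (dist x y / r) one_lt_two
    refine ⟨k, ?_⟩
    rw [div_lt_iff₀ hr] at hk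
    refine hk.trans_le ?_
    gcongr
    · norm_num
    · omega
  classical
  obtain ⟨k, hk, hmin⟩ : ∃ k : ℕ, dist x y < 2 ^ (k + 2) * r ∧
      ∀ i < k, ¬ dist x y < 2 ^ (i + 2) * r :=
    ⟨Nat.find hex, Nat.find_spec hex, fun i hi => Nat.find_min hex hi⟩
  have hJk : J ≤ k := by
    by_contra! hlt
    have : (2 : ℝ) ^ (k + 2) * r ≤ 2 ^ (J + 1) * r :=
      mul_le_mul_of_nonneg_right (pow_le_pow_right₀ one_le_two (by omega)) hr.le
    linarith
  refine mem_iUnion.2 ⟨k - J, ?_⟩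
  rw [Nat.sub_add_cancel hJk]
  refine ⟨hk, ?_⟩
  rw [Metric.mem_ball, not_lt]
  rcases hJk.eq_or_lt with h | h
  · rw [← h]; exact hx
  · have := hmin (k - 1) (by omega)
    rwa [not_lt, show k - 1 + 2 = k + 1 by omega] at this

theorem kernelOp_indicator (m : ℕ) (b W : E n → ℂ) {s : Set (E n)} (hs : MeasurableSet s)
    (f : E n → ℂ) (x : E n) :
    ∫⁻ z, ‖b x - b z‖ₑ ^ m * ‖W (x - z) * s.indicator f z‖ₑ = kernelOp m b W s f x := by
  rw [kernelOp, ← lintegral_indicator hs]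
  congr 1; ext z
  by_cases hz : z ∈ s
  · simp [hz]
  · simp [hz]

theorem kernelOp_compl_ball_le (m : ℕ) (b W : E n → ℂ) (f : E n → ℂ) (y : E n) {r : ℝ}
    (hr : 0 < r) (J : ℕ) (x : E n) :
    kernelOp m b W (Metric.ball y (2 ^ (J + 1) * r))ᶜ f x ≤
      ∑' i, kernelOp m b W (shell y r (i + J)) f x :=
  (lintegral_mono_set (compl_ball_subset_iUnion_shell y hr J)).trans (lintegral_iUnion_le _ _)

theorem aemeasurable_kernelOp {m : ℕ} {b W f : E n → ℂ} {μ : Measure (E n)} (hac : μ ≪ volume)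
    (hb : AEStronglyMeasurable b volume) (hW : AEStronglyMeasurable W volume)
    (hf : AEStronglyMeasurable f volume) (s : Set (E n)) : AEMeasurable (kernelOp m b W s f) μ := by
  refine AEMeasurable.mono_ac ?_ hac
  have h1 : AEStronglyMeasurable (fun q : E n × E n => b q.1)
      (volume.prod (volume.restrict s)) :=
    hb.comp_quasiMeasurePreserving Measure.quasiMeasurePreserving_fst
  have h2 : AEStronglyMeasurable (fun q : E n × E n => b q.2)
      (volume.prod (volume.restrict s)) :=
    hb.restrict.comp_quasiMeasurePreserving Measure.quasiMeasurePreserving_snd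
  have h3 : AEStronglyMeasurable (fun q : E n × E n => f q.2)
      (volume.prod (volume.restrict s)) :=
    hf.restrict.comp_quasiMeasurePreserving Measure.quasiMeasurePreserving_snd
  have h4 : AEStronglyMeasurable (fun q : E n × E n => W (q.1 - q.2))
      (volume.prod (volume.restrict s)) := by
    have := hW.comp_quasiMeasurePreserving (quasiMeasurePreserving_sub volume volume)
    refine this.mono_ac (Measure.AbsolutelyContinuous.prod Measure.AbsolutelyContinuous.rfl
      Measure.absolutelyContinuous_restrict)
  exact (((h1.sub h2).enorm.pow_const m).mul (h4.mul h3).enorm).lintegral_prod_right'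

/-- Splitting of `S f` along the shells around `ball y r`. -/
theorem IsSublinearOn.ae_enorm_le {p lam : ℝ} (hp : 0 < p) {w : E n → ℝ}
    {S : (E n → ℂ) → E n → ℂ} {m : ℕ} {b W : E n → ℂ}
    (hS : IsSublinearOn (morreySpace p lam w) S)
    (hdom : IsDominatedOn (morreySpace p lam w) m b W S) {f : E n → ℂ}
    (hf : f ∈ morreySpace p lam w) (y : E n) {r : ℝ} (hr : 0 < r) (J : ℕ) :
    ∀ᵐ x ∂(volume : Measure (E n)), ‖S f x‖ₑ ≤
      ‖S ((Metric.ball y (2 * r)).indicator f) x‖ₑ +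
        ∑ j ∈ Finset.range J, ‖S ((shell y r j).indicator f) x‖ₑ +
        ∑' i, kernelOp m b W (shell y r (i + J)) f x := by
  have hadd : ∀ g ∈ morreySpace p lam w, ∀ h ∈ morreySpace p lam w,
      ∀ᵐ x ∂(volume : Measure (E n)), ‖S (g + h) x‖ₑ ≤ ‖S g x‖ₑ + ‖S h x‖ₑ := by
    intro g hg h hh
    filter_upwards [hS.add_le g hg h hh] with x hx
    rw [← ofReal_norm, ← ofReal_norm, ← ofReal_norm,
      ← ENNReal.ofReal_add (norm_nonneg _) (norm_nonneg _)]
    exact ENNReal.ofReal_le_ofReal hx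
  have hmem : ∀ s : Set (E n), MeasurableSet s → s.indicator f ∈ morreySpace p lam w :=
    fun s hs => indicator_mem_morreySpace hp hf hs
  have hball : ∀ J : ℕ, ∀ᵐ x ∂(volume : Measure (E n)),
      ‖S ((Metric.ball y (2 ^ (J + 1) * r)).indicator f) x‖ₑ ≤
        ‖S ((Metric.ball y (2 * r)).indicator f) x‖ₑ +
          ∑ j ∈ Finset.range J, ‖S ((shell y r j).indicator f) x‖ₑ := by
    intro J
    induction J with
    | zero => simp
    | succ J ih =>
      filter_upwards [ih, hadd _ (hmem _ (measurableSet_ball (x := y) (ε := 2 ^ (J + 1) * r))) _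
        (hmem _ (measurableSet_shell y r J))] with x h1 h2
      rw [indicator_ball_succ f y hr J, Finset.sum_range_succ, ← add_assoc]
      exact h2.trans (by gcongr)
  -- Sublinearity gives only finite splittings. Everything outside the ball of radius `2 ^ (J + 1) *
  -- r` is kept as one function and dominated by the kernel, whose integral may be split over
  -- infinitely many shells.
  have htail := hdom _ (hmem _ (measurableSet_ball (x := y) (ε := 2 ^ (J + 1) * r)).compl)
  filter_upwards [hball J, htail,
    hadd _ (hmem _ (measurableSet_ball (x := y) (ε := 2 ^ (J + 1) * r))) _
      (hmem _ (measurableSet_ball (x := y) (ε := 2 ^ (J + 1) * r)).compl)] with x h1 h2 h3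
  rw [indicator_self_add_compl] at h3
  refine h3.trans (add_le_add h1 (h2.trans ?_))
  rw [kernelOp_indicator _ _ _ measurableSet_ball.compl]
  exact kernelOp_compl_ball_le m b W f y hr J x

/-! ### Interpolation between the two shell estimates and summation -/

theorem tsum_two_rpow_neg_mul_ne_top {γ : ℝ} (hγ : 0 < γ) :
    ∑' j : ℕ, (2 : ℝ≥0∞) ^ (-(γ * j)) ≠ ∞ := by
  have h : ∀ j : ℕ, (2 : ℝ≥0∞) ^ (-(γ * j)) = ((2 : ℝ≥0∞) ^ (-γ)) ^ j := fun j => by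
    rw [← ENNReal.rpow_natCast, ← ENNReal.rpow_mul, neg_mul]
  simp_rw [h]
  rw [ENNReal.tsum_geometric]
  have hθ : (2 : ℝ≥0∞) ^ (-γ) < 1 :=
    ENNReal.rpow_lt_one_of_one_lt_of_neg (by norm_num) (by linarith)
  rw [ENNReal.inv_ne_top]
  exact (tsub_pos_of_lt hθ).ne'

theorem le_rpow_mul_rpow_one_sub {x a b : ℝ≥0∞} {ε : ℝ} (h0 : 0 ≤ ε) (h1 : ε ≤ 1) (ha : x ≤ a)
    (hb : x ≤ b) : x ≤ a ^ ε * b ^ (1 - ε) :=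
  calc x = x ^ ε * x ^ (1 - ε) := by
        rw [← ENNReal.rpow_add_of_nonneg _ _ h0 (by linarith)]; simp
    _ ≤ _ := by gcongr

/-- On each of the first J shells the growing `L^p` estimate and the decaying kernel estimate are
interpolated; the shells beyond J use the kernel estimate alone. Here β is a positive finite bound
for the BMO seminorm, so that division by it is meaningful. -/
theorem exists_lpNorm_ball_le {u p lam γ d : ℝ} {m : ℕ} (hp : 1 < p)
    (hlam : 0 < lam) (hγ : 0 < γ) (hd : 0 ≤ d) {w : E n → ℝ} (hw : IsWeight w)
    (hbound : HasMorreyShellBound u p lam γ m (weightMeasure w)) {C2 : ℝ≥0∞} (hC2 : C2 ≠ ∞)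
    (hgrowth : ∀ (y : E n) (r : ℝ), 0 < r → ∀ j : ℕ, weightMeasure w (centeredCube y (2 ^ j * r)) ≤
      C2 * 2 ^ (d * j) * weightMeasure w (Metric.ball y r)) :
    ∃ ε : ℝ, 0 < ε ∧ ε < 1 ∧ ∀ A : ℝ, ∃ C : ℝ≥0∞, C ≠ ∞ ∧
      ∀ (b W : E n → ℂ) (S : (E n → ℂ) → E n → ℂ) (D β : ℝ≥0∞), IsBMO b → bmoNorm b ≤ β →
        β ≠ 0 → β ≠ ∞ → HasAnnularSize u A W → IsSublinearOn (morreySpace p lam w) S →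
        IsDominatedOn (morreySpace p lam w) m b W S → D ≠ ∞ →
        IsBoundedOnLp p w (D * bmoNorm b ^ m) S →
        ∀ f ∈ morreySpace p lam w, ∀ (y : E n) (r : ℝ), 0 < r →
          lpNorm p ((weightMeasure w).restrict (Metric.ball y r)) (fun x => ‖S f x‖ₑ) ≤
            C * (D + D ^ ε) * β ^ m * morreyNorm p lam w f *
              weightMeasure w (Metric.ball y r) ^ (lam / p) := by
  have hp0 : 0 < p := by linarith
  obtain ⟨C1, hC1, hb1⟩ := hbound
  set d' := d * lam / p with hd'
  have hd'0 : 0 ≤ d' := by positivity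
  set γ' := γ / p with hγ'
  have hγ'0 : 0 < γ' := by positivity
  -- This choice gives `d' ε - γ' (1 - ε) = -γ' / 2`, so the interpolated bounds still decay. It
  -- does not involve A.
  set ε := γ' / (2 * (d' + γ')) with hε
  have hε0 : 0 < ε := by positivity
  have hε1 : ε < 1 := by
    rw [hε, div_lt_one (by positivity)]; linarith
  refine ⟨ε, hε0, hε1, fun A => ?_⟩
  set c1 := C1 ^ (1 / p) * ENNReal.ofReal A with hc1
  have hc1t : c1 ≠ ∞ := ENNReal.mul_ne_top (ENNReal.rpow_ne_top_of_nonneg (by positivity) hC1)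
    ENNReal.ofReal_ne_top
  -- The factor `2 ^ (d' * 2)` accounts for shell j lying in the ball of radius `2 ^ (j + 2) * r`.
  set c2 := C2 ^ (lam / p) * 2 ^ (d' * 2) with hc2
  have hc2t : c2 ≠ ∞ := ENNReal.mul_ne_top (ENNReal.rpow_ne_top_of_nonneg (by positivity) hC2)
    (ENNReal.rpow_ne_top_of_nonneg (by positivity) (by simp))
  set c3 := c2 ^ ε * c1 ^ (1 - ε) * ∑' j : ℕ, (2 : ℝ≥0∞) ^ (-(γ' / 2 * j)) with hc3
  have hc3t : c3 ≠ ∞ := ENNReal.mul_ne_top (ENNReal.mul_ne_top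
    (ENNReal.rpow_ne_top_of_nonneg hε0.le hc2t)
    (ENNReal.rpow_ne_top_of_nonneg (by linarith) hc1t))
    (tsum_two_rpow_neg_mul_ne_top (by positivity))
  refine ⟨c2 + c3, ENNReal.add_ne_top.2 ⟨hc2t, hc3t⟩, ?_⟩
  intro b W S D β hb hbβ hβ0 hβt hW hS hdom hDt hLp f hf y r hr
  set μ := weightMeasure w with hμ
  have hac : μ ≪ volume := weightMeasure_absolutelyContinuous w
  set N := morreyNorm p lam w f
  have hNt : N ≠ ∞ := hf.2.ne
  set B := Metric.ball y r
  set ν := μ.restrict B with hν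
  have hacν : ν ≪ volume := Measure.restrict_le_self.absolutelyContinuous.trans hac
  have hBt : μ B ≠ ∞ := hw.weightMeasure_ball_ne_top y r
  set X := β ^ m * N * μ B ^ (lam / p) with hX
  have hXt : X ≠ ∞ := ENNReal.mul_ne_top (ENNReal.mul_ne_top (ENNReal.pow_ne_top hβt) hNt)
    (ENNReal.rpow_ne_top_of_nonneg (by positivity) hBt)
  have hSm : ∀ g ∈ morreySpace p lam w, AEMeasurable (fun x => ‖S g x‖ₑ) ν := fun g hg =>
    ((hS.aestronglyMeasurable g hg).mono_ac hacν).enorm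
  have hKm : ∀ j, AEMeasurable (kernelOp m b W (shell y r j) f) ν := fun j =>
    aemeasurable_kernelOp hacν hb.locallyIntegrable.aestronglyMeasurable hW.aestronglyMeasurable
      hf.1 _
  have hmem : ∀ s : Set (E n), MeasurableSet s → s.indicator f ∈ morreySpace p lam w :=
    fun s hs => indicator_mem_morreySpace hp0 hf hs
  have hLpj : ∀ (s : Set (E n)) (j : ℕ), MeasurableSet s → s ⊆ Metric.ball y (2 ^ j * r) →
      lpNorm p ν (fun x => ‖S (s.indicator f) x‖ₑ) ≤
        D * C2 ^ (lam / p) * 2 ^ (d' * j) * X := by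
    intro s j hs hsj
    have hjr : 0 < 2 ^ j * r := by positivity
    have h1 : lpNorm p μ (fun x => ‖s.indicator f x‖ₑ) ≤
        N * (C2 * 2 ^ (d * j) * μ B) ^ (lam / p) := by
      have h2 : ∫⁻ x, ‖s.indicator f x‖ₑ ^ p ∂μ ≤ N ^ p * (C2 * 2 ^ (d * j) * μ B) ^ lam := by
        calc ∫⁻ x, ‖s.indicator f x‖ₑ ^ p ∂μ = ∫⁻ x in s, ‖f x‖ₑ ^ p ∂μ := by
              rw [← lintegral_indicator hs]
              congr 1; ext x
              by_cases hx : x ∈ s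
              · simp [hx]
              · simp [hx, hp0]
          _ ≤ ∫⁻ x in Metric.ball y (2 ^ j * r), ‖f x‖ₑ ^ p ∂μ := lintegral_mono_set hsj
          _ ≤ N ^ p * μ (Metric.ball y (2 ^ j * r)) ^ lam :=
              lintegral_ball_le_morreyNorm hp0 hw f y hjr
          _ ≤ _ := by
              gcongr
              exact (measure_mono (ball_subset_centeredCube _ _)).trans (hgrowth y r hr j)
      refine (ENNReal.rpow_le_rpow h2 (z := 1 / p) (by positivity)).trans_eq ?_
      rw [ENNReal.mul_rpow_of_nonneg _ _ (by positivity), ← ENNReal.rpow_mul, ← ENNReal.rpow_mul,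
        mul_one_div_cancel hp0.ne', ENNReal.rpow_one, mul_one_div]
    have hfin : lpNorm p μ (fun x => ‖s.indicator f x‖ₑ) < ∞ := by
      refine h1.trans_lt (ENNReal.mul_lt_top hNt.lt_top (ENNReal.rpow_lt_top_of_nonneg
        (by positivity) (ENNReal.mul_ne_top (ENNReal.mul_ne_top hC2
        (ENNReal.rpow_ne_top_of_nonneg (by positivity) (by simp))) hBt)))
    have hmemLp : MemLp (s.indicator f) (ENNReal.ofReal p) μ :=
      ⟨(hmem s hs).1.mono_ac hac, by rwa [eLpNorm_ofReal_eq_lpNorm hp0]⟩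
    have h2 := hLp _ hmemLp
    rw [← hμ, eLpNorm_ofReal_eq_lpNorm hp0, eLpNorm_ofReal_eq_lpNorm hp0] at h2
    calc lpNorm p ν (fun x => ‖S (s.indicator f) x‖ₑ)
        ≤ lpNorm p μ (fun x => ‖S (s.indicator f) x‖ₑ) := by
          unfold lpNorm
          gcongr
          exact Measure.restrict_le_self
      _ ≤ D * bmoNorm b ^ m * (N * (C2 * 2 ^ (d * j) * μ B) ^ (lam / p)) := h2.trans (by gcongr)
      _ ≤ D * β ^ m * (N * (C2 * 2 ^ (d * j) * μ B) ^ (lam / p)) := by gcongr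
      _ = _ := by
          rw [ENNReal.mul_rpow_of_nonneg _ (μ B) (by positivity),
            ENNReal.mul_rpow_of_nonneg C2 _ (by positivity), ← ENNReal.rpow_mul,
            show d * j * (lam / p) = d' * j by rw [hd']; ring]
          ring
  have hKj : ∀ j : ℕ, lpNorm p ν (kernelOp m b W (shell y r j) f) ≤
      c1 * 2 ^ (-(γ' * j)) * X := by
    intro j
    have hjr : 0 < 2 ^ (j + 2) * r := by positivity
    have h0 := hw.weightMeasure_ball_ne_zero y hjr
    have ht := hw.weightMeasure_ball_ne_top y (2 ^ (j + 2) * r)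
    have h1 := hb1 A b W β hb hbβ hβ0 hβt hW y r hr j f hf.1
    have h2 : ∫⁻ x in shell y r j, ‖f x‖ₑ ^ p ∂μ ≤
        N ^ p * μ (Metric.ball y (2 ^ (j + 2) * r)) ^ lam :=
      (lintegral_mono_set (shell_subset_ball y r j)).trans
        (lintegral_ball_le_morreyNorm hp0 hw f y hjr)
    set q := μ (Metric.ball y (2 ^ (j + 2) * r)) ^ lam
    have hq0 : q ≠ 0 := (ENNReal.rpow_pos (pos_iff_ne_zero.2 h0) ht).ne'
    have hqt : q ≠ ∞ := ENNReal.rpow_ne_top_of_ne_zero h0 ht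
    have h3 : ∫⁻ x in B, kernelOp m b W (shell y r j) f x ^ p ∂μ ≤
        C1 * ENNReal.ofReal A ^ p * (β ^ m) ^ p * 2 ^ (-(γ * j)) * μ B ^ lam * N ^ p := by
      rw [← ENNReal.mul_le_mul_iff_left hq0 hqt]
      refine h1.trans ?_
      rw [mul_assoc _ (N ^ p)]
      gcongr
    refine (ENNReal.rpow_le_rpow h3 (z := 1 / p) (by positivity)).trans_eq ?_
    have hroot : ∀ x : ℝ≥0∞, (x ^ p) ^ (1 / p) = x := fun x => by
      rw [← ENNReal.rpow_mul, mul_one_div_cancel hp0.ne', ENNReal.rpow_one]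
    have hz : 0 ≤ 1 / p := by positivity
    rw [ENNReal.mul_rpow_of_nonneg _ _ hz, ENNReal.mul_rpow_of_nonneg _ _ hz,
      ENNReal.mul_rpow_of_nonneg _ _ hz, ENNReal.mul_rpow_of_nonneg _ _ hz,
      ENNReal.mul_rpow_of_nonneg _ _ hz, hroot, hroot, hroot, ← ENNReal.rpow_mul,
      ← ENNReal.rpow_mul, mul_one_div, mul_one_div, hc1, hX,
      show -(γ * j) / p = -(γ' * j) by rw [hγ']; ring]
    ring
  have hSj : ∀ j : ℕ, lpNorm p ν (fun x => ‖S ((shell y r j).indicator f) x‖ₑ) ≤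
      D ^ ε * (c2 ^ ε * c1 ^ (1 - ε) * 2 ^ (-(γ' / 2 * j))) * X := by
    intro j
    have h1 := hLpj (shell y r j) (j + 2) (measurableSet_shell y r j) (shell_subset_ball y r j)
    have h2 : lpNorm p ν (fun x => ‖S ((shell y r j).indicator f) x‖ₑ) ≤
        c1 * 2 ^ (-(γ' * j)) * X := by
      refine le_trans (lpNorm_mono_ae hp0.le ?_) (hKj j)
      refine hacν.ae_le ?_
      filter_upwards [hdom _ (hmem _ (measurableSet_shell y r j))] with x hx
      rwa [kernelOp_indicator _ _ _ (measurableSet_shell y r j)] at hx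
    refine (le_rpow_mul_rpow_one_sub hε0.le hε1.le h1 h2).trans_eq ?_
    have h1ε : 0 ≤ 1 - ε := by linarith
    have e1 : D * C2 ^ (lam / p) * 2 ^ (d' * ((j + 2 : ℕ) : ℝ)) * X =
        D * c2 * 2 ^ (d' * j) * X := by
      rw [hc2, show d' * ((j + 2 : ℕ) : ℝ) = d' * 2 + d' * j by push_cast; ring,
        ENNReal.rpow_add _ _ (by norm_num) (by norm_num)]
      ring
    have e2 : X = X ^ ε * X ^ (1 - ε) := by
      rw [← ENNReal.rpow_add_of_nonneg _ _ hε0.le h1ε]; simp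
    have e3 : (2 : ℝ≥0∞) ^ (-(γ' / 2 * j)) =
        2 ^ (d' * j * ε) * 2 ^ (-(γ' * j) * (1 - ε)) := by
      rw [← ENNReal.rpow_add _ _ (by norm_num) (by norm_num)]
      congr 1
      have : ε * (d' + γ') = γ' / 2 := by
        have : d' + γ' ≠ 0 := by positivity
        rw [hε]; field_simp
      linear_combination (-(j : ℝ)) * this
    rw [e1, ENNReal.mul_rpow_of_nonneg _ X hε0.le, ENNReal.mul_rpow_of_nonneg _ (2 ^ (d' * j)) hε0.le,
      ENNReal.mul_rpow_of_nonneg D _ hε0.le, ENNReal.mul_rpow_of_nonneg _ X h1ε,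
      ENNReal.mul_rpow_of_nonneg c1 _ h1ε, ← ENNReal.rpow_mul, ← ENNReal.rpow_mul, e3]
    conv_rhs => rw [e2]
    ring
  have hS0 : lpNorm p ν (fun x => ‖S ((Metric.ball y (2 * r)).indicator f) x‖ₑ) ≤ D * c2 * X := by
    have h1 := hLpj (Metric.ball y (2 * r)) 1 measurableSet_ball (by simp)
    refine h1.trans ?_
    have h2 : (2 : ℝ≥0∞) ^ (d' * ((1 : ℕ) : ℝ)) ≤ 2 ^ (d' * 2) :=
      ENNReal.rpow_le_rpow_of_exponent_le (by norm_num) (by gcongr; norm_num)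
    rw [hc2, ← mul_assoc D, hX]
    exact mul_le_mul_left (mul_le_mul_right h2 _) _
  -- The remainder carries no factor D, so it must vanish in the limit; being the tail of a
  -- convergent series, it does.
  have htail : Tendsto (fun J => ∑' i : ℕ, c1 * (2 : ℝ≥0∞) ^ (-(γ' * ((i + J : ℕ) : ℝ))) * X) atTop
      (𝓝 0) := by
    refine ENNReal.tendsto_sum_nat_add (fun j : ℕ => c1 * (2 : ℝ≥0∞) ^ (-(γ' * j)) * X) ?_
    rw [ENNReal.tsum_mul_right, ENNReal.tsum_mul_left]
    exact ENNReal.mul_ne_top (ENNReal.mul_ne_top hc1t (tsum_two_rpow_neg_mul_ne_top hγ'0)) hXt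
  have hsplit : ∀ J : ℕ, lpNorm p ν (fun x => ‖S f x‖ₑ) ≤
      (D * c2 * X + D ^ ε * c3 * X) +
        ∑' i : ℕ, c1 * (2 : ℝ≥0∞) ^ (-(γ' * ((i + J : ℕ) : ℝ))) * X := by
    intro J
    have hm0 := hSm _ (hmem _ (measurableSet_ball (x := y) (ε := 2 * r)))
    have hmj : ∀ j, AEMeasurable (fun x => ‖S ((shell y r j).indicator f) x‖ₑ) ν := fun j =>
      hSm _ (hmem _ (measurableSet_shell y r j))
    calc lpNorm p ν (fun x => ‖S f x‖ₑ)
        ≤ lpNorm p ν (fun x => ‖S ((Metric.ball y (2 * r)).indicator f) x‖ₑ +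
            ∑ j ∈ Finset.range J, ‖S ((shell y r j).indicator f) x‖ₑ +
            ∑' i, kernelOp m b W (shell y r (i + J)) f x) :=
          lpNorm_mono_ae hp0.le (hacν.ae_le (hS.ae_enorm_le hp0 hdom hf y hr J))
      _ ≤ lpNorm p ν (fun x => ‖S ((Metric.ball y (2 * r)).indicator f) x‖ₑ +
            ∑ j ∈ Finset.range J, ‖S ((shell y r j).indicator f) x‖ₑ) +
          lpNorm p ν (fun x => ∑' i, kernelOp m b W (shell y r (i + J)) f x) :=
          lpNorm_add_le hp.le (hm0.add (Finset.aemeasurable_fun_sum _ fun j _ => hmj j))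
            (AEMeasurable.tsum fun i => hKm (i + J))
      _ ≤ (lpNorm p ν (fun x => ‖S ((Metric.ball y (2 * r)).indicator f) x‖ₑ) +
            lpNorm p ν (fun x => ∑ j ∈ Finset.range J, ‖S ((shell y r j).indicator f) x‖ₑ)) +
          ∑' i, lpNorm p ν (kernelOp m b W (shell y r (i + J)) f) :=
          add_le_add (lpNorm_add_le hp.le hm0 (Finset.aemeasurable_fun_sum _ fun j _ => hmj j))
            (lpNorm_tsum_le hp.le fun i => hKm (i + J))
      _ ≤ _ := by
          refine add_le_add (add_le_add hS0 ?_) (ENNReal.tsum_le_tsum fun i => hKj (i + J))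
          refine ((lpNorm_sum_le hp.le hmj J).trans
            (Finset.sum_le_sum fun j _ => hSj j)).trans ?_
          refine (ENNReal.sum_le_tsum _).trans_eq ?_
          rw [ENNReal.tsum_mul_right, ENNReal.tsum_mul_left, ENNReal.tsum_mul_left]
  have hlim := ge_of_tendsto' (htail.const_add (D * c2 * X + D ^ ε * c3 * X)) hsplit
  rw [add_zero] at hlim
  calc _ ≤ _ := hlim
    _ ≤ (c2 + c3) * (D + D ^ ε) * X := by
        rw [← add_mul]
        gcongr
        rw [add_mul, mul_add, mul_add]
        calc D * c2 + D ^ ε * c3 = c2 * D + c3 * D ^ ε := by ring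
          _ ≤ _ := add_le_add le_self_add le_add_self
    _ = _ := by rw [hX]; ring

/-- Dividing the bound on each ball by `w(B) ^ (lam / p)` and taking the supremum gives the Morrey
norm; it remains to replace β by the BMO seminorm. -/
theorem exists_isBoundedOnMorrey {u p lam γ d : ℝ} {m : ℕ} (hp : 1 < p)
    (hlam : 0 < lam) (hγ : 0 < γ) (hd : 0 ≤ d) {w : E n → ℝ} (hw : IsWeight w)
    (hbound : HasMorreyShellBound u p lam γ m (weightMeasure w)) {C2 : ℝ≥0∞} (hC2 : C2 ≠ ∞)
    (hgrowth : ∀ (y : E n) (r : ℝ), 0 < r → ∀ j : ℕ, weightMeasure w (centeredCube y (2 ^ j * r)) ≤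
      C2 * 2 ^ (d * j) * weightMeasure w (Metric.ball y r)) :
    ∃ ε : ℝ, 0 < ε ∧ ε < 1 ∧ ∀ A : ℝ, ∃ C : ℝ, 0 < C ∧
      ∀ (b W : E n → ℂ) (S : (E n → ℂ) → E n → ℂ) (D : ℝ), IsBMO b →
        HasAnnularSize u A W → IsSublinearOn (morreySpace p lam w) S →
        IsDominatedOn (morreySpace p lam w) m b W S → 0 ≤ D →
        IsBoundedOnLp p w (ENNReal.ofReal D * bmoNorm b ^ m) S →
        IsBoundedOnMorrey p lam w (ENNReal.ofReal (C * (D + D ^ ε)) * bmoNorm b ^ m) S := by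
  have hp0 : 0 < p := by linarith
  obtain ⟨ε, hε0, hε1, h⟩ := exists_lpNorm_ball_le hp hlam hγ hd hw hbound hC2 hgrowth
  refine ⟨ε, hε0, hε1, fun A => ?_⟩
  obtain ⟨C, hC, hA⟩ := h A
  refine ⟨C.toReal + 1, by positivity, ?_⟩
  intro b W S D hb hW hS hdom hD hLp f hf
  set K := ENNReal.ofReal ((C.toReal + 1) * (D + D ^ ε)) with hK
  have hKC : C * (ENNReal.ofReal D + ENNReal.ofReal D ^ ε) ≤ K := by
    rw [ENNReal.ofReal_rpow_of_nonneg hD hε0.le, ← ENNReal.ofReal_add hD (by positivity), hK,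
      ENNReal.ofReal_mul (by positivity)]
    gcongr
    rw [ENNReal.ofReal_add ENNReal.toReal_nonneg zero_le_one, ENNReal.ofReal_toReal hC]
    exact le_self_add
  have hNt : morreyNorm p lam w f ≠ ∞ := hf.2.ne
  have hβ : ∀ β : ℝ≥0∞, bmoNorm b ≤ β → β ≠ 0 → β ≠ ∞ →
      morreyNorm p lam w (S f) ≤ K * β ^ m * morreyNorm p lam w f := by
    intro β hbβ hβ0 hβt
    refine iSup_le fun y => iSup_le fun r => iSup_le fun hr => ?_
    have h1 := hA b W S (ENNReal.ofReal D) β hb hbβ hβ0 hβt hW hS hdom ENNReal.ofReal_ne_top hLp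
      f hf y r hr
    have h0 := hw.weightMeasure_ball_ne_zero y hr
    have ht := hw.weightMeasure_ball_ne_top y r
    rw [ENNReal.div_rpow_of_nonneg _ _ (by positivity), ← ENNReal.rpow_mul, mul_one_div,
      ENNReal.div_le_iff (by simp [ENNReal.rpow_eq_zero_iff, h0, ht])
        (ENNReal.rpow_ne_top_of_ne_zero h0 ht)]
    refine h1.trans ?_
    gcongr
  have hle : morreyNorm p lam w (S f) ≤ K * bmoNorm b ^ m * morreyNorm p lam w f := by
    -- The seminorm may vanish and is then not an admissible β, so β decreases to it; the finiteness
    -- of the constant and of the Morrey norm of f makes the bound continuous in β.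
    have hlim : Tendsto (fun k : ℕ => bmoNorm b + ((k : ℝ≥0∞) + 1)⁻¹) atTop (𝓝 (bmoNorm b)) := by
      have h1 : Tendsto (fun k : ℕ => (((k + 1 : ℕ) : ℝ≥0∞))⁻¹) atTop (𝓝 0) :=
        (tendsto_add_atTop_iff_nat 1).2 ENNReal.tendsto_inv_nat_nhds_zero
      simpa using h1.const_add (bmoNorm b)
    have hlim2 := ENNReal.Tendsto.mul_const
      (ENNReal.Tendsto.const_mul ((ENNReal.continuous_pow m).tendsto _ |>.comp hlim)
        (Or.inr (show K ≠ ∞ from ENNReal.ofReal_ne_top)))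
      (Or.inr hNt)
    refine ge_of_tendsto' hlim2 fun k => hβ _ le_self_add (by simp) ?_
    exact ENNReal.add_ne_top.2 ⟨hb.bmoNorm_lt_top.ne, by simp⟩
  refine ⟨⟨hS.aestronglyMeasurable f hf, hle.trans_lt ?_⟩, hle⟩
  exact ENNReal.mul_lt_top (ENNReal.mul_lt_top ENNReal.ofReal_lt_top
    (ENNReal.pow_lt_top hb.bmoNorm_lt_top)) hf.2

end WeightedMorrey

end

/-! ### The two cases of the theorem -/

theorem lemma4p1 (n : ℕ) (hn : 1 ≤ n) (u : ℝ) (hu : 1 < u) (m : ℕ) :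
    (∀ (p lam : ℝ) (w : WeightedMorrey.E n → ℝ), u < p → 0 < lam → lam < 1 →
      WeightedMorrey.IsAp (p / u) w →
      ∃ ε : ℝ, 0 < ε ∧ ε < 1 ∧ ∀ A : ℝ, ∃ C : ℝ, 0 < C ∧
        ∀ (b W : WeightedMorrey.E n → ℂ)
          (S : (WeightedMorrey.E n → ℂ) → WeightedMorrey.E n → ℂ) (D : ℝ),
          WeightedMorrey.IsBMO b →
          WeightedMorrey.HasAnnularSize u A W →
          WeightedMorrey.IsSublinearOn (WeightedMorrey.morreySpace p lam w) S →
          WeightedMorrey.IsDominatedOn (WeightedMorrey.morreySpace p lam w) m b W S →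
          0 ≤ D →
          WeightedMorrey.IsBoundedOnLp p w
            (ENNReal.ofReal D * WeightedMorrey.bmoNorm b ^ m) S →
          WeightedMorrey.IsBoundedOnMorrey p lam w
            (ENNReal.ofReal (C * (D + D ^ ε)) * WeightedMorrey.bmoNorm b ^ m) S) ∧
    (∀ (p lam r : ℝ) (w : WeightedMorrey.E n → ℝ), 1 < p → p < u → u < r →
      0 < lam → lam < 1 - r.conjExponent / u.conjExponent →
      WeightedMorrey.IsWeight w → WeightedMorrey.IsA1 (fun x => w x ^ r) →
      ∃ ε : ℝ, 0 < ε ∧ ε < 1 ∧ ∀ A : ℝ, ∃ C : ℝ, 0 < C ∧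
        ∀ (b W : WeightedMorrey.E n → ℂ)
          (S : (WeightedMorrey.E n → ℂ) → WeightedMorrey.E n → ℂ) (D : ℝ),
          WeightedMorrey.IsBMO b →
          WeightedMorrey.HasAnnularSize u A W →
          WeightedMorrey.IsSublinearOn (WeightedMorrey.morreySpace p lam w) S →
          WeightedMorrey.IsDominatedOn (WeightedMorrey.morreySpace p lam w) m b W S →
          0 ≤ D →
          WeightedMorrey.IsBoundedOnLp p w
            (ENNReal.ofReal D * WeightedMorrey.bmoNorm b ^ m) S →
          WeightedMorrey.IsBoundedOnMorrey p lam w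
            (ENNReal.ofReal (C * (D + D ^ ε)) * WeightedMorrey.bmoNorm b ^ m) S) := by
  have hu0 : 0 < u := by linarith
  have hn0 : (0 : ℝ) < n := by exact_mod_cast hn
  constructor
  · intro p lam w hup hlam0 hlam1 hw
    have hp0 : 0 < p := by linarith
    obtain ⟨K, hK, hpair⟩ := hw.isMuckenhouptPair ((one_lt_div hu0).2 hup)
    rw [one_div_div] at hpair
    have hτ0 : 0 < u / p := by positivity
    have hτ1 : u / p < 1 := (div_lt_one hp0).2 hup
    have hfair := hpair.isFair hτ0 hτ1
    obtain ⟨θ, hθ, hthin⟩ := WeightedMorrey.IsFair.exists_isHalfThin (n := n) hτ0 hK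
    obtain ⟨κ, hκ0, hdecay⟩ := WeightedMorrey.IsHalfThin.exists_measure_centeredCube_le hn hθ
    obtain ⟨C2, hC2, hgrowth⟩ :=
      WeightedMorrey.IsFair.exists_measure_centeredCube_le (n := n) hτ0 hK
    -- Here η = 0, so the unspecified positive rate κ coming from half-thinness suffices for every
    -- lam < 1.
    have hκ : 0 < κ * (1 - lam) := mul_pos hκ0 (by linarith)
    have hshell := (hpair.hasShellBound hn hu hup m hK).hasMorreyShellBound hlam0 hlam1 hκ0.le hκ
      hw.1 ENNReal.one_ne_top hC2
      (fun y r hr j => by rw [one_mul]; exact hdecay _ (hthin _ hfair) y r hr j)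
      (hgrowth _ hfair)
    exact WeightedMorrey.exists_isBoundedOnMorrey (by linarith) hlam0 (by linarith)
      (by positivity) hw.1 hshell hC2 (hgrowth _ hfair)
  · intro p lam r w hp hpu hur hlam0 hlam hw hA1
    have hr : 1 < r := by linarith
    have hr0 : 0 < r := by linarith
    obtain ⟨L, hL, hmean⟩ := hA1.hasLowerMean hr0 hw
    have hfair := (hmean.mono one_pos hr.le).isFair one_pos hL
    simp only [ENNReal.rpow_one] at hfair
    obtain ⟨C2, hC2, hgrowth⟩ :=
      WeightedMorrey.IsFair.exists_measure_centeredCube_le (n := n) one_pos hL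
    have hru : 0 ≤ 1 - 1 / r := by
      rw [sub_nonneg, div_le_one hr0]; exact hr.le
    -- Since `r' / u' = (1 - 1/u) / (1 - 1/r)`, this is precisely the hypothesis `lam < 1 - r' /
    -- u'`.
    have hκ : n * (1 - 1 / u) < n * (1 - 1 / r) * (1 - lam) := by
      have h1 : (1 - 1 / r) * (r.conjExponent / u.conjExponent) = 1 - 1 / u := by
        have : r - 1 ≠ 0 := by linarith
        have : u - 1 ≠ 0 := by linarith
        unfold Real.conjExponent
        field_simp
      have h2 : 0 < 1 - 1 / r := by rw [sub_pos, div_lt_one hr0]; exact hr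
      rw [mul_assoc, ← h1]
      gcongr
      linarith
    have hlam1 : lam < 1 := by
      have h1 := (Real.HolderConjugate.conjExponent hr).symm.pos
      have h2 := (Real.HolderConjugate.conjExponent hu).symm.pos
      have : 0 < r.conjExponent / u.conjExponent := by positivity
      linarith
    have hshell := (hmean.hasShellBound hn hp hpu hur.le m hL).hasMorreyShellBound hlam0 hlam1
      (by positivity) hκ hw hL hC2
      (fun y ρ hρ j => by
        have := hmean.lintegral_centeredCube_le hr y hρ j
        rwa [WeightedMorrey.weightMeasure,
          withDensity_apply _ (WeightedMorrey.measurableSet_centeredCube _ _),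
          withDensity_apply _ (WeightedMorrey.measurableSet_centeredCube _ _)])
      (hgrowth _ hfair)
    exact WeightedMorrey.exists_isBoundedOnMorrey hp hlam0 (by linarith) (by positivity) hw
      hshell hC2 (hgrowth _ hfair)
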